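/- **Setting.** Let $k$ be a field. A *tensor category* over $k$ is a $k$-linear abelian monoidal category $\mathcal C$ whose tensor product is $k$-bilinear and exact in each variable and with $\dim_k\operatorname{End}(\mathbf 1)=1$. A (left) *$\mathcal C$-module category* is a $k$-linear abelian category $\mathcal M$ with a bifunctor $\otimes:\mathcal C\times\mathcal M\to\mathcal M$, $k$-bilinear and exact in each variable, together with natural coherent associativity and unit isomorphisms. Let $G$ be a group. A *$G$-grading* of $\mathcal C$ is a decomposition $\mathcal C=\bigoplus_{\sigma\in G}\mathcal C_\sigma$ into full subcategories (closed under isomorphisms and finite direct sums, with no nonzero morphisms between different components, every object being a finite direct sum of homogeneous ones) such that $\mathcal C_\sigma\otimes\mathcal C_\tau\subseteq\mathcal C_{\sigma\tau}$. Let $\mathcal C_\sigma\cdot\mathcal C_\tau$ be the full subcategory of $\mathcal C_{\sigma\tau}$ whose objects are the finite direct sums of objects $V\otimes W$ with $V\in\mathcal C_\sigma$, $W\in\mathcal C_\tau$. The category $\mathcal C$ is *strongly $G$-graded* if the inclusion $\mathcal C_\sigma\cdot\mathcal C_\tau\to\mathcal C_{\sigma\tau}$ is an equivalence for all $\sigma,\tau\in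 G$. For $S\subseteq G$ put $\mathcal C_S=\bigoplus_{\sigma\in S}\mathcal C_\sigma$. For a left $G$-set $X$, an *$X$-graded $\mathcal C$-module category* is a $\mathcal C$-module category $\mathcal M$ with a decomposition $\mathcal M=\bigoplus_{x\in X}\mathcal M_x$ (in the same sense) such that $\mathcal C_\sigma\otimes\mathcal M_x\subseteq\mathcal M_{\sigma x}$. Let $H$ be a subgroup of $G$, so that $\mathcal C_H$ is a tensor subcategory of $\mathcal C$, and let $A$ be an (associative, unital) algebra in $\mathcal C_H$. Let $\mathcal C_A$ and $(\mathcal C_H)_A$ be the categories of right $A$-modules in $\mathcal C$ and in $\mathcal C_H$, with left actions of $\mathcal C$ and of $\mathcal C_H$ given by $V\otimes(M,\rho)=(V\otimes M,(\mathrm{id}_V\otimes\rho)\circ a_{V,M,A})$, where $a$ is the associativity constraint of $\mathcal C$. For a $\mathcal C_H$-module category $\mathcal N$, let $\mathcal C\boxtimes_{\mathcal C_H}\mathcal N$ be the $k$-linear category whose objects are the finite direct sums of symbols $[V,Y]$, $V\in\mathcal C$, $Y\in\mathcal N$, and whose morphisms are matrices of linear combinations of composites of the generators $[f,g]:[V,Y]\to[V',Y']$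 (for $f:V\to V'$, $g:Y\to Y'$), $\alpha_{V,S,Y}:[V\otimes S,Y]\to[V,S\otimes Y]$ (for $S\in\mathcal C_H$) and a formal inverse of $\alpha_{V,S,Y}$, subject to: $[f,g]$ is $k$-bilinear in $(f,g)$; $[f'f,g'g]=[f',g'][f,g]$ and $[\mathrm{id},\mathrm{id}]=\mathrm{id}$; naturality $\alpha_{V',S',Y'}[f\otimes u,g]=[f,u\otimes g]\,\alpha_{V,S,Y}$ for $u:S\to S'$; and coherence: with $\alpha$, the associativity constraints $a$ of $\mathcal C$ and $n$ of $\mathcal N$, the two morphisms $[\mathrm{id}_V,n_{S,T,Y}]\,\alpha_{V,S\otimes T,Y}\,[a_{V,S,T},\mathrm{id}_Y]$ and $\alpha_{V,S,T\otimes Y}\,\alpha_{V\otimes S,T,Y}$ from $[(V\otimes S)\otimes T,Y]$ to $[V,S\otimes(T\otimes Y)]$ coincide. The category $\mathcal C$ acts on it by $X\otimes[V,Y]=[X\otimes V,Y]$. For a coset $x\in G/H$, let $(\mathcal C\boxtimes_{\mathcal C_H}\mathcal N)_x$ consist of the objects that are finite direct sums of symbols $[V,Y]$ with $V\in\mathcal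 C_x=\bigoplus_{\tau\in x}\mathcal C_\tau$, and let $(\mathcal C_A)_x$ consist of the modules $(M,\rho)$ with $M\in\mathcal C_x$. **Proposition.** Let $\mathcal C$ be a strongly $G$-graded tensor category, $H\subseteq G$ a subgroup and $A$ an algebra in $\mathcal C_H$. Then, with these actions and gradings, $\mathcal C\boxtimes_{\mathcal C_H}(\mathcal C_H)_A$ and $\mathcal C_A$ are $G/H$-graded $\mathcal C$-module categories, and they are equivalent as such: there is a $k$-linear equivalence of categories $$F:\mathcal C\boxtimes_{\mathcal C_H}(\mathcal C_H)_A\longrightarrow\mathcal C_A$$ that carries a structure of $\mathcal C$-module functor (coherent natural isomorphisms $X\otimes F(Z)\cong F(X\otimes Z)$) and satisfies, for every coset $x\in G/H$ and every object $Z$, $Z\in(\mathcal C\boxtimes_{\mathcal C_H}(\mathcal C_H)_A)_x$ if and only if $F(Z)\in(\mathcal C_A)_x$. -/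

import Mathlib

open CategoryTheory CategoryTheory.Limits MonoidalCategory

noncomputable section

namespace TensorClifford

/-! ### Direct sums and gradings -/

section Sums

variable {M : Type*} [Category* M] [Preadditive M]

/-- `X` is a (finite) direct sum of the objects `V j`, with inclusions `i j` and projections `p j`. -/
def IsDirectSum {J : Type} [Fintype J] (V : J → M) (X : M) : Prop :=
  ∃ (i : ∀ j, V j ⟶ X) (p : ∀ j, X ⟶ V j),
    (∀ j, i j ≫ p j = 𝟙 (V j)) ∧ (∀ j j', j ≠ j' → i j ≫ p j' = 0) ∧ ∑ j, p j ≫ i j = 𝟙 X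

/-- The objects that are finite direct sums (possibly empty) of objects satisfying `P`. -/
def sumsOf (P : ObjectProperty M) : ObjectProperty M := fun X =>
  ∃ (J : Type) (_ : Fintype J) (V : J → M), (∀ j, P (V j)) ∧ IsDirectSum V X

/-- A decomposition `M = ⨁ₓ Mₓ` of a `k`-linear category into a direct sum of full subcategories
`Mₓ`: each `Mₓ` is closed under isomorphisms and finite direct sums, there are no nonzero morphisms
between different components, and every object is a finite direct sum of homogeneous ones.
If `M` is abelian, each `Mₓ` is then automatically closed under subobjects and quotients in `M`,
so it is a full abelian subcategory. -/
structure IsGrading {X : Type*} (comp : X → ObjectProperty M) : Prop where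
  iso : ∀ x, (comp x).IsClosedUnderIsomorphisms
  sums : ∀ x, sumsOf (comp x) ≤ comp x
  hom_eq_zero : ∀ {x y : X}, x ≠ y → ∀ {V W : M}, comp x V → comp y W → ∀ f : V ⟶ W, f = 0
  total : ∀ V : M, sumsOf (fun W => ∃ x, comp x W) V

theorem sumsOf_mono {P Q : ObjectProperty M} (h : P ≤ Q) : sumsOf P ≤ sumsOf Q := by
  rintro X ⟨J, hJ, V, hV, hX⟩
  exact ⟨J, hJ, V, fun j => h _ (hV j), hX⟩

theorem sumsOf_of {P : ObjectProperty M} {X : M} (h : P X) : sumsOf P X :=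
  ⟨Unit, inferInstance, fun _ => X, fun _ => h, fun _ => 𝟙 X, fun _ => 𝟙 X, by simp, by simp,
    by simp⟩

end Sums

section Tensor

/-- The remaining axioms of a tensor category over the field `k`, for a `k`-linear abelian category
with a `k`-bilinear monoidal structure: the tensor product is exact in each variable and the
endomorphism algebra of the unit object is one-dimensional. -/
class TensorCategory (k : Type*) [Field k] (C : Type*) [Category* C] [Abelian C] [Linear k C]
    [MonoidalCategory C] [MonoidalPreadditive C] [MonoidalLinear k C] : Prop where
  tensorLeft_limits : ∀ X : C, PreservesFiniteLimits (tensorLeft X)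
  tensorLeft_colimits : ∀ X : C, PreservesFiniteColimits (tensorLeft X)
  tensorRight_limits : ∀ X : C, PreservesFiniteLimits (tensorRight X)
  tensorRight_colimits : ∀ X : C, PreservesFiniteColimits (tensorRight X)
  finrank_end_unit : Module.finrank k (𝟙_ C ⟶ 𝟙_ C) = 1

/-- A `G`-grading `C = ⨁ C_σ` of a tensor category over `k`, with `C_σ ⊗ C_τ ⊆ C_{στ}`. -/
structure TensorGrading (k : Type*) [Field k] (G : Type*) [Group G] (C : Type*) [Category* C]
    [Abelian C] [Linear k C] [MonoidalCategory C] [MonoidalPreadditive C] [MonoidalLinear k C]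
    [TensorCategory k C] where
  comp : G → ObjectProperty C
  isGrading : IsGrading comp
  tensor_mem : ∀ {σ τ : G} {V W : C}, comp σ V → comp τ W → comp (σ * τ) (V ⊗ W)

namespace TensorGrading

variable {k : Type*} [Field k] {G : Type*} [Group G] {C : Type*} [Category* C] [Abelian C]
  [Linear k C] [MonoidalCategory C] [MonoidalPreadditive C] [MonoidalLinear k C]
  [TensorCategory k C] (gr : TensorGrading k G C)

/-- The full subcategory `⨁_{σ ∈ S} C_σ`. -/
def restrict (S : Set G) : ObjectProperty C := sumsOf (fun V => ∃ σ ∈ S, gr.comp σ V)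

/-- The tensor subcategory `C_H = ⨁_{h ∈ H} C_h`. -/
def sub (H : Subgroup G) : ObjectProperty C := gr.restrict (H : Set G)

/-- The full subcategory `C_σ · C_τ`, whose objects are the direct sums of objects `V ⊗ W` with
`V` in `C_σ` and `W` in `C_τ`. -/
def prod (σ τ : G) : ObjectProperty C :=
  sumsOf (fun X => ∃ V W : C, gr.comp σ V ∧ gr.comp τ W ∧ X = V ⊗ W)

theorem prod_le (σ τ : G) : gr.prod σ τ ≤ gr.comp (σ * τ) := by
  refine le_trans (sumsOf_mono ?_) (gr.isGrading.sums _)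
  rintro _ ⟨V, W, hV, hW, rfl⟩
  exact gr.tensor_mem hV hW

/-- `C` is strongly graded: the inclusion functors `C_σ · C_τ ⥤ C_{στ}` are equivalences. -/
def IsStrong : Prop :=
  ∀ σ τ : G, (ObjectProperty.ιOfLE (gr.prod_le σ τ)).IsEquivalence

theorem unit_mem : gr.comp 1 (𝟙_ C) := by
  have hfin := TensorCategory.finrank_end_unit (k := k) (C := C)
  have hne : 𝟙 (𝟙_ C) ≠ 0 := by
    intro h
    have : Subsingleton (𝟙_ C ⟶ 𝟙_ C) := ⟨fun f g => by
      rw [← Category.comp_id f, ← Category.comp_id g, h, comp_zero, comp_zero]⟩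
    rw [Module.finrank_zero_of_subsingleton] at hfin
    exact zero_ne_one hfin
  have hsc := (finrank_eq_one_iff_of_nonzero' (𝟙 (𝟙_ C)) hne).1 hfin
  obtain ⟨J, _, V, hV, i, p, hip, -, htot⟩ := gr.isGrading.total (𝟙_ C)
  obtain ⟨j, hj⟩ : ∃ j, p j ≫ i j ≠ 0 := by
    by_contra! h
    apply hne
    rw [← htot, Finset.sum_eq_zero fun j _ => h j]
  obtain ⟨c, hc⟩ := hsc (p j ≫ i j)
  have hc0 : c ≠ 0 := by rintro rfl; exact hj (by rw [← hc, zero_smul])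
  have hidem : (p j ≫ i j) ≫ (p j ≫ i j) = p j ≫ i j := by
    rw [Category.assoc, ← Category.assoc (i j), hip, Category.id_comp]
  have h1 : p j ≫ i j = 𝟙 _ := by
    rw [← hc, Linear.smul_comp, Category.id_comp] at hidem
    have h2 := congrArg (fun f => c⁻¹ • f) hidem
    simp only [inv_smul_smul₀ hc0] at h2
    rw [← hc, h2]
  obtain ⟨x, hx⟩ := hV j
  have e : V j ≅ 𝟙_ C := ⟨i j, p j, hip j, h1⟩
  have hx1 : gr.comp x (𝟙_ C) := (gr.isGrading.iso x).of_iso e hx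
  by_cases hxx : x * x = x
  · rwa [mul_eq_left.1 hxx] at hx1
  · exfalso
    have h0 := gr.isGrading.hom_eq_zero hxx (gr.tensor_mem hx1 hx1) hx1 (λ_ (𝟙_ C)).hom
    apply hne
    rw [← (λ_ (𝟙_ C)).inv_hom_id, h0, comp_zero]

theorem restrict_tensor {S T U : Set G} (h : ∀ s ∈ S, ∀ t ∈ T, s * t ∈ U) {V W : C}
    (hV : gr.restrict S V) (hW : gr.restrict T W) : gr.restrict U (V ⊗ W) := by
  obtain ⟨J, _, A, hA, i, p, h1, h2, h3⟩ := hV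
  obtain ⟨J', _, B, hB, i', p', h1', h2', h3'⟩ := hW
  refine ⟨J × J', inferInstance, fun j => A j.1 ⊗ B j.2, ?_, fun j => i j.1 ⊗ₘ i' j.2,
    fun j => p j.1 ⊗ₘ p' j.2, ?_, ?_, ?_⟩
  · rintro ⟨j, j'⟩
    obtain ⟨s, hs, hsA⟩ := hA j
    obtain ⟨t, ht, htB⟩ := hB j'
    exact ⟨s * t, h s hs t ht, gr.tensor_mem hsA htB⟩
  · rintro ⟨j, j'⟩
    simp [h1, h1']
  · rintro ⟨a, b⟩ ⟨a', b'⟩ hne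
    by_cases ha : a = a'
    · have hb : b ≠ b' := by rintro rfl; exact hne (by rw [ha])
      simp [h2' _ _ hb]
    · simp [h2 _ _ ha]
  · simp only [tensorHom_comp_tensorHom, Fintype.sum_prod_type]
    simp only [← tensor_sum, ← sum_tensor, h3, h3', id_tensorHom_id]

instance (H : Subgroup G) : (gr.sub H).IsMonoidal where
  prop_unit := sumsOf_of (P := fun V => ∃ σ ∈ (H : Set G), gr.comp σ V) ⟨1, H.one_mem, gr.unit_mem⟩
  prop_tensor _ _ hV hW := gr.restrict_tensor (fun _ hs _ ht => H.mul_mem hs ht) hV hW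

end TensorGrading

end Tensor

/-! ### The regular right action of a tensor subcategory -/

section SubAction

variable {C : Type*} [Category* C] [MonoidalCategory C] (P : ObjectProperty C) [P.IsMonoidal]

/-- A monoidal full subcategory of `C` acts on `C` on the right through the tensor product. -/
@[simps!]
instance subRightAction : MonoidalRightAction P.FullSubcategory C where
  actionObj X V := X ⊗ V.obj
  actionHomRight X _ _ f := X ◁ f.hom
  actionHomLeft f V := f ▷ V.obj
  actionHom f g := f ⊗ₘ g.hom
  actionAssocIso X V W := (α_ X V.obj W.obj).symm
  actionUnitIso X := ρ_ X
  actionHom_def f g := by simp [MonoidalCategory.tensorHom_def]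

end SubAction

/-! ### Right modules over an algebra -/

section Modules

variable {C : Type*} [Category* C] [MonoidalCategory C]

/-- A right module over the algebra `A` in the monoidal category `C`. -/
structure RightMod (A : C) [MonObj A] where
  X : C
  act : X ⊗ A ⟶ X
  act_one : X ◁ MonObj.one ≫ act = (ρ_ X).hom
  act_act : act ▷ A ≫ act = (α_ X A A).hom ≫ X ◁ MonObj.mul ≫ act

namespace RightMod

variable {A : C} [MonObj A]

/-- Morphisms of right `A`-modules. -/
@[ext]
structure Hom (M N : RightMod A) where
  hom : M.X ⟶ N.X
  comm : M.act ≫ hom = hom ▷ A ≫ N.act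

@[simps id_hom comp_hom]
instance : Category (RightMod A) where
  Hom M N := Hom M N
  id M := ⟨𝟙 M.X, by simp⟩
  comp f g := ⟨f.hom ≫ g.hom, by
    rw [← Category.assoc, f.comm, Category.assoc, g.comm, comp_whiskerRight, Category.assoc]⟩

@[ext]
theorem hom_ext {M N : RightMod A} {f g : M ⟶ N} (h : f.hom = g.hom) : f = g := Hom.ext h

/-- An isomorphism of modules from an isomorphism of the underlying objects. -/
@[simps]
def isoMk {M N : RightMod A} (e : M.X ≅ N.X) (h : M.act ≫ e.hom = e.hom ▷ A ≫ N.act) : M ≅ N where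
  hom := ⟨e.hom, h⟩
  inv := ⟨e.inv, by
    rw [Iso.comp_inv_eq, Category.assoc, h, ← comp_whiskerRight_assoc, e.inv_hom_id,
      id_whiskerRight, Category.id_comp]⟩

section Preadditive

variable [Preadditive C] [MonoidalPreadditive C]

instance (M N : RightMod A) : Zero (M ⟶ N) := ⟨⟨0, by simp⟩⟩

instance (M N : RightMod A) : Add (M ⟶ N) :=
  ⟨fun f g => ⟨f.hom + g.hom, by simp [f.comm, g.comm]⟩⟩

instance (M N : RightMod A) : Neg (M ⟶ N) := ⟨fun f => ⟨-f.hom, by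
  have h : (-f.hom) ▷ A = -(f.hom ▷ A) := (tensorRight A).map_neg
  simp [f.comm, h]⟩⟩

instance (M N : RightMod A) : Sub (M ⟶ N) := ⟨fun f g => ⟨f.hom - g.hom, by
  have h : (f.hom - g.hom) ▷ A = f.hom ▷ A - g.hom ▷ A := (tensorRight A).map_sub
  simp [f.comm, g.comm, h]⟩⟩

@[simp] theorem zero_hom (M N : RightMod A) : (0 : M ⟶ N).hom = 0 := rfl
@[simp] theorem add_hom {M N : RightMod A} (f g : M ⟶ N) : (f + g).hom = f.hom + g.hom := rfl
@[simp] theorem neg_hom {M N : RightMod A} (f : M ⟶ N) : (-f).hom = -f.hom := rfl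
@[simp] theorem sub_hom {M N : RightMod A} (f g : M ⟶ N) : (f - g).hom = f.hom - g.hom := rfl

instance (M N : RightMod A) : AddCommGroup (M ⟶ N) where
  add_assoc f g h := by ext; simp [add_assoc]
  zero_add f := by ext; simp
  add_zero f := by ext; simp
  nsmul := nsmulRec
  zsmul := zsmulRec
  neg_add_cancel f := by ext; simp
  add_comm f g := by ext; simp [add_comm]
  sub_eq_add_neg f g := by ext; simp [sub_eq_add_neg]

instance : Preadditive (RightMod A) where
  add_comp _ _ _ f g h := by ext; simp
  comp_add _ _ _ f g h := by ext; simp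

variable {k : Type*} [Field k] [Linear k C] [MonoidalLinear k C]

instance (M N : RightMod A) : SMul k (M ⟶ N) :=
  ⟨fun a f => ⟨a • f.hom, by simp [f.comm]⟩⟩

@[simp] theorem smul_hom {M N : RightMod A} (a : k) (f : M ⟶ N) : (a • f).hom = a • f.hom := rfl

instance : Linear k (RightMod A) where
  homModule M N :=
    { one_smul := fun f => by ext; simp
      mul_smul := fun a b f => by ext; simp [mul_smul]
      smul_zero := fun a => by ext; simp
      smul_add := fun a f g => by ext; simp
      add_smul := fun a b f => by ext; simp [add_smul]
      zero_smul := fun f => by ext; simp }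
  smul_comp _ _ _ a f g := by ext; simp
  comp_smul _ _ _ f a g := by ext; simp

end Preadditive

/-- The module `V ⊗ M`. -/
@[simps]
def tens (V : C) (M : RightMod A) : RightMod A where
  X := V ⊗ M.X
  act := (α_ V M.X A).hom ≫ V ◁ M.act
  act_one := by
    have h := congrArg (fun f => V ◁ f) M.act_one
    simp only [whiskerLeft_comp] at h
    rw [tensor_whiskerLeft, Category.assoc, Category.assoc, Iso.inv_hom_id_assoc, h]
    simp
  act_act := by
    simp only [comp_whiskerRight, whisker_assoc, Category.assoc, Iso.inv_hom_id_assoc,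
      ← whiskerLeft_comp, M.act_act]
    simp

/-- Right `A`-modules in `C` form a left `C`-module category, with `V ⊗ (M, ρ)` the object
`V ⊗ M` with the `A`-action `(V ⊗ ρ) ∘ α`. -/
instance : MonoidalLeftAction C (RightMod A) where
  actionObj V M := tens V M
  actionHomLeft {V W} f M := ⟨f ▷ M.X, by
    change ((α_ V M.X A).hom ≫ V ◁ M.act) ≫ f ▷ M.X =
      f ▷ M.X ▷ A ≫ (α_ W M.X A).hom ≫ W ◁ M.act
    simp [whisker_exchange]⟩
  actionHomRight V M N f := ⟨V ◁ f.hom, by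
    change ((α_ V M.X A).hom ≫ V ◁ M.act) ≫ V ◁ f.hom =
      (V ◁ f.hom) ▷ A ≫ (α_ V N.X A).hom ≫ V ◁ N.act
    simp [← whiskerLeft_comp, f.comm]⟩
  actionAssocIso V W M := isoMk (α_ V W M.X) (by
    change ((α_ (V ⊗ W) M.X A).hom ≫ (V ⊗ W) ◁ M.act) ≫ (α_ V W M.X).hom =
      (α_ V W M.X).hom ▷ A ≫ (α_ V (W ⊗ M.X) A).hom ≫ V ◁ ((α_ W M.X A).hom ≫ W ◁ M.act)
    simp)
  actionUnitIso M := isoMk (λ_ M.X) (by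
    change ((α_ (𝟙_ C) M.X A).hom ≫ (𝟙_ C) ◁ M.act) ≫ (λ_ M.X).hom = (λ_ M.X).hom ▷ A ≫ M.act
    simp)
  actionHom_def _ _ := rfl
  actionHomRight_id V M := hom_ext (whiskerLeft_id V M.X)
  id_actionHomLeft V M := hom_ext (id_whiskerRight V M.X)
  actionHom_comp {_ _ c''} {d d' _} f₁ f₂ g₁ g₂ := hom_ext <| by
    change (f₁ ≫ f₂) ▷ d.X ≫ c'' ◁ (g₁.hom ≫ g₂.hom) =
      (f₁ ▷ d.X ≫ _ ◁ g₁.hom) ≫ f₂ ▷ d'.X ≫ c'' ◁ g₂.hom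
    simp [whisker_exchange_assoc]
  actionAssocIso_hom_naturality {_ c₂ _ c₄ d₁ _} f g h := hom_ext <| by
    change ((f ⊗ₘ g) ▷ d₁.X ≫ (c₂ ⊗ c₄) ◁ h.hom) ≫ (α_ _ _ _).hom =
      (α_ _ _ _).hom ≫ f ▷ (_ ⊗ d₁.X) ≫ c₂ ◁ (g ▷ d₁.X ≫ c₄ ◁ h.hom)
    simp [MonoidalCategory.tensorHom_def]
  actionUnitIso_hom_naturality {M N} f := hom_ext <| by
    change (λ_ M.X).hom ≫ f.hom = (𝟙_ C) ◁ f.hom ≫ (λ_ N.X).hom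
    simp
  whiskerLeft_actionHomLeft c _ _ f M := hom_ext <| by
    change (c ◁ f) ▷ M.X = (α_ _ _ _).hom ≫ c ◁ f ▷ M.X ≫ (α_ _ _ _).inv
    simp
  whiskerRight_actionHomLeft c f M := hom_ext <| by
    change (f ▷ c) ▷ M.X = (α_ _ _ _).hom ≫ f ▷ (c ⊗ M.X) ≫ (α_ _ _ _).inv
    simp
  associator_actionHom c₁ c₂ c₃ M := hom_ext (pentagon c₁ c₂ c₃ M.X)
  leftUnitor_actionHom c M := hom_ext <| by
    change (λ_ c).hom ▷ M.X = (α_ _ _ _).hom ≫ (λ_ (c ⊗ M.X)).hom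
    simp
  rightUnitor_actionHom c M := hom_ext <| by
    change (ρ_ c).hom ▷ M.X = (α_ _ _ _).hom ≫ c ◁ (λ_ M.X).hom
    simp

end RightMod

end Modules

/-! ### The tensor product of module categories, by generators and relations -/

section Balanced

open scoped MonoidalLeftAction MonoidalRightAction

/-- The symbols `[X, Y]` for objects `X` of `M` and `Y` of `N`. -/
structure Sym (k D M N : Type*) where
  left : M
  right : N

section

variable {k D M N : Type*} [Field k] [Category* D] [MonoidalCategory D]
  [Category* M] [Preadditive M] [Linear k M] [MonoidalRightAction D M]
  [Category* N] [Preadditive N] [Linear k N] [MonoidalLeftAction D N]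

namespace Sym

/-- Formal `k`-linear combinations of formal composites of the generating morphisms `[f, g]`,
`α_{X,V,Y} : [X ⊗ V, Y] ⟶ [X, V ⊗ Y]` and `α_{X,V,Y}⁻¹`. -/
inductive Pre : Sym k D M N → Sym k D M N → Type _
  | id (p : Sym k D M N) : Pre p p
  | comp {p q r : Sym k D M N} : Pre p q → Pre q r → Pre p r
  | zero (p q : Sym k D M N) : Pre p q
  | add {p q : Sym k D M N} : Pre p q → Pre p q → Pre p q
  | smul {p q : Sym k D M N} : k → Pre p q → Pre p q
  | gen {X X' : M} {Y Y' : N} (f : X ⟶ X') (g : Y ⟶ Y') : Pre ⟨X, Y⟩ ⟨X', Y'⟩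
  | bal (X : M) (V : D) (Y : N) : Pre ⟨X ⊙ᵣ V, Y⟩ ⟨X, V ⊙ₗ Y⟩
  | balInv (X : M) (V : D) (Y : N) : Pre ⟨X, V ⊙ₗ Y⟩ ⟨X ⊙ᵣ V, Y⟩

/-- The smallest `k`-linear congruence that makes the formal morphisms a `k`-linear category and
imposes linearity, functoriality, invertibility of `α`, naturality and coherence. -/
inductive Rel : ∀ {p q : Sym k D M N}, Pre p q → Pre p q → Prop
  | refl {p q : Sym k D M N} (a : Pre p q) : Rel a a
  | symm {p q : Sym k D M N} {a b : Pre p q} : Rel a b → Rel b a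
  | trans {p q : Sym k D M N} {a b c : Pre p q} : Rel a b → Rel b c → Rel a c
  | comp_congr {p q r : Sym k D M N} {a a' : Pre p q} {b b' : Pre q r} :
      Rel a a' → Rel b b' → Rel (a.comp b) (a'.comp b')
  | add_congr {p q : Sym k D M N} {a a' b b' : Pre p q} :
      Rel a a' → Rel b b' → Rel (a.add b) (a'.add b')
  | smul_congr {p q : Sym k D M N} (t : k) {a a' : Pre p q} :
      Rel a a' → Rel (a.smul t) (a'.smul t)
  -- category axioms
  | id_comp {p q : Sym k D M N} (a : Pre p q) : Rel ((Pre.id p).comp a) a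
  | comp_id {p q : Sym k D M N} (a : Pre p q) : Rel (a.comp (Pre.id q)) a
  | assoc {p q r s : Sym k D M N} (a : Pre p q) (b : Pre q r) (c : Pre r s) :
      Rel ((a.comp b).comp c) (a.comp (b.comp c))
  -- vector space axioms
  | add_assoc {p q : Sym k D M N} (a b c : Pre p q) : Rel ((a.add b).add c) (a.add (b.add c))
  | add_comm {p q : Sym k D M N} (a b : Pre p q) : Rel (a.add b) (b.add a)
  | zero_add {p q : Sym k D M N} (a : Pre p q) : Rel ((Pre.zero p q).add a) a
  | one_smul {p q : Sym k D M N} (a : Pre p q) : Rel (a.smul 1) a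
  | mul_smul {p q : Sym k D M N} (s t : k) (a : Pre p q) :
      Rel (a.smul (s * t)) ((a.smul t).smul s)
  | smul_add {p q : Sym k D M N} (t : k) (a b : Pre p q) :
      Rel ((a.add b).smul t) ((a.smul t).add (b.smul t))
  | add_smul {p q : Sym k D M N} (s t : k) (a : Pre p q) :
      Rel (a.smul (s + t)) ((a.smul s).add (a.smul t))
  | zero_smul {p q : Sym k D M N} (a : Pre p q) : Rel (a.smul 0) (Pre.zero p q)
  -- bilinearity of the composition
  | add_comp {p q r : Sym k D M N} (a b : Pre p q) (c : Pre q r) :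
      Rel ((a.add b).comp c) ((a.comp c).add (b.comp c))
  | comp_add {p q r : Sym k D M N} (a : Pre p q) (b c : Pre q r) :
      Rel (a.comp (b.add c)) ((a.comp b).add (a.comp c))
  | smul_comp {p q r : Sym k D M N} (t : k) (a : Pre p q) (b : Pre q r) :
      Rel ((a.smul t).comp b) ((a.comp b).smul t)
  | comp_smul {p q r : Sym k D M N} (t : k) (a : Pre p q) (b : Pre q r) :
      Rel (a.comp (b.smul t)) ((a.comp b).smul t)
  -- linearity
  | gen_add_left {X X' : M} {Y Y' : N} (f f' : X ⟶ X') (g : Y ⟶ Y') :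
      Rel (Pre.gen (f + f') g) ((Pre.gen f g).add (Pre.gen f' g))
  | gen_add_right {X X' : M} {Y Y' : N} (f : X ⟶ X') (g g' : Y ⟶ Y') :
      Rel (Pre.gen f (g + g')) ((Pre.gen f g).add (Pre.gen f g'))
  | gen_smul_left {X X' : M} {Y Y' : N} (t : k) (f : X ⟶ X') (g : Y ⟶ Y') :
      Rel (Pre.gen (t • f) g) ((Pre.gen f g).smul t)
  | gen_smul_right {X X' : M} {Y Y' : N} (t : k) (f : X ⟶ X') (g : Y ⟶ Y') :
      Rel (Pre.gen f (t • g)) ((Pre.gen f g).smul t)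
  -- functoriality
  | gen_id (X : M) (Y : N) : Rel (Pre.gen (𝟙 X) (𝟙 Y)) (Pre.id ⟨X, Y⟩)
  | gen_comp {X X' X'' : M} {Y Y' Y'' : N} (f : X ⟶ X') (f' : X' ⟶ X'') (g : Y ⟶ Y')
      (g' : Y' ⟶ Y'') :
      Rel (Pre.gen (f ≫ f') (g ≫ g')) ((Pre.gen f g).comp (Pre.gen f' g'))
  -- the formal inverse of `α`
  | bal_balInv (X : M) (V : D) (Y : N) :
      Rel ((Pre.bal X V Y).comp (Pre.balInv X V Y)) (Pre.id _)
  | balInv_bal (X : M) (V : D) (Y : N) :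
      Rel ((Pre.balInv X V Y).comp (Pre.bal X V Y)) (Pre.id _)
  -- naturality
  | naturality {X X' : M} {V V' : D} {Y Y' : N} (f : X ⟶ X') (u : V ⟶ V') (g : Y ⟶ Y') :
      Rel ((Pre.gen (f ⊙ᵣₘ u) g).comp (Pre.bal X' V' Y'))
        ((Pre.bal X V Y).comp (Pre.gen f (u ⊙ₗₘ g)))
  -- coherence
  | coherence (X : M) (V W : D) (Y : N) :
      Rel ((Pre.gen (αᵣ X V W).inv (𝟙 Y)).comp
          ((Pre.bal X (V ⊗ W) Y).comp (Pre.gen (𝟙 X) (αₗ V W Y).hom)))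
        ((Pre.bal (X ⊙ᵣ V) W Y).comp (Pre.bal X V (W ⊙ₗ Y)))

instance preSetoid (p q : Sym k D M N) : Setoid (Pre p q) :=
  ⟨Rel, Rel.refl, Rel.symm, Rel.trans⟩

instance : Category (Sym k D M N) where
  Hom p q := Quotient (preSetoid p q)
  id p := ⟦Pre.id p⟧
  comp := Quotient.map₂ Pre.comp fun _ _ h _ _ h' => Rel.comp_congr h h'
  id_comp := by rintro _ _ ⟨a⟩; exact Quotient.sound (Rel.id_comp a)
  comp_id := by rintro _ _ ⟨a⟩; exact Quotient.sound (Rel.comp_id a)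
  assoc := by rintro _ _ _ _ ⟨a⟩ ⟨b⟩ ⟨c⟩; exact Quotient.sound (Rel.assoc a b c)

/-- The class of a formal morphism. -/
def homMk {p q : Sym k D M N} (a : Pre p q) : p ⟶ q := Quotient.mk (preSetoid p q) a

theorem homMk_sound {p q : Sym k D M N} {a b : Pre p q} (h : Rel a b) : homMk a = homMk b :=
  Quotient.sound h

instance (p q : Sym k D M N) : Zero (p ⟶ q) := ⟨homMk (Pre.zero p q)⟩

instance (p q : Sym k D M N) : Add (p ⟶ q) :=
  ⟨Quotient.map₂ Pre.add fun _ _ h _ _ h' => Rel.add_congr h h'⟩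

instance (p q : Sym k D M N) : SMul k (p ⟶ q) :=
  ⟨fun t => Quotient.map (Pre.smul t) fun _ _ h => Rel.smul_congr t h⟩

theorem zero_add' {p q : Sym k D M N} (f : p ⟶ q) : 0 + f = f := by
  obtain ⟨a⟩ := f; exact Quotient.sound (Rel.zero_add a)

theorem add_comm' {p q : Sym k D M N} (f g : p ⟶ q) : f + g = g + f := by
  obtain ⟨a⟩ := f; obtain ⟨b⟩ := g; exact Quotient.sound (Rel.add_comm a b)

theorem zero_smul' {p q : Sym k D M N} (f : p ⟶ q) : (0 : k) • f = 0 := by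
  obtain ⟨a⟩ := f; exact Quotient.sound (Rel.zero_smul a)

theorem one_smul' {p q : Sym k D M N} (f : p ⟶ q) : (1 : k) • f = f := by
  obtain ⟨a⟩ := f; exact Quotient.sound (Rel.one_smul a)

theorem add_smul' {p q : Sym k D M N} (s t : k) (f : p ⟶ q) : (s + t) • f = s • f + t • f := by
  obtain ⟨a⟩ := f; exact Quotient.sound (Rel.add_smul s t a)

theorem mul_smul' {p q : Sym k D M N} (s t : k) (f : p ⟶ q) : (s * t) • f = s • t • f := by
  obtain ⟨a⟩ := f; exact Quotient.sound (Rel.mul_smul s t a)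

theorem smul_add' {p q : Sym k D M N} (t : k) (f g : p ⟶ q) : t • (f + g) = t • f + t • g := by
  obtain ⟨a⟩ := f; obtain ⟨b⟩ := g; exact Quotient.sound (Rel.smul_add t a b)

instance (p q : Sym k D M N) : AddCommGroup (p ⟶ q) where
  add_assoc := by rintro ⟨a⟩ ⟨b⟩ ⟨c⟩; exact Quotient.sound (Rel.add_assoc a b c)
  zero_add := zero_add'
  add_zero f := by rw [add_comm', zero_add']
  add_comm := add_comm'
  nsmul := nsmulRec
  neg f := (-1 : k) • f
  zsmul := @zsmulRec (p ⟶ q) _ _ ⟨fun f => (-1 : k) • f⟩ nsmulRec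
  neg_add_cancel f := by
    change (-1 : k) • f + f = 0
    have h : (-1 : k) • f + f = (-1 : k) • f + (1 : k) • f := by rw [one_smul']
    rw [h, ← add_smul', neg_add_cancel, zero_smul']

instance : Preadditive (Sym k D M N) where
  add_comp := by rintro _ _ _ ⟨a⟩ ⟨b⟩ ⟨c⟩; exact Quotient.sound (Rel.add_comp a b c)
  comp_add := by rintro _ _ _ ⟨a⟩ ⟨b⟩ ⟨c⟩; exact Quotient.sound (Rel.comp_add a b c)

instance : Linear k (Sym k D M N) where
  homModule p q :=
    { one_smul := one_smul'
      mul_smul := mul_smul'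
      smul_zero := fun t => by
        have h := smul_add' t (0 : p ⟶ q) 0
        rw [add_zero] at h
        exact left_eq_add.1 h
      smul_add := smul_add'
      add_smul := add_smul'
      zero_smul := zero_smul' }
  smul_comp := by rintro _ _ _ t ⟨a⟩ ⟨b⟩; exact Quotient.sound (Rel.smul_comp t a b)
  comp_smul := by rintro _ _ _ ⟨a⟩ t ⟨b⟩; exact Quotient.sound (Rel.comp_smul t a b)

/-- The generating morphism `[f, g]`. -/
def gen {X X' : M} {Y Y' : N} (f : X ⟶ X') (g : Y ⟶ Y') :
    (⟨X, Y⟩ : Sym k D M N) ⟶ ⟨X', Y'⟩ := homMk (Pre.gen f g)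

/-- The generating isomorphism `α_{X,V,Y} : [X ⊗ V, Y] ≅ [X, V ⊗ Y]`. -/
@[simps]
def bal (X : M) (V : D) (Y : N) : (⟨X ⊙ᵣ V, Y⟩ : Sym k D M N) ≅ ⟨X, V ⊙ₗ Y⟩ where
  hom := homMk (Pre.bal X V Y)
  inv := homMk (Pre.balInv X V Y)
  hom_inv_id := homMk_sound (Rel.bal_balInv X V Y)
  inv_hom_id := homMk_sound (Rel.balInv_bal X V Y)

@[simp]
theorem gen_id (X : M) (Y : N) : gen (k := k) (D := D) (𝟙 X) (𝟙 Y) = 𝟙 _ :=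
  homMk_sound (Rel.gen_id X Y)

theorem gen_comp {X X' X'' : M} {Y Y' Y'' : N} (f : X ⟶ X') (f' : X' ⟶ X'') (g : Y ⟶ Y')
    (g' : Y' ⟶ Y'') :
    gen (k := k) (D := D) f g ≫ gen f' g' = gen (f ≫ f') (g ≫ g') :=
  (homMk_sound (Rel.gen_comp f f' g g')).symm

theorem gen_add_left {X X' : M} {Y Y' : N} (f f' : X ⟶ X') (g : Y ⟶ Y') :
    gen (k := k) (D := D) (f + f') g = gen f g + gen f' g :=
  homMk_sound (Rel.gen_add_left f f' g)

theorem gen_add_right {X X' : M} {Y Y' : N} (f : X ⟶ X') (g g' : Y ⟶ Y') :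
    gen (k := k) (D := D) f (g + g') = gen f g + gen f g' :=
  homMk_sound (Rel.gen_add_right f g g')

theorem gen_smul_left {X X' : M} {Y Y' : N} (t : k) (f : X ⟶ X') (g : Y ⟶ Y') :
    gen (k := k) (D := D) (t • f) g = t • gen f g :=
  homMk_sound (Rel.gen_smul_left t f g)

theorem gen_smul_right {X X' : M} {Y Y' : N} (t : k) (f : X ⟶ X') (g : Y ⟶ Y') :
    gen (k := k) (D := D) f (t • g) = t • gen f g :=
  homMk_sound (Rel.gen_smul_right t f g)

theorem bal_naturality {X X' : M} {V V' : D} {Y Y' : N} (f : X ⟶ X') (u : V ⟶ V') (g : Y ⟶ Y') :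
    gen (k := k) (f ⊙ᵣₘ u) g ≫ (bal X' V' Y').hom = (bal X V Y).hom ≫ gen f (u ⊙ₗₘ g) :=
  homMk_sound (Rel.naturality f u g)

theorem bal_coherence (X : M) (V W : D) (Y : N) :
    gen (k := k) (αᵣ X V W).inv (𝟙 Y) ≫ (bal X (V ⊗ W) Y).hom ≫ gen (𝟙 X) (αₗ V W Y).hom =
      (bal (X ⊙ᵣ V) W Y).hom ≫ (bal X V (W ⊙ₗ Y)).hom :=
  homMk_sound (Rel.coherence X V W Y)

/-- Every morphism is obtained from the generators by composition and linear combination. -/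
theorem hom_induction {motive : ∀ {p q : Sym k D M N}, (p ⟶ q) → Prop}
    (id : ∀ p, motive (𝟙 p))
    (comp : ∀ {p q r : Sym k D M N} (f : p ⟶ q) (g : q ⟶ r), motive f → motive g → motive (f ≫ g))
    (zero : ∀ p q : Sym k D M N, motive (0 : p ⟶ q))
    (add : ∀ {p q : Sym k D M N} (f g : p ⟶ q), motive f → motive g → motive (f + g))
    (smul : ∀ {p q : Sym k D M N} (t : k) (f : p ⟶ q), motive f → motive (t • f))
    (gen : ∀ {X X' : M} {Y Y' : N} (f : X ⟶ X') (g : Y ⟶ Y'), motive (gen f g))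
    (bal : ∀ (X : M) (V : D) (Y : N), motive (bal X V Y).hom)
    (balInv : ∀ (X : M) (V : D) (Y : N), motive (Sym.bal X V Y).inv)
    {p q : Sym k D M N} (f : p ⟶ q) : motive f := by
  refine Quotient.inductionOn f fun a => ?_
  clear f
  induction a with
  | id p => exact id p
  | comp a b ha hb => exact comp _ _ ha hb
  | zero p q => exact zero p q
  | add a b ha hb => exact add _ _ ha hb
  | smul t a ha => exact smul t _ ha
  | gen f g => exact gen f g
  | bal X V Y => exact bal X V Y
  | balInv X V Y => exact balInv X V Y

end Sym

/-- A `k`-bilinear `D`-balanced functor `M × N → E` into a `k`-linear category. -/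
structure BalancedFunctor (k D M N : Type*) [Field k] [Category* D] [MonoidalCategory D]
    [Category* M] [Preadditive M] [Linear k M] [MonoidalRightAction D M]
    [Category* N] [Preadditive N] [Linear k N] [MonoidalLeftAction D N]
    (E : Type*) [Category* E] [Preadditive E] [Linear k E] where
  obj : M → N → E
  map {X X' : M} {Y Y' : N} (f : X ⟶ X') (g : Y ⟶ Y') : obj X Y ⟶ obj X' Y'
  map_id (X : M) (Y : N) : map (𝟙 X) (𝟙 Y) = 𝟙 _
  map_comp {X X' X'' : M} {Y Y' Y'' : N} (f : X ⟶ X') (f' : X' ⟶ X'') (g : Y ⟶ Y')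
    (g' : Y' ⟶ Y'') : map (f ≫ f') (g ≫ g') = map f g ≫ map f' g'
  map_add_left {X X' : M} {Y Y' : N} (f f' : X ⟶ X') (g : Y ⟶ Y') :
    map (f + f') g = map f g + map f' g
  map_add_right {X X' : M} {Y Y' : N} (f : X ⟶ X') (g g' : Y ⟶ Y') :
    map f (g + g') = map f g + map f g'
  map_smul_left {X X' : M} {Y Y' : N} (t : k) (f : X ⟶ X') (g : Y ⟶ Y') :
    map (t • f) g = t • map f g
  map_smul_right {X X' : M} {Y Y' : N} (t : k) (f : X ⟶ X') (g : Y ⟶ Y') :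
    map f (t • g) = t • map f g
  iso (X : M) (V : D) (Y : N) : obj (X ⊙ᵣ V) Y ≅ obj X (V ⊙ₗ Y)
  naturality {X X' : M} {V V' : D} {Y Y' : N} (f : X ⟶ X') (u : V ⟶ V') (g : Y ⟶ Y') :
    map (f ⊙ᵣₘ u) g ≫ (iso X' V' Y').hom = (iso X V Y).hom ≫ map f (u ⊙ₗₘ g)
  coherence (X : M) (V W : D) (Y : N) :
    map (αᵣ X V W).inv (𝟙 Y) ≫ (iso X (V ⊗ W) Y).hom ≫ map (𝟙 X) (αₗ V W Y).hom =
      (iso (X ⊙ᵣ V) W Y).hom ≫ (iso X V (W ⊙ₗ Y)).hom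

namespace BalancedFunctor

variable {E : Type*} [Category* E] [Preadditive E] [Linear k E] (F : BalancedFunctor k D M N E)

/-- The value of a balanced functor on a formal morphism. -/
def preMap : ∀ {p q : Sym k D M N}, Sym.Pre p q → (F.obj p.left p.right ⟶ F.obj q.left q.right)
  | _, _, .id _ => 𝟙 _
  | _, _, .comp a b => preMap a ≫ preMap b
  | _, _, .zero _ _ => 0
  | _, _, .add a b => preMap a + preMap b
  | _, _, .smul t a => t • preMap a
  | _, _, .gen f g => F.map f g
  | _, _, .bal X V Y => (F.iso X V Y).hom
  | _, _, .balInv X V Y => (F.iso X V Y).inv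

theorem preMap_eq {p q : Sym k D M N} {a b : Sym.Pre p q} (h : Sym.Rel a b) :
    F.preMap a = F.preMap b := by
  induction h with
  | refl => rfl
  | symm _ h => exact h.symm
  | trans _ _ h h' => exact h.trans h'
  | comp_congr _ _ h h' => simp only [preMap, h, h']
  | add_congr _ _ h h' => simp only [preMap, h, h']
  | smul_congr t _ h => simp only [preMap, h]
  | add_assoc => simp only [preMap, _root_.add_assoc]
  | add_comm => simp only [preMap]; exact _root_.add_comm _ _
  | mul_smul => simp only [preMap, SemigroupAction.mul_smul]
  | add_smul => simp only [preMap, _root_.add_smul]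
  | gen_add_left f f' g => exact F.map_add_left f f' g
  | gen_add_right f g g' => exact F.map_add_right f g g'
  | gen_smul_left t f g => exact F.map_smul_left t f g
  | gen_smul_right t f g => exact F.map_smul_right t f g
  | gen_id X Y => exact F.map_id X Y
  | gen_comp f f' g g' => exact F.map_comp f f' g g'
  | naturality f u g => exact F.naturality f u g
  | coherence X V W Y => exact F.coherence X V W Y
  | _ => simp [preMap]

/-- The functor on symbols induced by a balanced functor. -/
@[simps obj, reducible]
def lift : Sym k D M N ⥤ E where
  obj p := F.obj p.left p.right
  map := Quotient.lift F.preMap fun _ _ h => F.preMap_eq h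
  map_id _ := rfl
  map_comp := by rintro _ _ _ ⟨a⟩ ⟨b⟩; rfl

@[simp]
theorem lift_map_gen {X X' : M} {Y Y' : N} (f : X ⟶ X') (g : Y ⟶ Y') :
    F.lift.map (Sym.gen f g) = F.map f g := rfl

@[simp]
theorem lift_map_bal_hom (X : M) (V : D) (Y : N) :
    F.lift.map (Sym.bal X V Y).hom = (F.iso X V Y).hom := rfl

@[simp]
theorem lift_map_bal_inv (X : M) (V : D) (Y : N) :
    F.lift.map (Sym.bal X V Y).inv = (F.iso X V Y).inv := rfl

instance : F.lift.Additive where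
  map_add := by rintro _ _ ⟨a⟩ ⟨b⟩; rfl

instance : F.lift.Linear k where
  map_smul := by rintro _ _ ⟨a⟩ t; rfl

end BalancedFunctor

/-- A family of morphisms between `k`-linear functors is natural if it is natural with respect to
the generating morphisms. -/
theorem Sym.natural_of_gen {E : Type*} [Category* E] [Preadditive E] [Linear k E]
    (F F' : Sym k D M N ⥤ E) [F.Additive] [F.Linear k] [F'.Additive] [F'.Linear k]
    (η : ∀ p, F.obj p ⟶ F'.obj p)
    (hgen : ∀ {X X' : M} {Y Y' : N} (f : X ⟶ X') (g : Y ⟶ Y'),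
      F.map (Sym.gen f g) ≫ η ⟨X', Y'⟩ = η ⟨X, Y⟩ ≫ F'.map (Sym.gen f g))
    (hbal : ∀ (X : M) (V : D) (Y : N), F.map (Sym.bal X V Y).hom ≫ η ⟨X, V ⊙ₗ Y⟩ =
      η ⟨X ⊙ᵣ V, Y⟩ ≫ F'.map (Sym.bal X V Y).hom)
    {p q : Sym k D M N} (g : p ⟶ q) : F.map g ≫ η q = η p ≫ F'.map g := by
  induction g using Sym.hom_induction with
  | id p => simp
  | comp g h hg hh => simp only [Functor.map_comp, Category.assoc, hh, reassoc_of% hg]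
  | zero p q => simp
  | add g h hg hh => simp only [Functor.map_add, Preadditive.add_comp, hg, hh,
      Preadditive.comp_add]
  | smul t g hg => simp only [Functor.map_smul, Linear.smul_comp, hg, Linear.comp_smul]
  | gen a b => exact hgen a b
  | bal V S Y => exact hbal V S Y
  | balInv V S Y =>
    have h := hbal V S Y
    rw [← cancel_epi (F.map (Sym.bal V S Y).hom), ← Functor.map_comp_assoc,
      Iso.hom_inv_id, CategoryTheory.Functor.map_id, Category.id_comp, ← Category.assoc, h,
      Category.assoc,
      ← Functor.map_comp, Iso.hom_inv_id, CategoryTheory.Functor.map_id,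
      Category.comp_id]

end

/-- The tensor product `M ⊠_D N` of a right and a left `D`-module category: its objects are the
finite direct sums of symbols `[X, Y]`, its morphisms the matrices of morphisms between symbols. -/
abbrev BoxTensor (k D M N : Type*) [Field k] [Category* D] [MonoidalCategory D]
    [Category* M] [Preadditive M] [Linear k M] [MonoidalRightAction D M]
    [Category* N] [Preadditive N] [Linear k N] [MonoidalLeftAction D N] : Type _ :=
  Mat_ (Sym k D M N)

/-- The symbol `[X, Y]` as an object of `M ⊠_D N`. -/
def box (k D : Type*) {M N : Type*} [Field k] [Category* D] [MonoidalCategory D]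
    [Category* M] [Preadditive M] [Linear k M] [MonoidalRightAction D M]
    [Category* N] [Preadditive N] [Linear k N] [MonoidalLeftAction D N]
    (X : M) (Y : N) : BoxTensor k D M N :=
  (Mat_.embedding (Sym k D M N)).obj ⟨X, Y⟩

end Balanced

/-! ### `k`-bilinear actions, and the action on additive completions -/

section Actions

open scoped MonoidalLeftAction

/-- The action of `C` on `M` is `k`-bilinear. -/
class BilinearAction (k C M : Type*) [Field k] [Category* C] [Preadditive C] [Linear k C]
    [MonoidalCategory C] [Category* M] [Preadditive M] [Linear k M] [MonoidalLeftAction C M] :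
    Prop where
  add_left : ∀ {V W : C} (f g : V ⟶ W) (X : M), (f + g) ⊵ₗ X = f ⊵ₗ X + g ⊵ₗ X
  smul_left : ∀ {V W : C} (t : k) (f : V ⟶ W) (X : M), (t • f) ⊵ₗ X = t • f ⊵ₗ X
  add_right : ∀ (V : C) {X Y : M} (f g : X ⟶ Y), V ⊴ₗ (f + g) = V ⊴ₗ f + V ⊴ₗ g
  smul_right : ∀ (V : C) {X Y : M} (t : k) (f : X ⟶ Y), V ⊴ₗ (t • f) = t • V ⊴ₗ f

variable {k : Type*} [Field k] {C : Type*} [Category* C] [Preadditive C] [Linear k C]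
    [MonoidalCategory C] {E : Type*} [Category* E] [Preadditive E] [Linear k E]

instance [MonoidalPreadditive C] [MonoidalLinear k C] (A : C) [MonObj A] :
    BilinearAction k C (RightMod A) where
  add_left f g X := RightMod.hom_ext (by change (f + g) ▷ X.X = f ▷ X.X + g ▷ X.X; simp)
  smul_left t f X := RightMod.hom_ext (by change (t • f) ▷ X.X = t • f ▷ X.X; simp)
  add_right V _ _ f g := RightMod.hom_ext (by
    change V ◁ (f.hom + g.hom) = V ◁ f.hom + V ◁ g.hom; simp)
  smul_right V _ _ t f := RightMod.hom_ext (by change V ◁ (t • f.hom) = t • V ◁ f.hom; simp)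

set_option linter.unusedSectionVars false

namespace MatAction

instance (X Y : Mat_ E) : SMul k (X ⟶ Y) := ⟨fun t f i j => t • f i j⟩

@[simp]
theorem smul_apply {X Y : Mat_ E} (t : k) (f : X ⟶ Y) (i : X.ι) (j : Y.ι) :
    (t • f) i j = t • f i j := rfl

instance : Linear k (Mat_ E) where
  homModule X Y :=
    { one_smul := fun f => by ext; simp
      mul_smul := fun a b f => by ext; simp [SemigroupAction.mul_smul]
      smul_zero := fun a => by ext i j; exact smul_zero a
      smul_add := fun a f g => by ext; simp
      add_smul := fun a b f => by ext; simp [add_smul]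
      zero_smul := fun f => by ext i j; exact zero_smul k (f i j) }
  smul_comp _ _ _ a f g := by ext; simp [Finset.smul_sum]
  comp_smul _ _ _ f a g := by ext; simp [Finset.smul_sum]

/-- The diagonal matrix of a family of morphisms. -/
def dg {J : Type} [Fintype J] {X Y : J → E} (f : ∀ j, X j ⟶ Y j) :
    (Mat_.mk J X : Mat_ E) ⟶ Mat_.mk J Y := by
  classical
  exact fun i j => if h : i = j then f i ≫ eqToHom (congrArg Y h) else 0

section

variable {J : Type} [Fintype J] {X Y Z : J → E}

@[simp]
theorem dg_self (f : ∀ j, X j ⟶ Y j) (j : J) : dg f j j = f j := by simp [dg]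

theorem dg_ne (f : ∀ j, X j ⟶ Y j) {i j : J} (h : i ≠ j) : dg f i j = 0 := by simp [dg, h]

theorem dg_comp_apply (f : ∀ j, X j ⟶ Y j) {W : Mat_ E} (g : (Mat_.mk J Y : Mat_ E) ⟶ W)
    (i : J) (j : W.ι) : (dg f ≫ g) i j = f i ≫ g i j := by
  refine (Finset.sum_eq_single i ?_ ?_).trans ?_
  · intro b _ hb
    rw [dg_ne f hb.symm, zero_comp]
  · intro h; exact absurd (Finset.mem_univ i) h
  · rw [dg_self]

theorem comp_dg_apply {W : Mat_ E} (g : W ⟶ (Mat_.mk J X : Mat_ E)) (f : ∀ j, X j ⟶ Y j)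
    (i : W.ι) (j : J) : (g ≫ dg f) i j = g i j ≫ f j := by
  refine (Finset.sum_eq_single j ?_ ?_).trans ?_
  · intro b _ hb
    rw [dg_ne f hb, comp_zero]
  · intro h; exact absurd (Finset.mem_univ j) h
  · rw [dg_self]

theorem dg_comp_dg (f : ∀ j, X j ⟶ Y j) (g : ∀ j, Y j ⟶ Z j) :
    dg f ≫ dg g = dg fun j => f j ≫ g j := by
  ext i j
  rw [dg_comp_apply]
  by_cases h : i = j
  · subst h; simp
  · simp [dg_ne _ h]

theorem dg_id (X : J → E) : dg (fun j => 𝟙 (X j)) = 𝟙 (Mat_.mk J X : Mat_ E) := by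
  ext i j
  by_cases h : i = j
  · subst h; rw [dg_self]; exact (Mat_.id_apply_self (Mat_.mk J X) i).symm
  · rw [dg_ne _ h]; exact (Mat_.id_apply_of_ne (Mat_.mk J X) i j h).symm

/-- The diagonal isomorphism of a family of isomorphisms. -/
@[simps]
def dgIso (f : ∀ j, X j ≅ Y j) : (Mat_.mk J X : Mat_ E) ≅ Mat_.mk J Y where
  hom := dg fun j => (f j).hom
  inv := dg fun j => (f j).inv
  hom_inv_id := by rw [dg_comp_dg]; simp [dg_id]
  inv_hom_id := by rw [dg_comp_dg]; simp [dg_id]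

end

variable [MonoidalLeftAction C E]

/-- The object `V ⊗ ⨁ Xⱼ = ⨁ V ⊗ Xⱼ`. -/
abbrev obj (V : C) (X : Mat_ E) : Mat_ E := ⟨X.ι, fun j => V ⊙ₗ X.X j⟩

/-- `V ⊗ f` for a matrix `f`. -/
def right (V : C) {X Y : Mat_ E} (f : X ⟶ Y) : obj V X ⟶ obj V Y := fun i j => V ⊴ₗ f i j

@[simp]
theorem right_apply (V : C) {X Y : Mat_ E} (f : X ⟶ Y) (i : X.ι) (j : Y.ι) :
    right V f i j = V ⊴ₗ f i j := rfl

/-- `f ⊗ X`, a diagonal matrix. -/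
abbrev left {V W : C} (f : V ⟶ W) (X : Mat_ E) : obj V X ⟶ obj W X := dg fun j => f ⊵ₗ X.X j

/-- An additive functor sends sums to sums. -/
theorem actionHomRight_sum [BilinearAction k C E] (V : C) {J : Type} [Fintype J] {X Y : E}
    (f : J → (X ⟶ Y)) : V ⊴ₗ ∑ j, f j = ∑ j, V ⊴ₗ f j :=
  map_sum (AddMonoidHom.mk' (fun g : X ⟶ Y => V ⊴ₗ g)
    (BilinearAction.add_right (k := k) V)) f Finset.univ

theorem actionHomRight_zero [BilinearAction k C E] (V : C) (X Y : E) :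
    V ⊴ₗ (0 : X ⟶ Y) = 0 :=
  map_zero (AddMonoidHom.mk' (fun g : X ⟶ Y => V ⊴ₗ g) (BilinearAction.add_right (k := k) V))

theorem right_dg [BilinearAction k C E] (V : C) {J : Type} [Fintype J] {X Y : J → E}
    (f : ∀ j, X j ⟶ Y j) : right V (dg f) = dg fun j => V ⊴ₗ f j := by
  ext i j
  by_cases h : i = j
  · subst h; rw [right_apply, dg_self, dg_self]
  · rw [right_apply, dg_ne _ h, dg_ne _ h, actionHomRight_zero (k := k)]

theorem right_id [BilinearAction k C E] (V : C) (X : Mat_ E) : right V (𝟙 X) = 𝟙 (obj V X) := by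
  have h := right_dg (k := k) V (fun j => 𝟙 (X.X j))
  rw [dg_id] at h
  refine h.trans ?_
  rw [← dg_id]
  simp

theorem right_comp [BilinearAction k C E] (V : C) {X Y Z : Mat_ E} (f : X ⟶ Y) (g : Y ⟶ Z) :
    right V (f ≫ g) = right V f ≫ right V g := by
  ext i j
  simp only [right_apply, Mat_.comp_apply]
  rw [actionHomRight_sum (k := k)]
  simp

theorem exchange {V W : C} (f : V ⟶ W) {X Y : Mat_ E} (g : X ⟶ Y) :
    right V g ≫ left f Y = left f X ≫ right W g := by
  ext i j
  refine (comp_dg_apply (right V g) _ i j).trans ?_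
  refine Eq.trans ?_ (dg_comp_apply _ (right W g) i j).symm
  exact MonoidalLeftAction.action_exchange f (g i j)

end MatAction

open MatAction in
/-- The action of `C` on a `k`-linear category `E` extends to finite direct sums of objects
of `E`. -/
abbrev matAction (k C E : Type*) [Field k] [Category* C] [Preadditive C] [Linear k C]
    [MonoidalCategory C] [Category* E] [Preadditive E] [Linear k E] [MonoidalLeftAction C E]
    [BilinearAction k C E] : MonoidalLeftAction C (Mat_ E) where
  actionObj V X := obj V X
  actionHomLeft f X := left f X
  actionHomRight V _ _ f := right V f
  actionAssocIso V W X := dgIso fun j => MonoidalLeftAction.actionAssocIso V W (X.X j)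
  actionUnitIso X := dgIso fun j => MonoidalLeftAction.actionUnitIso (X.X j)
  actionHom_def _ _ := rfl
  actionHomRight_id V X := right_id (k := k) V X
  id_actionHomLeft V X := by
    refine Eq.trans ?_ (dg_id fun j => V ⊙ₗ X.X j)
    exact congrArg dg (funext fun j => MonoidalLeftAction.id_actionHomLeft V (X.X j))
  actionHom_comp {_ _ c} {d d' _} f₁ f₂ g₁ g₂ := by
    have h : left (f₁ ≫ f₂) d = left f₁ d ≫ left f₂ d := by
      rw [dg_comp_dg]
      exact congrArg dg (funext fun j => MonoidalLeftAction.comp_actionHomLeft f₁ f₂ (d.X j))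
    rw [h, right_comp (k := k), Category.assoc, Category.assoc, ← Category.assoc (left f₂ d),
      ← exchange, Category.assoc]
  actionAssocIso_hom_naturality {c₁ c₂ c₃ c₄ d₁ d₂} f g h := by
    ext i j
    change ((left (f ⊗ₘ g) d₁ ≫ right _ h) ≫ dg _) i j =
      (dg _ ≫ (left f (obj _ d₁) ≫ right _ (left g d₁ ≫ right _ h))) i j
    refine (comp_dg_apply _ _ i j).trans ?_
    refine Eq.trans ?_ (dg_comp_apply _ _ i j).symm
    refine (congrArg (· ≫ _) (dg_comp_apply _ (right _ h) i j)).trans ?_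
    refine Eq.trans ?_ (congrArg (_ ≫ ·) (dg_comp_apply
      (fun j => f ⊵ₗ (c₃ ⊙ₗ d₁.X j)) (right c₂ (left g d₁ ≫ right _ h)) i j).symm)
    refine Eq.trans ?_ (congrArg (fun t => (MonoidalLeftAction.actionAssocIso c₁ c₃ (d₁.X i)).hom ≫
      (f ⊵ₗ (c₃ ⊙ₗ d₁.X i)) ≫ (c₂ ⊴ₗ t)) (dg_comp_apply
        (fun j => g ⊵ₗ d₁.X j) (right c₄ h) i j).symm)
    have := MonoidalLeftAction.actionAssocIso_hom_naturality f g (h i j)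
    simp only [MonoidalLeftAction.actionHom_def] at this
    exact this
  actionUnitIso_hom_naturality f := by
    ext i j
    refine (dg_comp_apply _ _ i j).trans ?_
    refine Eq.trans ?_ (comp_dg_apply _ _ i j).symm
    exact MonoidalLeftAction.actionUnitIso_hom_naturality (f i j)
  whiskerLeft_actionHomLeft c _ _ f X := by
    change left (c ◁ f) X = dg _ ≫ right c (left f X) ≫ dg _
    rw [right_dg (k := k)]
    erw [dg_comp_dg, dg_comp_dg]
    exact congrArg dg (funext fun j => MonoidalLeftAction.whiskerLeft_actionHomLeft c f (X.X j))
  whiskerRight_actionHomLeft c f X := by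
    change left (f ▷ c) X = dg _ ≫ left f (obj c X) ≫ dg _
    erw [dg_comp_dg, dg_comp_dg]
    exact congrArg dg (funext fun j => MonoidalLeftAction.whiskerRight_actionHomLeft c f (X.X j))
  associator_actionHom c₁ c₂ c₃ X := by
    refine (congrArg (fun t => left (α_ c₁ c₂ c₃).hom X ≫ dg (fun j =>
      (MonoidalLeftAction.actionAssocIso c₁ (c₂ ⊗ c₃) (X.X j)).hom) ≫ t)
      (right_dg (k := k) c₁ fun j =>
        (MonoidalLeftAction.actionAssocIso c₂ c₃ (X.X j)).hom)).trans ?_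
    change _ = dg _ ≫ dg _
    erw [dg_comp_dg, dg_comp_dg, dg_comp_dg]
    exact congrArg dg (funext fun j => MonoidalLeftAction.associator_actionHom c₁ c₂ c₃ (X.X j))
  leftUnitor_actionHom c X := by
    change left (λ_ c).hom X = dg _ ≫ dg _
    erw [dg_comp_dg]
    exact congrArg dg (funext fun j => MonoidalLeftAction.leftUnitor_actionHom c (X.X j))
  rightUnitor_actionHom c X := by
    refine Eq.trans ?_ (congrArg (fun t => dg (fun j =>
      (MonoidalLeftAction.actionAssocIso c (𝟙_ C) (X.X j)).hom) ≫ t)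
      (right_dg (k := k) c fun j => (MonoidalLeftAction.actionUnitIso (X.X j)).hom).symm)
    erw [dg_comp_dg]
    exact congrArg dg (funext fun j => MonoidalLeftAction.rightUnitor_actionHom c (X.X j))

end Actions

/-! ### The left action of `C` on `C ⊠_D N` for a tensor subcategory `D` of `C` -/

section BoxAction

open scoped MonoidalLeftAction MonoidalRightAction

variable {k : Type*} [Field k] {C : Type*} [Category* C] [Preadditive C] [Linear k C]
  [MonoidalCategory C] [MonoidalPreadditive C] [MonoidalLinear k C]
  {P : ObjectProperty C} [P.IsMonoidal]
  {N : Type*} [Category* N] [Preadditive N] [Linear k N] [MonoidalLeftAction P.FullSubcategory N]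

namespace BoxAction

/-- The isomorphism `[e, id]`. -/
@[simps]
def genIso {V W : C} (e : V ≅ W) (Y : N) :
    (⟨V, Y⟩ : Sym k P.FullSubcategory C N) ≅ ⟨W, Y⟩ where
  hom := Sym.gen e.hom (𝟙 Y)
  inv := Sym.gen e.inv (𝟙 Y)
  hom_inv_id := by rw [Sym.gen_comp]; simp
  inv_hom_id := by rw [Sym.gen_comp]; simp

/-- The balanced functor `(V, Y) ↦ [X ⊗ V, Y]`; the isomorphism `id_X ⊗ α_{V,S,Y}` is
`α_{X ⊗ V,S,Y} ∘ [α_{X,V,S}⁻¹, id]`. -/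
@[simps obj map iso, reducible]
def actData (X : C) :
    BalancedFunctor k P.FullSubcategory C N (Sym k P.FullSubcategory C N) where
  obj V Y := ⟨X ⊗ V, Y⟩
  map f g := Sym.gen (X ◁ f) g
  map_id V Y := by simp
  map_comp f f' g g' := by rw [Sym.gen_comp, whiskerLeft_comp]
  map_add_left f f' g := by rw [MonoidalPreadditive.whiskerLeft_add, Sym.gen_add_left]
  map_add_right f g g' := Sym.gen_add_right _ _ _
  map_smul_left t f g := by rw [MonoidalLinear.whiskerLeft_smul, Sym.gen_smul_left]
  map_smul_right t f g := Sym.gen_smul_right _ _ _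
  iso V S Y := genIso (α_ X V S.obj).symm Y ≪≫ Sym.bal (X ⊗ V) S Y
  naturality {V V' S S' Y Y'} f u g := by
    have h := Sym.bal_naturality (k := k) (X ◁ f) u g
    simp only [Iso.trans_hom, Category.assoc, genIso_hom, Iso.symm_hom]
    rw [← h, ← Category.assoc, ← Category.assoc, Sym.gen_comp, Sym.gen_comp, Category.comp_id,
      Category.id_comp]
    congr 2
    simp [MonoidalCategory.tensorHom_def]
  coherence V S T Y := by
    have h1 := Sym.bal_coherence (k := k) (X ⊗ V) S T Y
    have h2 := Sym.bal_naturality (k := k) (α_ X V S.obj).inv (𝟙 T) (𝟙 Y)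
    simp only [MonoidalRightAction.actionHom_id, MonoidalLeftAction.id_actionHom,
      MonoidalLeftAction.actionHomRight_id] at h2
    simp only [Iso.trans_hom, Category.assoc, genIso_hom, Iso.symm_hom, whiskerLeft_id]
    erw [← reassoc_of% h2]
    erw [← h1]
    rw [← Category.assoc, ← Category.assoc (Sym.gen _ _) (Sym.gen _ _),
      ← Category.assoc (Sym.gen _ _ ≫ Sym.gen _ _) (Sym.gen _ _), Sym.gen_comp, Sym.gen_comp,
      Sym.gen_comp]
    simp only [Category.comp_id]
    congr 2
    simp

theorem gen_natural {X X' : C} (f : X ⟶ X') {p q : Sym k P.FullSubcategory C N} (g : p ⟶ q) :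
    (actData X).lift.map g ≫ Sym.gen (f ▷ q.left) (𝟙 q.right) =
      Sym.gen (f ▷ p.left) (𝟙 p.right) ≫ (actData X').lift.map g := by
  refine Sym.natural_of_gen (actData X).lift (actData X').lift
    (fun p => Sym.gen (f ▷ p.left) (𝟙 p.right)) ?_ ?_ g
  · intro V V' Y Y' a b
    change Sym.gen (X ◁ a) b ≫ Sym.gen (f ▷ V') (𝟙 Y') = Sym.gen (f ▷ V) (𝟙 Y) ≫ Sym.gen (X' ◁ a) b
    rw [Sym.gen_comp, Sym.gen_comp, whisker_exchange, Category.comp_id, Category.id_comp]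
  · intro V S Y
    have h := Sym.bal_naturality (k := k) (f ▷ V) (𝟙 S) (𝟙 Y)
    simp only [MonoidalRightAction.actionHom_id, MonoidalLeftAction.id_actionHom,
      MonoidalLeftAction.actionHomRight_id] at h
    change (Sym.gen (α_ X V S.obj).inv (𝟙 Y) ≫ (Sym.bal (X ⊗ V) S Y).hom) ≫ Sym.gen _ _ =
      Sym.gen _ _ ≫ Sym.gen (α_ X' V S.obj).inv (𝟙 Y) ≫ (Sym.bal (X' ⊗ V) S Y).hom
    rw [Category.assoc, ← h, ← Category.assoc, ← Category.assoc, Sym.gen_comp]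
    erw [Sym.gen_comp]
    congr 2
    simp

theorem assoc_natural (X X' : C) {p q : Sym k P.FullSubcategory C N} (g : p ⟶ q) :
    (actData (X ⊗ X')).lift.map g ≫ Sym.gen (α_ X X' q.left).hom (𝟙 q.right) =
      Sym.gen (α_ X X' p.left).hom (𝟙 p.right) ≫
        (actData X).lift.map ((actData X').lift.map g) := by
  refine Sym.natural_of_gen (actData (X ⊗ X')).lift ((actData X').lift ⋙ (actData X).lift)
    (fun p => Sym.gen (α_ X X' p.left).hom (𝟙 p.right)) ?_ ?_ g
  · intro V V' Y Y' a b
    change Sym.gen ((X ⊗ X') ◁ a) b ≫ Sym.gen (α_ X X' V').hom (𝟙 Y') =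
      Sym.gen (α_ X X' V).hom (𝟙 Y) ≫ Sym.gen (X ◁ X' ◁ a) b
    rw [Sym.gen_comp, Sym.gen_comp]
    simp
  · intro V S Y
    have h := Sym.bal_naturality (k := k) (α_ X X' V).hom (𝟙 S) (𝟙 Y)
    simp only [MonoidalRightAction.actionHom_id, MonoidalLeftAction.id_actionHom,
      MonoidalLeftAction.actionHomRight_id] at h
    change (Sym.gen (α_ (X ⊗ X') V S.obj).inv (𝟙 Y) ≫ (Sym.bal ((X ⊗ X') ⊗ V) S Y).hom) ≫
        Sym.gen _ _ = Sym.gen (α_ X X' (V ⊗ S.obj)).hom (𝟙 Y) ≫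
      Sym.gen (X ◁ (α_ X' V S.obj).inv) (𝟙 Y) ≫ Sym.gen (α_ X (X' ⊗ V) S.obj).inv (𝟙 Y) ≫
          (Sym.bal (X ⊗ X' ⊗ V) S Y).hom
    rw [Category.assoc, ← h, ← Category.assoc, ← Category.assoc, ← Category.assoc, Sym.gen_comp,
      Sym.gen_comp]
    erw [Sym.gen_comp]
    congr 2
    · simp
    · simp

theorem unit_natural {p q : Sym k P.FullSubcategory C N} (g : p ⟶ q) :
    (actData (𝟙_ C)).lift.map g ≫ Sym.gen (λ_ q.left).hom (𝟙 q.right) =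
      Sym.gen (λ_ p.left).hom (𝟙 p.right) ≫ g := by
  refine Sym.natural_of_gen (actData (𝟙_ C)).lift (𝟭 _)
    (fun p => Sym.gen (λ_ p.left).hom (𝟙 p.right)) ?_ ?_ g
  · intro V V' Y Y' a b
    change Sym.gen ((𝟙_ C) ◁ a) b ≫ Sym.gen (λ_ V').hom (𝟙 Y') =
      Sym.gen (λ_ V).hom (𝟙 Y) ≫ Sym.gen a b
    rw [Sym.gen_comp, Sym.gen_comp]
    simp
  · intro V S Y
    have h := Sym.bal_naturality (k := k) (λ_ V).hom (𝟙 S) (𝟙 Y)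
    simp only [MonoidalRightAction.actionHom_id, MonoidalLeftAction.id_actionHom,
      MonoidalLeftAction.actionHomRight_id] at h
    change (Sym.gen (α_ (𝟙_ C) V S.obj).inv (𝟙 Y) ≫ (Sym.bal (𝟙_ C ⊗ V) S Y).hom) ≫
      Sym.gen _ _ = Sym.gen (λ_ (V ⊗ S.obj)).hom (𝟙 Y) ≫ (Sym.bal V S Y).hom
    rw [Category.assoc, ← h, ← Category.assoc, Sym.gen_comp]
    congr 2
    · simp
    · simp

end BoxAction

open BoxAction

/-- The action `X ⊗ [V, Y] = [X ⊗ V, Y]`. -/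
instance symAction : MonoidalLeftAction C (Sym k P.FullSubcategory C N) where
  actionObj X p := ⟨X ⊗ p.left, p.right⟩
  actionHomLeft f p := Sym.gen (f ▷ p.left) (𝟙 p.right)
  actionHomRight X _ _ g := (actData X).lift.map g
  actionAssocIso X X' p := genIso (α_ X X' p.left) p.right
  actionUnitIso p := genIso (λ_ p.left) p.right
  actionHom_def _ _ := rfl
  actionHomRight_id X p := (actData X).lift.map_id p
  id_actionHomLeft X p := by
    rw [id_whiskerRight]; exact Sym.gen_id _ _
  actionHom_comp {_ _ X} {p q _} f₁ f₂ g₁ g₂ := by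
    change Sym.gen ((f₁ ≫ f₂) ▷ p.left) (𝟙 p.right) ≫ (actData X).lift.map (g₁ ≫ g₂) =
      (Sym.gen (f₁ ▷ p.left) (𝟙 p.right) ≫ (actData _).lift.map g₁) ≫
        Sym.gen (f₂ ▷ q.left) (𝟙 q.right) ≫ (actData X).lift.map g₂
    have h := gen_natural f₂ g₁
    rw [Category.assoc, reassoc_of% h, ← Category.assoc, Sym.gen_comp, ← comp_whiskerRight,
      Category.comp_id, Functor.map_comp]
  actionAssocIso_hom_naturality {X₁ X₂ X₃ X₄ p q} f g h := by
    change (Sym.gen ((f ⊗ₘ g) ▷ p.left) (𝟙 p.right) ≫ (actData (X₂ ⊗ X₄)).lift.map h) ≫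
        Sym.gen (α_ X₂ X₄ q.left).hom (𝟙 q.right) =
      Sym.gen (α_ X₁ X₃ p.left).hom (𝟙 p.right) ≫ Sym.gen (f ▷ (X₃ ⊗ p.left)) (𝟙 p.right) ≫
        (actData X₂).lift.map (Sym.gen (g ▷ p.left) (𝟙 p.right) ≫ (actData X₄).lift.map h)
    rw [Category.assoc, assoc_natural, Functor.map_comp, BalancedFunctor.lift_map_gen, actData_map,
      ← Category.assoc, ← Category.assoc, ← Category.assoc, Sym.gen_comp]
    erw [Sym.gen_comp, Sym.gen_comp]
    congr 2
    · simp [MonoidalCategory.tensorHom_def]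
    · simp
  actionUnitIso_hom_naturality f := (unit_natural f).symm
  whiskerLeft_actionHomLeft X _ _ f p := by
    change Sym.gen ((X ◁ f) ▷ p.left) (𝟙 p.right) = Sym.gen (α_ _ _ _).hom (𝟙 p.right) ≫
      Sym.gen (X ◁ f ▷ p.left) (𝟙 p.right) ≫ Sym.gen (α_ _ _ _).inv (𝟙 p.right)
    rw [Sym.gen_comp, Sym.gen_comp]
    simp
  whiskerRight_actionHomLeft X f p := by
    change Sym.gen ((f ▷ X) ▷ p.left) (𝟙 p.right) = Sym.gen (α_ _ _ _).hom (𝟙 p.right) ≫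
      Sym.gen (f ▷ (X ⊗ p.left)) (𝟙 p.right) ≫ Sym.gen (α_ _ _ _).inv (𝟙 p.right)
    rw [Sym.gen_comp, Sym.gen_comp]
    simp
  associator_actionHom X₁ X₂ X₃ p := by
    change Sym.gen ((α_ X₁ X₂ X₃).hom ▷ p.left) (𝟙 p.right) ≫
        Sym.gen (α_ _ _ _).hom (𝟙 p.right) ≫ Sym.gen (X₁ ◁ (α_ _ _ _).hom) (𝟙 p.right) =
      Sym.gen (α_ _ _ _).hom (𝟙 p.right) ≫ Sym.gen (α_ _ _ _).hom (𝟙 p.right)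
    rw [Sym.gen_comp, Sym.gen_comp, Sym.gen_comp]
    simp
  leftUnitor_actionHom X p := by
    change Sym.gen ((λ_ X).hom ▷ p.left) (𝟙 p.right) =
      Sym.gen (α_ _ _ _).hom (𝟙 p.right) ≫ Sym.gen (λ_ _).hom (𝟙 p.right)
    rw [Sym.gen_comp]
    simp
  rightUnitor_actionHom X p := by
    change Sym.gen ((ρ_ X).hom ▷ p.left) (𝟙 p.right) =
      Sym.gen (α_ _ _ _).hom (𝟙 p.right) ≫ Sym.gen (X ◁ (λ_ _).hom) (𝟙 p.right)
    rw [Sym.gen_comp]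
    simp

instance : BilinearAction k C (Sym k P.FullSubcategory C N) where
  add_left f g p := by
    change Sym.gen ((f + g) ▷ p.left) (𝟙 p.right) = _
    rw [MonoidalPreadditive.add_whiskerRight, Sym.gen_add_left]; rfl
  smul_left t f p := by
    change Sym.gen ((t • f) ▷ p.left) (𝟙 p.right) = _
    rw [MonoidalLinear.smul_whiskerRight, Sym.gen_smul_left]; rfl
  add_right X _ _ _ _ := (actData (k := k) X).lift.map_add
  smul_right X _ _ t f := CategoryTheory.Functor.Linear.map_smul (F := (actData (k := k) X).lift) f t

/-- The left action of `C` on `C ⊠_D N`, determined by `X ⊗ [V, Y] = [X ⊗ V, Y]`. -/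
instance boxAction : MonoidalLeftAction C (BoxTensor k P.FullSubcategory C N) :=
  matAction k C (Sym k P.FullSubcategory C N)

end BoxAction

/-! ### Graded module categories -/

section Graded

open scoped MonoidalLeftAction

/-- A preadditive category is abelian: it has finite products, kernels and cokernels, every
monomorphism is a kernel and every epimorphism is a cokernel. -/
structure IsAbelian (M : Type*) [Category* M] [Preadditive M] : Prop where
  hasFiniteProducts : HasFiniteProducts M
  hasKernels : HasKernels M
  hasCokernels : HasCokernels M
  normalMono : IsNormalMonoCategory M
  normalEpi : IsNormalEpiCategory M

/-- A `k`-linear category with an action of the tensor category `C` is a left `C`-module category: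
it is abelian and the action is bilinear and exact in each variable. -/
structure IsModuleCategory (k C M : Type*) [Field k] [Category* C] [Preadditive C] [Linear k C]
    [MonoidalCategory C] [Category* M] [Preadditive M] [Linear k M] [MonoidalLeftAction C M] :
    Prop where
  abelian : IsAbelian M
  bilinear : BilinearAction k C M
  actionLeft_limits : ∀ V : C, PreservesFiniteLimits (MonoidalLeftAction.actionLeft M V)
  actionLeft_colimits : ∀ V : C, PreservesFiniteColimits (MonoidalLeftAction.actionLeft M V)
  actionRight_limits : ∀ X : M, PreservesFiniteLimits (MonoidalLeftAction.actionRight C X)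
  actionRight_colimits : ∀ X : M, PreservesFiniteColimits (MonoidalLeftAction.actionRight C X)

variable {k : Type*} [Field k] {G : Type*} [Group G] {C : Type*} [Category* C] [Abelian C]
  [Linear k C] [MonoidalCategory C] [MonoidalPreadditive C] [MonoidalLinear k C]
  [TensorCategory k C] (gr : TensorGrading k G C)

namespace TensorGrading

/-- For a left `G`-set `X`, the full subcategories `comp x` make the left `C`-module category `M`
an `X`-graded one: `M = ⨁ₓ Mₓ` and `C_σ ⊗ Mₓ ⊆ M_{σ x}`. -/
structure IsGradedModuleCategory {X : Type*} [MulAction G X] {M : Type*} [Category* M]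
    [Preadditive M] [Linear k M] [MonoidalLeftAction C M] (comp : X → ObjectProperty M) :
    Prop where
  isModuleCategory : IsModuleCategory k C M
  isGrading : IsGrading comp
  action_mem : ∀ {σ : G} {x : X} {V : C} {Y : M},
    gr.comp σ V → comp x Y → comp (σ • x) (V ⊙ₗ Y)

/-- `C_x = ⨁_{τ ∈ x} C_τ` for a coset `x` of `H`. -/
def coset {H : Subgroup G} (x : G ⧸ H) : ObjectProperty C :=
  gr.restrict {τ : G | (QuotientGroup.mk τ : G ⧸ H) = x}

/-- The grading `(C ⊠_{C_H} N)_x = C_x ⊠_{C_H} N`: the direct sums of symbols `[V, Y]` with `V`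
in `C_x`. -/
def boxGrading (H : Subgroup G) (N : Type*) [Category* N] [Preadditive N] [Linear k N]
    [MonoidalLeftAction (gr.sub H).FullSubcategory N] (x : G ⧸ H) :
    ObjectProperty (BoxTensor k (gr.sub H).FullSubcategory C N) :=
  sumsOf fun Z => ∃ (V : C) (Y : N), gr.coset x V ∧ Z = box k (gr.sub H).FullSubcategory V Y

/-- The algebra `A` of `C_H`, as an algebra in `C`. -/
instance algebra (H : Subgroup G) (A : (gr.sub H).FullSubcategory) [MonObj A] : MonObj A.obj where
  one := (MonObj.one : 𝟙_ _ ⟶ A).hom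
  mul := (MonObj.mul : A ⊗ A ⟶ A).hom
  one_mul := congrArg (fun f => f.hom) (MonObj.one_mul A)
  mul_one := congrArg (fun f => f.hom) (MonObj.mul_one A)
  mul_assoc := congrArg (fun f => f.hom) (MonObj.mul_assoc A)

/-- The grading of `C_A` for an algebra `A` in `C_H`: a module is homogeneous of degree `x` if its
underlying object lies in `C_x`. -/
def modGrading (H : Subgroup G) (A : C) [MonObj A] (x : G ⧸ H) : ObjectProperty (RightMod A) :=
  fun M => gr.coset x M.X

end TensorGrading

end Graded

end TensorClifford

end

open CategoryTheory CategoryTheory.Limits MonoidalCategory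

noncomputable section

/-! The functor sends a symbol `[X, Y]` to `X ⊗ Y`, sends `α` to the associator of `C`, and is
extended to direct sums. The point is that each coset component of any object can be rebuilt from a
component in `C_H`.

Strong grading puts `1` into `C_σ · C_{σ⁻¹}`, so `1` is a direct sum of objects `V ⊗ W`. Since
`End(1) = k` has no idempotents except `0` and `1`, a single such `V ⊗ W` is already isomorphic to
`1` (`IsStrong.exists_tensor_iso_unit`). Fix such a pair. Writing `(-)_H` for the component in
`C_H`, the isomorphism gives maps `X ⟶ V ⊗ (W ⊗ X)_H ⟶ X`. The composite on `V ⊗ (W ⊗ X)_H` is the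
identity, and the one on `X` is the projection to the component of degree `σH`, because `σ⁻¹s ∈ H`
exactly when `s ∈ σH` (`ofPart_toPart`, `toPart_ofPart`). An isomorphism `W ⊗ V ≅ 1` is never
needed.

Because `sh ∈ H` if and only if `s ∈ H` for `h ∈ H`, taking the component in `C_H` commutes with
tensoring on the right by objects of `C_H` (`proj_tensor_sub`). Hence it carries `A`-modules to
`A`-modules, and `R(M) = [V, (W ⊗ M)_H]` is a functor from modules back to symbols.

Let `F` be the functor on symbols. The maps above lift to `toSym : p ⟶ R(F p)` and `ofSym : R(F p) ⟶
p`. Over the finitely many cosets that meet the degrees of `p`, the composites `toSym ≫ ofSym` add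
up to the identity of `p` (`exists_finset_sum_toSym`). As `toSym` is natural, every `f : p ⟶ q`
equals the sum of `toSym ≫ R(F f) ≫ ofSym`, so `F` is faithful. Replacing `F f` by an arbitrary
morphism of modules gives a preimage, so `F` is full. The naturality of `toSym` (`toSym_naturality`)
is where the relations defining the tensor product over `C_H` have to be used.

The same decomposition for a module `M` shows that `M` is the direct sum of objects `F(R(M))` over
cosets (`isDirectSum_tensFunctor`). This gives essential surjectivity and the grading of the module
category. Modules form an abelian category with exact action because kernels and cokernels are
computed in `C`; the tensor product over `C_H` then inherits all its structure through the
equivalence. -/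

namespace TensorClifford

/-! ### Finite direct sums in preadditive categories, and the summands of the unit object -/

section Sums

variable {M : Type*} [Category* M] [Preadditive M]

theorem IsDirectSum.of_iso {J : Type} [Fintype J] {V : J → M} {X Y : M} (e : X ≅ Y)
    (h : IsDirectSum V X) : IsDirectSum V Y := by
  obtain ⟨i, p, h1, h2, h3⟩ := h
  refine ⟨fun j => i j ≫ e.hom, fun j => e.inv ≫ p j, fun j => by simp [h1],
    fun j j' hj => by simp [h2 j j' hj], ?_⟩
  have : ∀ j, (e.inv ≫ p j) ≫ i j ≫ e.hom = e.inv ≫ (p j ≫ i j) ≫ e.hom := by simp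
  simp only [this, ← Preadditive.comp_sum, ← Preadditive.sum_comp, h3]
  simp

theorem sumsOf_of_iso {P : ObjectProperty M} {X Y : M} (e : X ≅ Y) (h : sumsOf P X) :
    sumsOf P Y := by
  obtain ⟨J, hJ, V, hV, hX⟩ := h
  exact ⟨J, hJ, V, hV, hX.of_iso e⟩

theorem IsDirectSum.sigma {J : Type} [Fintype J] {K : J → Type} [∀ j, Fintype (K j)]
    {V : J → M} {W : ∀ j, K j → M} {X : M} (h : IsDirectSum V X)
    (h' : ∀ j, IsDirectSum (W j) (V j)) :
    IsDirectSum (fun a : Σ j, K j => W a.1 a.2) X := by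
  obtain ⟨i, p, h1, h2, h3⟩ := h
  choose i' p' h1' h2' h3' using h'
  refine ⟨fun a => i' a.1 a.2 ≫ i a.1, fun a => p a.1 ≫ p' a.1 a.2, fun a => ?_, ?_, ?_⟩
  · rw [Category.assoc, ← Category.assoc (i a.1), h1, Category.id_comp, h1']
  · rintro ⟨j, a⟩ ⟨j', a'⟩ hne
    rw [Category.assoc, ← Category.assoc (i j)]
    by_cases hj : j = j'
    · subst hj
      rw [h1, Category.id_comp, h2' j a a' (fun h => hne (by rw [h]))]
    · rw [h2 _ _ hj, zero_comp, comp_zero]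
  · rw [← h3, Fintype.sum_sigma]
    refine Finset.sum_congr rfl fun j _ => ?_
    have : ∀ a, (p j ≫ p' j a) ≫ i' j a ≫ i j = p j ≫ (p' j a ≫ i' j a) ≫ i j := by simp
    simp only [this, ← Preadditive.comp_sum, ← Preadditive.sum_comp, h3', Category.id_comp]

/-- The subcategories `C_x` for cosets `x` are themselves defined by `sumsOf`, so this is what
closes them under direct sums. -/
theorem sumsOf_sumsOf (P : ObjectProperty M) : sumsOf (sumsOf P) ≤ sumsOf P := by
  rintro X ⟨J, hJ, V, hV, hX⟩
  choose K hK W hW hVW using hV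
  exact ⟨Σ j, K j, inferInstance, fun a => W a.1 a.2, fun a => hW a.1 a.2, hX.sigma hVW⟩

theorem isDirectSum_biproduct {J : Type} [Fintype J] (V : J → M) [HasBiproduct V] :
    IsDirectSum V (⨁ V) :=
  ⟨biproduct.ι V, biproduct.π V, fun j => biproduct.ι_π_self V j,
    fun _ _ h => biproduct.ι_π_ne V h, biproduct.total⟩

end Sums

/-- The idempotents `p j ≫ i j` of `End(1) = k` are each `0` or `1`, and they add up to `1 ≠ 0`. A
nonzero one is therefore the identity, which makes its summand the whole unit object. -/
theorem exists_iso_unit_of_isDirectSum (k : Type*) [Field k] {C : Type*}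
    [Category* C] [Abelian C] [Linear k C] [MonoidalCategory C] [MonoidalPreadditive C]
    [MonoidalLinear k C] [TensorCategory k C] {J : Type} [Fintype J] {V : J → C}
    (hV : IsDirectSum V (𝟙_ C)) : ∃ j, Nonempty (V j ≅ 𝟙_ C) := by
  have hfin := TensorCategory.finrank_end_unit (k := k) (C := C)
  have hne : 𝟙 (𝟙_ C) ≠ 0 := by
    intro h
    have : Subsingleton (𝟙_ C ⟶ 𝟙_ C) := ⟨fun f g => by
      rw [← Category.comp_id f, ← Category.comp_id g, h, comp_zero, comp_zero]⟩
    rw [Module.finrank_zero_of_subsingleton] at hfin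
    exact zero_ne_one hfin
  have hsc := (finrank_eq_one_iff_of_nonzero' (𝟙 (𝟙_ C)) hne).1 hfin
  obtain ⟨i, p, hip, -, htot⟩ := hV
  obtain ⟨j, hj⟩ : ∃ j, p j ≫ i j ≠ 0 := by
    by_contra! h
    apply hne
    rw [← htot, Finset.sum_eq_zero fun j _ => h j]
  obtain ⟨c, hc⟩ := hsc (p j ≫ i j)
  have hc0 : c ≠ 0 := by rintro rfl; exact hj (by rw [← hc, zero_smul])
  have hidem : (p j ≫ i j) ≫ (p j ≫ i j) = p j ≫ i j := by
    rw [Category.assoc, ← Category.assoc (i j), hip, Category.id_comp]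
  refine ⟨j, ⟨⟨i j, p j, hip j, ?_⟩⟩⟩
  rw [← hc, Linear.smul_comp, Category.id_comp] at hidem
  have h2 := congrArg (fun f => c⁻¹ • f) hidem
  simp only [inv_smul_smul₀ hc0] at h2
  rw [← hc, h2]

/-! ### Projections onto sums of graded components -/

namespace TensorGrading

variable {k : Type*} [Field k] {G : Type*} [Group G] {C : Type*} [Category* C] [Abelian C]
  [Linear k C] [MonoidalCategory C] [MonoidalPreadditive C] [MonoidalLinear k C]
  [TensorCategory k C] (gr : TensorGrading k G C)

theorem restrict_of_iso {S : Set G} {V W : C} (e : V ≅ W) (h : gr.restrict S V) :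
    gr.restrict S W := sumsOf_of_iso e h

theorem restrict_of_comp {S : Set G} {σ : G} (hσ : σ ∈ S) {V : C} (hV : gr.comp σ V) :
    gr.restrict S V := sumsOf_of (P := fun V => ∃ σ ∈ S, gr.comp σ V) ⟨σ, hσ, hV⟩

/-- The matrix entries of `f` with respect to homogeneous decompositions go between components of
different degrees. -/
theorem restrict_hom_eq_zero {S T : Set G} (h : Disjoint S T) {V W : C} (hV : gr.restrict S V)
    (hW : gr.restrict T W) (f : V ⟶ W) : f = 0 := by
  obtain ⟨J, _, A, hA, i, p, -, -, h3⟩ := hV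
  obtain ⟨J', _, B, hB, i', p', -, -, h3'⟩ := hW
  rw [← Category.id_comp f, ← h3, ← Category.comp_id (_ ≫ f), ← h3', Preadditive.comp_sum]
  refine Finset.sum_eq_zero fun j' _ => ?_
  rw [Preadditive.sum_comp, Preadditive.sum_comp]
  refine Finset.sum_eq_zero fun j _ => ?_
  obtain ⟨s, hs, hsA⟩ := hA j
  obtain ⟨t, ht, htB⟩ := hB j'
  have hst : s ≠ t := fun h' => Set.disjoint_left.1 h hs (h' ▸ ht)
  have h0 := gr.isGrading.hom_eq_zero hst hsA htB (i j ≫ f ≫ p' j')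
  have : ((p j ≫ i j) ≫ f) ≫ p' j' ≫ i' j' = p j ≫ (i j ≫ f ≫ p' j') ≫ i' j' := by simp
  rw [this, h0, zero_comp, comp_zero]

/-- The homogeneous summands of `V` are sorted by whether their degree lies in `S`. A zero summand
has every degree, so a degree is chosen for each summand before sorting. -/
theorem exists_part (S : Set G) (V : C) : ∃ (P Q : C) (i : P ⟶ V) (r : V ⟶ P) (i' : Q ⟶ V)
    (r' : V ⟶ Q), gr.restrict S P ∧ gr.restrict Sᶜ Q ∧ i ≫ r = 𝟙 P ∧ r ≫ i + r' ≫ i' = 𝟙 V := by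
  classical
  obtain ⟨J, _, W, hW, i, p, h1, h2, h3⟩ := gr.isGrading.total V
  choose d hd using hW
  have := Abelian.hasFiniteBiproducts (C := C)
  have key : ∀ T : Set G, gr.restrict T (⨁ fun j : {j // d j ∈ T} => W j) := fun T =>
    ⟨{j // d j ∈ T}, inferInstance, fun j => W j, fun j => ⟨d j, j.2, hd j⟩,
      isDirectSum_biproduct _⟩
  refine ⟨⨁ fun j : {j // d j ∈ S} => W j, ⨁ fun j : {j // d j ∈ Sᶜ} => W j,
    biproduct.desc fun j => i j, biproduct.lift fun j => p j,
    biproduct.desc fun j => i j, biproduct.lift fun j => p j, key S, key Sᶜ, ?_, ?_⟩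
  · ext a b
    simp only [biproduct.ι_desc_assoc, Category.assoc, biproduct.lift_π, Category.id_comp]
    by_cases hab : a = b
    · subst hab
      rw [h1, biproduct.ι_π_self]
    · rw [h2 _ _ (fun h => hab (Subtype.ext h.symm)), biproduct.ι_π_ne _ (Ne.symm hab)]
  · rw [biproduct.lift_desc, biproduct.lift_desc, ← h3]
    exact Fintype.sum_subtype_add_sum_subtype (fun j => d j ∈ S) fun j => p j ≫ i j

/-- The component of `V` in `C_S`. -/
def part (S : Set G) (V : C) : C := (gr.exists_part S V).choose

/-- The complement of the component of `V` in `C_S`. -/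
def copart (S : Set G) (V : C) : C := (gr.exists_part S V).choose_spec.choose

/-- The inclusion of the component in `C_S`. -/
def partι (S : Set G) (V : C) : gr.part S V ⟶ V :=
  (gr.exists_part S V).choose_spec.choose_spec.choose

/-- The projection to the component in `C_S`. -/
def partπ (S : Set G) (V : C) : V ⟶ gr.part S V :=
  (gr.exists_part S V).choose_spec.choose_spec.choose_spec.choose

theorem part_spec (S : Set G) (V : C) : ∃ (i' : gr.copart S V ⟶ V) (r' : V ⟶ gr.copart S V),
    gr.restrict S (gr.part S V) ∧ gr.restrict Sᶜ (gr.copart S V) ∧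
    gr.partι S V ≫ gr.partπ S V = 𝟙 _ ∧ gr.partπ S V ≫ gr.partι S V + r' ≫ i' = 𝟙 V :=
  (gr.exists_part S V).choose_spec.choose_spec.choose_spec.choose_spec

theorem part_mem (S : Set G) (V : C) : gr.restrict S (gr.part S V) :=
  (gr.part_spec S V).choose_spec.choose_spec.1

@[simp]
theorem partι_partπ (S : Set G) (V : C) : gr.partι S V ≫ gr.partπ S V = 𝟙 _ :=
  (gr.part_spec S V).choose_spec.choose_spec.2.2.1

@[simp]
theorem partι_partπ_assoc (S : Set G) (V : C) {Z : C} (h : gr.part S V ⟶ Z) :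
    gr.partι S V ≫ gr.partπ S V ≫ h = h := by
  rw [← Category.assoc, partι_partπ, Category.id_comp]

/-- The idempotent endomorphism of `V` that projects onto the component in `C_S`. -/
def proj (S : Set G) (V : C) : V ⟶ V := gr.partπ S V ≫ gr.partι S V

@[simp]
theorem partι_proj (S : Set G) (V : C) : gr.partι S V ≫ gr.proj S V = gr.partι S V := by
  simp [proj]

@[simp]
theorem partι_proj_assoc (S : Set G) (V : C) {Z : C} (h : V ⟶ Z) :
    gr.partι S V ≫ gr.proj S V ≫ h = gr.partι S V ≫ h := by
  rw [← Category.assoc, partι_proj]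

@[simp]
theorem proj_partπ (S : Set G) (V : C) : gr.proj S V ≫ gr.partπ S V = gr.partπ S V := by
  simp [proj]

/-- No nonzero morphism joins `C_S` to its complement in either direction, so the off-diagonal parts
of `f` vanish. In other words, `proj S` is an idempotent endomorphism of the identity functor. -/
theorem proj_naturality (S : Set G) {V W : C} (f : V ⟶ W) :
    gr.proj S V ≫ f = f ≫ gr.proj S W := by
  obtain ⟨i, r, h1, h2, -, h4⟩ := gr.part_spec S V
  obtain ⟨i', r', h1', h2', -, h4'⟩ := gr.part_spec S W
  have ha : gr.partι S V ≫ f ≫ r' = 0 :=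
    gr.restrict_hom_eq_zero disjoint_compl_right h1 h2' _
  have hb : i ≫ f ≫ gr.partπ S W = 0 :=
    gr.restrict_hom_eq_zero disjoint_compl_left h2 h1' _
  have e1 : gr.proj S V ≫ f = gr.proj S V ≫ f ≫ gr.proj S W := by
    conv_lhs => rw [← Category.comp_id f, ← h4']
    simp [proj, reassoc_of% ha]
  have e2 : f ≫ gr.proj S W = gr.proj S V ≫ f ≫ gr.proj S W := by
    conv_lhs => rw [← Category.id_comp f, ← h4]
    simp [proj, reassoc_of% hb]
  rw [e1, ← e2]

theorem proj_naturality_assoc (S : Set G) {V W Z : C} (f : V ⟶ W) (h : W ⟶ Z) :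
    gr.proj S V ≫ f ≫ h = f ≫ gr.proj S W ≫ h := by
  rw [← Category.assoc, proj_naturality, Category.assoc]

theorem proj_of_mem {S : Set G} {V : C} (hV : gr.restrict S V) : gr.proj S V = 𝟙 V := by
  obtain ⟨i, r, -, h2, -, h4⟩ := gr.part_spec S V
  rw [← h4, gr.restrict_hom_eq_zero disjoint_compl_right hV h2 r, zero_comp, add_zero, proj]

theorem proj_of_disjoint {S T : Set G} (h : Disjoint T S) {V : C} (hV : gr.restrict T V) :
    gr.proj S V = 0 := by
  rw [proj, gr.restrict_hom_eq_zero h hV (gr.part_mem S V) (gr.partπ S V), zero_comp]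

/-- By naturality the projection passes through `i` and `i'`, and it is the identity on `P` and zero
on `Q`. No orthogonality of the two pieces has to be assumed. -/
theorem proj_unique {S : Set G} {V P Q : C} (i : P ⟶ V) (r : V ⟶ P) (i' : Q ⟶ V) (r' : V ⟶ Q)
    (hP : gr.restrict S P) (hQ : gr.restrict Sᶜ Q) (h : r ≫ i + r' ≫ i' = 𝟙 V) :
    gr.proj S V = r ≫ i := by
  rw [← Category.id_comp (gr.proj S V), ← h, Preadditive.add_comp, Category.assoc, Category.assoc,
    ← proj_naturality, ← proj_naturality, gr.proj_of_mem hP, gr.proj_of_disjoint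
      disjoint_compl_left hQ]
  simp

/-- The splitting of `V` into its `S`-part and the rest, tensored with `W`, is a splitting of `V ⊗
W` into a `U`-part and the rest; `proj_unique` identifies the projection. -/
theorem proj_tensor_right {S T U : Set G} (h : ∀ s ∈ S, ∀ t ∈ T, s * t ∈ U)
    (h' : ∀ s ∉ S, ∀ t ∈ T, s * t ∉ U) (V : C) {W : C} (hW : gr.restrict T W) :
    gr.proj U (V ⊗ W) = gr.proj S V ▷ W := by
  obtain ⟨i, r, h1, h2, -, h4⟩ := gr.part_spec S V
  rw [gr.proj_unique (gr.partι S V ▷ W) (gr.partπ S V ▷ W) (i ▷ W) (r ▷ W)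
    (gr.restrict_tensor h h1 hW) (gr.restrict_tensor h' h2 hW), proj, comp_whiskerRight]
  rw [← comp_whiskerRight, ← comp_whiskerRight, ← MonoidalPreadditive.add_whiskerRight, h4,
    id_whiskerRight]

theorem proj_tensor_left {S T U : Set G} (h : ∀ t ∈ T, ∀ s ∈ S, t * s ∈ U)
    (h' : ∀ t ∈ T, ∀ s ∉ S, t * s ∉ U) (V : C) {W : C} (hW : gr.restrict T W) :
    gr.proj U (W ⊗ V) = W ◁ gr.proj S V := by
  obtain ⟨i, r, h1, h2, -, h4⟩ := gr.part_spec S V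
  rw [gr.proj_unique (W ◁ gr.partι S V) (W ◁ gr.partπ S V) (W ◁ i) (W ◁ r)
    (gr.restrict_tensor h hW h1) (gr.restrict_tensor h' hW h2), proj,
    MonoidalCategory.whiskerLeft_comp]
  rw [← MonoidalCategory.whiskerLeft_comp, ← MonoidalCategory.whiskerLeft_comp,
    ← MonoidalPreadditive.whiskerLeft_add, h4, MonoidalCategory.whiskerLeft_id]

/-- The elements of the coset `x` of `H`. -/
def cosetSet {H : Subgroup G} (x : G ⧸ H) : Set G := {τ : G | (QuotientGroup.mk τ : G ⧸ H) = x}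

/-- `G ⧸ H` may be infinite, but only the cosets of the degrees of a finite homogeneous
decomposition contribute. -/
theorem exists_finset_sum_proj (H : Subgroup G) (V : C) :
    ∃ s : Finset (G ⧸ H), ∑ x ∈ s, gr.proj (cosetSet x) V = 𝟙 V := by
  classical
  obtain ⟨J, _, W, hW, i, p, h1, h2, h3⟩ := gr.isGrading.total V
  choose d hd using hW
  let c : J → G ⧸ H := fun j => QuotientGroup.mk (d j)
  -- The projection is `1` or `0` on each homogeneous summand, according to the coset of its degree.
  have key : ∀ x, gr.proj (cosetSet x) V = ∑ j, if c j = x then p j ≫ i j else 0 := by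
    intro x
    rw [← Category.id_comp (gr.proj _ V), ← h3, Preadditive.sum_comp]
    refine Finset.sum_congr rfl fun j _ => ?_
    rw [Category.assoc, ← proj_naturality]
    split_ifs with hj
    · rw [gr.proj_of_mem (gr.restrict_of_comp (show d j ∈ cosetSet x from hj) (hd j)),
        Category.id_comp]
    · rw [gr.proj_of_disjoint (S := cosetSet x) (T := {d j}) (Set.disjoint_singleton_left.2 hj)
        (gr.restrict_of_comp (Set.mem_singleton _) (hd j)), zero_comp, comp_zero]
  refine ⟨Finset.univ.image c, ?_⟩
  simp only [key]
  rw [Finset.sum_comm, ← h3]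
  refine Finset.sum_congr rfl fun j _ => ?_
  rw [Finset.sum_ite_eq, if_pos (Finset.mem_image_of_mem c (Finset.mem_univ j))]

/-- In a strongly graded tensor category the components `C_σ` and `C_{σ⁻¹}` contain objects whose
tensor product is the unit object. -/
theorem IsStrong.exists_tensor_iso_unit {gr : TensorGrading k G C} (hgr : gr.IsStrong) (σ : G) :
    ∃ V W : C, gr.comp σ V ∧ gr.comp σ⁻¹ W ∧ Nonempty (V ⊗ W ≅ 𝟙_ C) := by
  have h1 : gr.comp (σ * σ⁻¹) (𝟙_ C) := by rw [mul_inv_cancel]; exact gr.unit_mem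
  have := hgr σ σ⁻¹
  let F := ObjectProperty.ιOfLE (gr.prod_le σ σ⁻¹)
  -- Of the strong grading only essential surjectivity is used, at the unit object, which lies in
  -- `C_1 = C_{σσ⁻¹}`.
  let X := F.objPreimage ⟨𝟙_ C, h1⟩
  have e : X.obj ≅ 𝟙_ C := (gr.comp (σ * σ⁻¹)).ι.mapIso (F.objObjPreimageIso ⟨𝟙_ C, h1⟩)
  obtain ⟨J, _, U, hU, hX⟩ := X.property
  obtain ⟨j, ⟨e'⟩⟩ := exists_iso_unit_of_isDirectSum k (hX.of_iso e)
  obtain ⟨V, W, hV, hW, hVW⟩ := hU j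
  exact ⟨V, W, hV, hW, ⟨eqToIso hVW.symm ≪≫ e'⟩⟩

end TensorGrading

/-! ### The abelian category of modules over an algebra -/

namespace RightMod

section Forget

variable {C : Type*} [Category* C] [MonoidalCategory C] (A : C) [MonObj A]

/-- The functor that forgets the `A`-action. -/
@[simps]
def forget : RightMod A ⥤ C where
  obj M := M.X
  map f := f.hom

instance : (forget A).ReflectsIsomorphisms where
  reflects f hf :=
    have : IsIso f.hom := hf
    (isoMk (asIso f.hom) f.comm).isIso_hom

end Forget

section Preadditive

variable {C : Type*} [Category* C] [MonoidalCategory C] {A : C} [MonObj A]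
  [Preadditive C] [MonoidalPreadditive C]

instance : (forget A).Additive where

@[simp]
theorem sum_hom {M N : RightMod A} {J : Type*} (s : Finset J) (f : J → (M ⟶ N)) :
    (∑ j ∈ s, f j).hom = ∑ j ∈ s, (f j).hom :=
  (forget A).map_sum f s

theorem sum_whiskerRight {X Y : C} (Z : C) {J : Type*} (s : Finset J) (f : J → (X ⟶ Y)) :
    (∑ j ∈ s, f j) ▷ Z = ∑ j ∈ s, f j ▷ Z := (tensorRight Z).map_sum f s

/-- The direct sum of a finite family of modules. -/
@[simps!]
abbrev directSum {J : Type} [Fintype J] (M : J → RightMod A) [HasBiproduct fun j => (M j).X] :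
    RightMod A where
  X := ⨁ fun j => (M j).X
  act := ∑ j, biproduct.π (fun j => (M j).X) j ▷ A ≫ (M j).act ≫ biproduct.ι (fun j => (M j).X) j
  act_one := by
    have h : ∀ j, (⨁ fun j => (M j).X) ◁ MonObj.one ≫ biproduct.π (fun j => (M j).X) j ▷ A ≫
        (M j).act ≫ biproduct.ι (fun j => (M j).X) j =
        (ρ_ _).hom ≫ biproduct.π (fun j => (M j).X) j ≫ biproduct.ι (fun j => (M j).X) j := by
      intro j
      rw [whisker_exchange_assoc, reassoc_of% (M j).act_one]
      simp
    simp only [Preadditive.comp_sum, h]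
    rw [← Preadditive.comp_sum, biproduct.total, Category.comp_id]
  act_act := by
    simp only [Preadditive.comp_sum, sum_whiskerRight, comp_whiskerRight]
    refine Finset.sum_congr rfl fun j _ => ?_
    rw [whisker_exchange_assoc, Preadditive.sum_comp, Finset.sum_eq_single j]
    · simp [← comp_whiskerRight_assoc, -comp_whiskerRight]
      rw [comp_whiskerRight_assoc, reassoc_of% (M j).act_act]
    · intro b _ hb
      simp [← comp_whiskerRight_assoc, -comp_whiskerRight, biproduct.ι_π_ne _ hb]
    · simp

theorem directSum_act_π {J : Type} [Fintype J] (M : J → RightMod A)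
    [HasBiproduct fun j => (M j).X] (j : J) :
    (directSum M).act ≫ biproduct.π (fun j => (M j).X) j =
      biproduct.π (fun j => (M j).X) j ▷ A ≫ (M j).act := by
  classical
  rw [directSum_act, Preadditive.sum_comp, Finset.sum_eq_single j]
  · simp
  · intro b _ hb
    simp [biproduct.ι_π_ne _ hb]
  · simp

theorem directSum_ι_act {J : Type} [Fintype J] (M : J → RightMod A)
    [HasBiproduct fun j => (M j).X] (j : J) :
    biproduct.ι (fun j => (M j).X) j ▷ A ≫ (directSum M).act =
      (M j).act ≫ biproduct.ι (fun j => (M j).X) j := by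
  classical
  rw [directSum_act, Preadditive.comp_sum, Finset.sum_eq_single j]
  · simp [← comp_whiskerRight_assoc, -comp_whiskerRight]
  · intro b _ hb
    simp [← comp_whiskerRight_assoc, -comp_whiskerRight, biproduct.ι_π_ne _ hb.symm]
  · simp

theorem hasFiniteBiproducts [HasFiniteBiproducts C] : HasFiniteBiproducts (RightMod A) where
  out n :=
    { has_biproduct := fun M => by
        classical
        refine hasBiproduct_of_total
          { pt := directSum M
            π := fun j => ⟨biproduct.π (fun j => (M j).X) j, directSum_act_π M j⟩
            ι := fun j => ⟨biproduct.ι (fun j => (M j).X) j, (directSum_ι_act M j).symm⟩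
            ι_π := fun j j' => ?_ } ?_
        · ext
          by_cases h : j = j'
          · subst h
            simp
          · simp [biproduct.ι_π_ne _ h, h]
        · ext1
          simp [biproduct.total] }

end Preadditive

section Abelian

variable {C : Type*} [Category* C] [Abelian C] [MonoidalCategory C] [MonoidalPreadditive C]
  {A : C} [MonObj A]

/-- The kernel of a morphism of modules. -/
@[simps!]
abbrev kernelMod {M N : RightMod A} (f : M ⟶ N) : RightMod A where
  X := kernel f.hom
  act := kernel.lift f.hom (kernel.ι f.hom ▷ A ≫ M.act) (by
    rw [Category.assoc, f.comm, ← comp_whiskerRight_assoc, kernel.condition]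
    simp)
  act_one := by
    rw [← cancel_mono (kernel.ι f.hom)]
    simp [whisker_exchange_assoc, M.act_one]
  act_act := by
    rw [← cancel_mono (kernel.ι f.hom)]
    simp [whisker_exchange_assoc, ← comp_whiskerRight_assoc, -comp_whiskerRight]
    simp [M.act_act]

/-- The inclusion of the kernel. -/
@[simps!]
abbrev kernelModι {M N : RightMod A} (f : M ⟶ N) : kernelMod f ⟶ M where
  hom := kernel.ι f.hom
  comm := by simp

theorem kernelModι_comp {M N : RightMod A} (f : M ⟶ N) : kernelModι f ≫ f = 0 :=
  hom_ext (kernel.condition f.hom)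

/-- The kernel fork of a morphism of modules is a limit. -/
def kernelModIsLimit {M N : RightMod A} (f : M ⟶ N) :
    IsLimit (KernelFork.ofι (kernelModι f) (kernelModι_comp f)) :=
  KernelFork.IsLimit.ofι _ _
    (fun {L} g hg => ⟨kernel.lift f.hom g.hom (congrArg Hom.hom hg), by
      rw [← cancel_mono (kernel.ι f.hom)]
      simp [g.comm, ← comp_whiskerRight_assoc, -comp_whiskerRight]⟩)
    (fun g hg => hom_ext (kernel.lift_ι _ _ _))
    (fun g hg m hm => hom_ext (by
      rw [← cancel_mono (kernel.ι f.hom)]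
      exact (congrArg Hom.hom hm).trans (kernel.lift_ι _ _ _).symm))

instance : HasKernels (RightMod A) where
  has_limit f := ⟨⟨⟨_, kernelModIsLimit f⟩⟩⟩

instance {M N : RightMod A} (f : M ⟶ N) : PreservesLimit (parallelPair f 0) (forget A) :=
  preservesLimit_of_preserves_limit_cone (kernelModIsLimit f)
    ((KernelFork.isLimitMapConeEquiv _ (forget A)).symm (kernelIsKernel f.hom))

variable [PreservesFiniteColimits (tensorRight A)]

/-- The tensor product with `A` preserves the cokernel of `f`. -/
def cokernelTensor {X Y : C} (f : X ⟶ Y) :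
    IsColimit (CokernelCofork.ofπ (f := f ▷ A) (cokernel.π f ▷ A)
      (by rw [← comp_whiskerRight, cokernel.condition]; simp)) :=
  (CokernelCofork.isColimitMapCoconeEquiv _ (tensorRight A))
    (isColimitOfPreserves (tensorRight A) (colimit.isColimit (parallelPair f 0)))

instance {X Y : C} (f : X ⟶ Y) [Epi f] : Epi (f ▷ A) :=
  inferInstanceAs (Epi ((tensorRight A).map f))

/-- The cokernel of a morphism of modules. -/
@[simps!]
abbrev cokernelMod {M N : RightMod A} (f : M ⟶ N) : RightMod A where
  X := cokernel f.hom
  -- Right exactness of `- ⊗ A` makes `coker f ⊗ A` the cokernel of `f ⊗ A`, so the action of `N`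
  -- descends to it. Kernels need no such hypothesis.
  act := (cokernelTensor f.hom).desc (CokernelCofork.ofπ (N.act ≫ cokernel.π f.hom) (by
    rw [← Category.assoc, ← f.comm, Category.assoc, cokernel.condition, comp_zero]))
  act_one := by
    have h := (cokernelTensor f.hom).fac (CokernelCofork.ofπ (N.act ≫ cokernel.π f.hom) (by
      rw [← Category.assoc, ← f.comm, Category.assoc, cokernel.condition, comp_zero]))
        WalkingParallelPair.one
    dsimp at h
    have : Epi (cokernel.π f.hom ▷ 𝟙_ C) := by
      rw [MonoidalCategory.whiskerRight_id]
      infer_instance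
    rw [← cancel_epi (cokernel.π f.hom ▷ 𝟙_ C), ← whisker_exchange_assoc, h,
      reassoc_of% N.act_one, rightUnitor_naturality]
  act_act := by
    have h := (cokernelTensor f.hom).fac (CokernelCofork.ofπ (N.act ≫ cokernel.π f.hom) (by
      rw [← Category.assoc, ← f.comm, Category.assoc, cokernel.condition, comp_zero]))
        WalkingParallelPair.one
    dsimp at h
    rw [← cancel_epi (cokernel.π f.hom ▷ A ▷ A), ← comp_whiskerRight_assoc, h,
      comp_whiskerRight_assoc, h, reassoc_of% N.act_act, associator_naturality_left_assoc,
      ← whisker_exchange_assoc, h]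

theorem π_cokernelMod_act {M N : RightMod A} (f : M ⟶ N) :
    cokernel.π f.hom ▷ A ≫ (cokernelMod f).act = N.act ≫ cokernel.π f.hom :=
  (cokernelTensor f.hom).fac _ WalkingParallelPair.one

/-- The projection to the cokernel. -/
@[simps!]
abbrev cokernelModπ {M N : RightMod A} (f : M ⟶ N) : N ⟶ cokernelMod f where
  hom := cokernel.π f.hom
  comm := (π_cokernelMod_act f).symm

theorem comp_cokernelModπ {M N : RightMod A} (f : M ⟶ N) : f ≫ cokernelModπ f = 0 :=
  hom_ext (cokernel.condition f.hom)

/-- The cokernel cofork of a morphism of modules is a colimit. -/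
def cokernelModIsColimit {M N : RightMod A} (f : M ⟶ N) :
    IsColimit (CokernelCofork.ofπ (cokernelModπ f) (comp_cokernelModπ f)) :=
  CokernelCofork.IsColimit.ofπ _ _
    (fun {L} g hg => ⟨cokernel.desc f.hom g.hom (congrArg Hom.hom hg), by
      rw [← cancel_epi (cokernel.π f.hom ▷ A), ← Category.assoc, π_cokernelMod_act]
      simp [g.comm, ← comp_whiskerRight_assoc, -comp_whiskerRight]⟩)
    (fun g hg => hom_ext (cokernel.π_desc _ _ _))
    (fun g hg m hm => hom_ext (by
      rw [← cancel_epi (cokernel.π f.hom)]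
      exact (congrArg Hom.hom hm).trans (cokernel.π_desc _ _ _).symm))

instance : HasCokernels (RightMod A) where
  has_colimit f := ⟨⟨⟨_, cokernelModIsColimit f⟩⟩⟩

instance {M N : RightMod A} (f : M ⟶ N) : PreservesColimit (parallelPair f 0) (forget A) :=
  preservesColimit_of_preserves_colimit_cocone (cokernelModIsColimit f)
    ((CokernelCofork.isColimitMapCoconeEquiv _ (forget A)).symm (cokernelIsCokernel f.hom))

instance : HasFiniteProducts (RightMod A) :=
  have := Abelian.hasFiniteBiproducts (C := C)
  have := hasFiniteBiproducts (A := A)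
  inferInstance

/-- Modules over an algebra in an abelian category with right exact tensor product form an abelian
category. -/
instance : Abelian (RightMod A) :=
  have : ∀ {M N : RightMod A} (f : M ⟶ N), IsIso (Abelian.coimageImageComparison f) := by
    intro M N f
    -- The forgetful functor preserves kernels and cokernels. It therefore carries the comparison to
    -- that of `f.hom` in the abelian category `C`, and invertibility is reflected back.
    have h := Abelian.PreservesCoimage.hom_coimageImageComparison (forget A) f
    have : IsIso ((forget A).map (Abelian.coimageImageComparison f)) := by
      rw [← Iso.comp_inv_eq] at h
      rw [← h]
      infer_instance
    exact isIso_of_reflects_iso _ (forget A)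
  Abelian.ofCoimageImageComparisonIsIso

instance : PreservesFiniteLimits (forget A) := by
  have := Abelian.hasFiniteBiproducts (C := C)
  have := hasFiniteBiproducts (A := A)
  exact (forget A).preservesFiniteLimits_of_preservesKernels

instance : PreservesFiniteColimits (forget A) := by
  have := Abelian.hasFiniteBiproducts (C := C)
  have := hasFiniteBiproducts (A := A)
  exact (forget A).preservesFiniteColimits_of_preservesCokernels

end Abelian

end RightMod

/-! ### Exactness of the action on modules -/

theorem preservesFiniteLimits_of_comp {C D E : Type*} [Category* C] [Category* D] [Category* E]
    (F : C ⥤ D) (U : D ⥤ E) [HasFiniteLimits D] [PreservesFiniteLimits U]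
    [U.ReflectsIsomorphisms] (h : PreservesFiniteLimits (F ⋙ U)) : PreservesFiniteLimits F where
  preservesFiniteLimits J _ _ :=
    have : PreservesLimitsOfShape J (F ⋙ U) := h.preservesFiniteLimits J
    have : ReflectsLimitsOfShape J U := reflectsLimitsOfShape_of_reflectsIsomorphisms
    preservesLimitsOfShape_of_reflects_of_preserves F U

theorem preservesFiniteColimits_of_comp {C D E : Type*} [Category* C] [Category* D] [Category* E]
    (F : C ⥤ D) (U : D ⥤ E) [HasFiniteColimits D] [PreservesFiniteColimits U]
    [U.ReflectsIsomorphisms] (h : PreservesFiniteColimits (F ⋙ U)) :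
    PreservesFiniteColimits F where
  preservesFiniteColimits J _ _ :=
    have : PreservesColimitsOfShape J (F ⋙ U) := h.preservesFiniteColimits J
    have : ReflectsColimitsOfShape J U := reflectsColimitsOfShape_of_reflectsIsomorphisms
    preservesColimitsOfShape_of_reflects_of_preserves F U

theorem isAbelian_of_abelian (M : Type*) [Category* M] [h : Abelian M] : IsAbelian M :=
  ⟨inferInstance, inferInstance, inferInstance, ⟨fun f _ => ⟨normalMonoOfMono f⟩⟩,
    ⟨fun f _ => ⟨normalEpiOfEpi f⟩⟩⟩

/-- Followed by the forgetful functor, the two partial actions become `V ⊗ -` on underlying objects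
and `- ⊗ M.X`, which are exact in a tensor category. The forgetful functor is exact and reflects
isomorphisms, so exactness lifts. -/
theorem RightMod.isModuleCategory (k : Type*) [Field k] {C : Type*} [Category* C] [Abelian C]
    [Linear k C] [MonoidalCategory C] [MonoidalPreadditive C] [MonoidalLinear k C]
    [TensorCategory k C] (A : C) [MonObj A] : IsModuleCategory k C (RightMod A) := by
  have : PreservesFiniteColimits (tensorRight A) := TensorCategory.tensorRight_colimits k A
  exact
  { abelian := isAbelian_of_abelian _
    bilinear := inferInstance
    actionLeft_limits := fun V => by
      have : PreservesFiniteLimits (tensorLeft V) := TensorCategory.tensorLeft_limits k V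
      exact preservesFiniteLimits_of_comp _ (forget A)
        (inferInstanceAs (PreservesFiniteLimits (forget A ⋙ tensorLeft V)))
    actionLeft_colimits := fun V => by
      have : PreservesFiniteColimits (tensorLeft V) := TensorCategory.tensorLeft_colimits k V
      exact preservesFiniteColimits_of_comp _ (forget A)
        (inferInstanceAs (PreservesFiniteColimits (forget A ⋙ tensorLeft V)))
    actionRight_limits := fun M =>
      preservesFiniteLimits_of_comp _ (forget A) (TensorCategory.tensorRight_limits k M.X)
    actionRight_colimits := fun M =>
      preservesFiniteColimits_of_comp _ (forget A) (TensorCategory.tensorRight_colimits k M.X) }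

/-! ### Components in `C_H`, and the recovery of `X` from `V ⊗ (W ⊗ X)_H` -/

namespace TensorGrading

variable {k : Type*} [Field k] {G : Type*} [Group G] {C : Type*} [Category* C] [Abelian C]
  [Linear k C] [MonoidalCategory C] [MonoidalPreadditive C] [MonoidalLinear k C]
  [TensorCategory k C] (gr : TensorGrading k G C)

section Part

variable (S : Set G)

/-- The morphism induced on the components in `C_S`. -/
def partMap {V W : C} (f : V ⟶ W) : gr.part S V ⟶ gr.part S W :=
  gr.partι S V ≫ f ≫ gr.partπ S W

theorem partπ_partι (V : C) : gr.partπ S V ≫ gr.partι S V = gr.proj S V := rfl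

theorem partπ_partι_assoc (V : C) {Z : C} (h : V ⟶ Z) :
    gr.partπ S V ≫ gr.partι S V ≫ h = gr.proj S V ≫ h := by
  rw [← Category.assoc, partπ_partι]

@[simp]
theorem partMap_partι {V W : C} (f : V ⟶ W) :
    gr.partMap S f ≫ gr.partι S W = gr.partι S V ≫ f := by
  rw [partMap, Category.assoc, Category.assoc, partπ_partι, ← proj_naturality, partι_proj_assoc]

@[simp]
theorem partπ_partMap {V W : C} (f : V ⟶ W) :
    gr.partπ S V ≫ gr.partMap S f = f ≫ gr.partπ S W := by
  rw [partMap, partπ_partι_assoc, proj_naturality_assoc, proj_partπ]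

@[simp]
theorem partMap_id (V : C) : gr.partMap S (𝟙 V) = 𝟙 _ := by simp [partMap]

theorem partMap_comp {U V W : C} (f : U ⟶ V) (g : V ⟶ W) :
    gr.partMap S (f ≫ g) = gr.partMap S f ≫ gr.partMap S g := by
  conv_rhs => rw [partMap, Category.assoc, Category.assoc, partπ_partMap]
  simp [partMap]

end Part

section Sub

variable (H : Subgroup G)

/-- For `h ∈ H`, `sh ∈ H` exactly when `s ∈ H`. This compatibility with the right action of `C_H` is
what makes `partTensor` invertible and lets an `A`-action restrict to the component in `C_H`. -/
theorem proj_tensor_sub (V : C) {W : C} (hW : gr.sub H W) :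
    gr.proj (H : Set G) (V ⊗ W) = gr.proj (H : Set G) V ▷ W :=
  gr.proj_tensor_right (fun _ hs _ ht => H.mul_mem hs ht)
    (fun _ hs _ ht h => hs ((H.mul_mem_cancel_right ht).1 h)) V hW

variable (W : C)

/-- The comparison morphism `(W ⊗ X)_H ⊗ T ⟶ (W ⊗ (X ⊗ T))_H`. -/
def partTensor (X T : C) :
    gr.part (H : Set G) (W ⊗ X) ⊗ T ⟶ gr.part (H : Set G) (W ⊗ X ⊗ T) :=
  gr.partι (H : Set G) (W ⊗ X) ▷ T ≫ (α_ W X T).hom ≫ gr.partπ (H : Set G) (W ⊗ X ⊗ T)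

/-- The inverse of the comparison morphism `(W ⊗ X)_H ⊗ T ⟶ (W ⊗ (X ⊗ T))_H`. -/
def partTensorInv (X T : C) :
    gr.part (H : Set G) (W ⊗ X ⊗ T) ⟶ gr.part (H : Set G) (W ⊗ X) ⊗ T :=
  gr.partι (H : Set G) (W ⊗ X ⊗ T) ≫ (α_ W X T).inv ≫ gr.partπ (H : Set G) (W ⊗ X) ▷ T

theorem partTensor_partι (X : C) {T : C} (hT : gr.sub H T) :
    gr.partTensor H W X T ≫ gr.partι (H : Set G) (W ⊗ X ⊗ T) =
      gr.partι (H : Set G) (W ⊗ X) ▷ T ≫ (α_ W X T).hom := by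
  rw [partTensor, Category.assoc, Category.assoc, partπ_partι, ← proj_naturality,
    gr.proj_tensor_sub H _ hT, ← comp_whiskerRight_assoc, partι_proj]

theorem partπ_partTensor (X : C) {T : C} (hT : gr.sub H T) :
    gr.partπ (H : Set G) (W ⊗ X) ▷ T ≫ gr.partTensor H W X T =
      (α_ W X T).hom ≫ gr.partπ (H : Set G) (W ⊗ X ⊗ T) := by
  rw [partTensor, ← comp_whiskerRight_assoc, partπ_partι, ← gr.proj_tensor_sub H _ hT,
    proj_naturality_assoc, proj_partπ]

theorem partTensor_hom_inv (X : C) {T : C} (hT : gr.sub H T) :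
    gr.partTensor H W X T ≫ gr.partTensorInv H W X T = 𝟙 _ := by
  rw [partTensorInv, ← Category.assoc, gr.partTensor_partι H W X hT]
  simp only [Category.assoc, Iso.hom_inv_id_assoc]
  rw [← comp_whiskerRight, partι_partπ, id_whiskerRight]

theorem partTensor_inv_hom (X : C) {T : C} (hT : gr.sub H T) :
    gr.partTensorInv H W X T ≫ gr.partTensor H W X T = 𝟙 _ := by
  rw [partTensorInv, Category.assoc, Category.assoc, gr.partπ_partTensor H W X hT]
  simp

theorem partTensor_naturality {X X' T T' : C} (f : X ⟶ X') (g : T ⟶ T') :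
    (gr.partMap (H : Set G) (W ◁ f) ⊗ₘ g) ≫ gr.partTensor H W X' T' =
      gr.partTensor H W X T ≫ gr.partMap (H : Set G) (W ◁ (f ⊗ₘ g)) := by
  have h : gr.partTensor H W X T ≫ gr.partMap (H : Set G) (W ◁ (f ⊗ₘ g)) =
      gr.partι (H : Set G) (W ⊗ X) ▷ T ≫ (α_ W X T).hom ≫ W ◁ (f ⊗ₘ g) ≫
        gr.partπ (H : Set G) (W ⊗ X' ⊗ T') := by
    simp [partTensor]
  rw [h, partTensor, MonoidalCategory.tensorHom_def', Category.assoc, ← comp_whiskerRight_assoc,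
    partMap_partι, comp_whiskerRight_assoc, whisker_exchange_assoc]
  simp [MonoidalCategory.tensorHom_def']

/-- With naturality and invertibility, this makes `X ↦ (W ⊗ X)_H` compatible with the right action
of `C_H` up to coherent isomorphism, as is needed to match the coherence relation for `α`. -/
theorem partTensor_assoc (X T : C) {U : C} (hU : gr.sub H U) :
    gr.partTensor H W X T ▷ U ≫ gr.partTensor H W (X ⊗ T) U ≫
        gr.partMap (H : Set G) (W ◁ (α_ X T U).hom) =
      (α_ _ T U).hom ≫ gr.partTensor H W X (T ⊗ U) := by
  have h : gr.partTensor H W X T ▷ U ≫ gr.partTensor H W (X ⊗ T) U =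
      (gr.partι (H : Set G) (W ⊗ X) ▷ T ≫ (α_ W X T).hom) ▷ U ≫ (α_ W (X ⊗ T) U).hom ≫
        gr.partπ (H : Set G) (W ⊗ (X ⊗ T) ⊗ U) := by
    rw [← gr.partπ_partTensor H W (X ⊗ T) hU, ← comp_whiskerRight_assoc, Category.assoc]
    rfl
  rw [reassoc_of% h, partπ_partMap]
  simp [partTensor]

variable {W} {V : C} (e : V ⊗ W ≅ 𝟙_ C)

/-- The morphism `X ⟶ V ⊗ (W ⊗ X)_H` for objects with `V ⊗ W ≅ 1`. -/
def toPart (X : C) : X ⟶ V ⊗ gr.part (H : Set G) (W ⊗ X) :=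
  (λ_ X).inv ≫ e.inv ▷ X ≫ (α_ V W X).hom ≫ V ◁ gr.partπ (H : Set G) (W ⊗ X)

/-- The morphism `V ⊗ (W ⊗ X)_H ⟶ X` for objects with `V ⊗ W ≅ 1`. -/
def ofPart (X : C) : V ⊗ gr.part (H : Set G) (W ⊗ X) ⟶ X :=
  V ◁ gr.partι (H : Set G) (W ⊗ X) ≫ (α_ V W X).inv ≫ e.hom ▷ X ≫ (λ_ X).hom

/-- The isomorphism `e` meets its inverse in the middle, and what is left is `V` tensored with
inclusion followed by projection. -/
theorem ofPart_toPart (X : C) : gr.ofPart H e X ≫ gr.toPart H e X = 𝟙 _ := by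
  simp only [ofPart, toPart, Category.assoc, Iso.hom_inv_id_assoc, hom_inv_whiskerRight_assoc,
    Iso.inv_hom_id_assoc]
  rw [← MonoidalCategory.whiskerLeft_comp, partι_partπ, MonoidalCategory.whiskerLeft_id]

theorem toPart_naturality {X X' : C} (f : X ⟶ X') :
    f ≫ gr.toPart H e X' = gr.toPart H e X ≫ V ◁ gr.partMap (H : Set G) (W ◁ f) := by
  simp only [toPart, Category.assoc, ← MonoidalCategory.whiskerLeft_comp, partπ_partMap]
  rw [leftUnitor_inv_naturality_assoc, whisker_exchange_assoc]
  simp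

/-- Compatibility of `toPart` with the right action of `C_H`. With `T = A` it makes `toMod` a
morphism of modules; with general `T` it makes `toSym` respect `α`. -/
theorem toPart_tensor (X : C) {T : C} (hT : gr.sub H T) :
    gr.toPart H e (X ⊗ T) =
      gr.toPart H e X ▷ T ≫ (α_ _ _ _).hom ≫ V ◁ gr.partTensor H W X T := by
  have : V ◁ gr.partπ (H : Set G) (W ⊗ X) ▷ T ≫ V ◁ gr.partTensor H W X T =
      V ◁ (α_ W X T).hom ≫ V ◁ gr.partπ (H : Set G) (W ⊗ X ⊗ T) := by
    rw [← MonoidalCategory.whiskerLeft_comp, gr.partπ_partTensor H W X hT,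
      MonoidalCategory.whiskerLeft_comp]
  simp [toPart, this]

/-- The projection of `X` onto its component in `C_x`, in terms of `V ⊗ W ≅ 1`. -/
theorem toPart_ofPart {σ : G} (hW : gr.comp σ⁻¹ W) (X : C) :
    gr.toPart H e X ≫ gr.ofPart H e X = gr.proj (cosetSet (σ : G ⧸ H)) X := by
  -- `W` has degree `σ⁻¹`, and left multiplication by `σ⁻¹` maps `σH` onto `H` and its complement
  -- onto the complement of `H`.
  have h : gr.proj (H : Set G) (W ⊗ X) = W ◁ gr.proj (cosetSet (σ : G ⧸ H)) X := by
    refine gr.proj_tensor_left (T := {σ⁻¹}) ?_ ?_ X (gr.restrict_of_comp (Set.mem_singleton _) hW)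
    · rintro _ rfl s hs
      exact QuotientGroup.eq.1 (Eq.symm hs)
    · rintro _ rfl s hs h
      exact hs (QuotientGroup.eq.2 h).symm
  have h' : V ◁ gr.partπ (H : Set G) (W ⊗ X) ≫ V ◁ gr.partι (H : Set G) (W ⊗ X) =
      V ◁ W ◁ gr.proj (cosetSet (σ : G ⧸ H)) X := by
    rw [← MonoidalCategory.whiskerLeft_comp, partπ_partι, h]
  simp only [toPart, ofPart, Category.assoc, reassoc_of% h']
  rw [associator_inv_naturality_right_assoc, Iso.hom_inv_id_assoc, whisker_exchange_assoc]
  simp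

end Sub

end TensorGrading

open scoped MonoidalLeftAction MonoidalRightAction

/-! ### The functor from symbols to modules, and the component in `C_H` of a module -/

namespace TensorGrading

variable {k : Type*} [Field k] {G : Type*} [Group G] {C : Type*} [Category* C] [Abelian C]
  [Linear k C] [MonoidalCategory C] [MonoidalPreadditive C] [MonoidalLinear k C]
  [TensorCategory k C] (gr : TensorGrading k G C) (H : Subgroup G)
  (A : (gr.sub H).FullSubcategory) [MonObj A]

/-- The inclusion of the `A`-modules in `C_H` into the `A`-modules in `C`. -/
@[simps]
def incl : RightMod A ⥤ RightMod A.obj where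
  obj M :=
    { X := M.X.obj
      act := M.act.hom
      act_one := congrArg (fun f => f.hom) M.act_one
      act_act := congrArg (fun f => f.hom) M.act_act }
  map f := ⟨f.hom.hom, congrArg (fun f => f.hom) f.comm⟩

/-- The balanced functor `(X, Y) ↦ X ⊗ Y` with values in the modules in `C`. -/
@[simps obj map, reducible]
def tensData : BalancedFunctor k (gr.sub H).FullSubcategory C (RightMod A) (RightMod A.obj) where
  obj X Y := X ⊙ₗ (gr.incl H A).obj Y
  map f g := f ⊙ₗₘ (gr.incl H A).map g
  map_id X Y := by simp
  map_comp f f' g g' := by simp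
  map_add_left f f' g := RightMod.hom_ext <| by
    change (f + f') ▷ _ ≫ _ ◁ g.hom.hom = f ▷ _ ≫ _ ◁ g.hom.hom + f' ▷ _ ≫ _ ◁ g.hom.hom
    simp
  map_add_right f g g' := RightMod.hom_ext <| by
    change f ▷ _ ≫ _ ◁ (g.hom.hom + g'.hom.hom) = f ▷ _ ≫ _ ◁ g.hom.hom + f ▷ _ ≫ _ ◁ g'.hom.hom
    simp
  map_smul_left t f g := RightMod.hom_ext <| by
    change (t • f) ▷ _ ≫ _ ◁ g.hom.hom = t • (f ▷ _ ≫ _ ◁ g.hom.hom)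
    simp
  map_smul_right t f g := RightMod.hom_ext <| by
    change f ▷ _ ≫ _ ◁ (t • g.hom.hom) = t • (f ▷ _ ≫ _ ◁ g.hom.hom)
    simp
  iso X V Y := (αₗ X V.obj ((gr.incl H A).obj Y) :)
  naturality {X X' V V' Y Y'} f u g := RightMod.hom_ext <| by
    change ((f ⊗ₘ u.hom) ▷ _ ≫ _ ◁ g.hom.hom) ≫ (α_ X' V'.obj Y'.X.obj).hom =
      (α_ X V.obj Y.X.obj).hom ≫ f ▷ _ ≫ X' ◁ (u.hom ▷ Y.X.obj ≫ V'.obj ◁ g.hom.hom)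
    simp [MonoidalCategory.tensorHom_def]
  coherence X V W Y := RightMod.hom_ext <| by
    change ((α_ X V.obj W.obj).hom ▷ _ ≫ _ ◁ 𝟙 _) ≫ (α_ X (V.obj ⊗ W.obj) Y.X.obj).hom ≫
        ((𝟙 X) ▷ _ ≫ X ◁ (α_ V.obj W.obj Y.X.obj).hom) =
      (α_ (X ⊗ V.obj) W.obj Y.X.obj).hom ≫ (α_ X V.obj (W.obj ⊗ Y.X.obj)).hom
    simp

/-- The functor `[X, Y] ↦ X ⊗ Y` on symbols. -/
abbrev tensFunctor : Sym k (gr.sub H).FullSubcategory C (RightMod A) ⥤ RightMod A.obj :=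
  (gr.tensData H A).lift

/-- As `A` lies in `C_H`, the action maps `M_H ⊗ A` into `M_H`, so projecting afterwards changes
nothing: `M_H` is stable under `A`. -/
theorem part_act_partι (M : RightMod A.obj) :
    gr.partι (H : Set G) M.X ▷ A.obj ≫ M.act ≫ gr.partπ (H : Set G) M.X ≫
      gr.partι (H : Set G) M.X = gr.partι (H : Set G) M.X ▷ A.obj ≫ M.act := by
  rw [partπ_partι, ← proj_naturality, gr.proj_tensor_sub H _ A.property, ← comp_whiskerRight_assoc,
    partι_proj]

/-- The component in `C_H` of a module. -/
@[simps]
def partMod : RightMod A.obj ⥤ RightMod A where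
  obj M :=
    { X := ⟨gr.part (H : Set G) M.X, gr.part_mem _ _⟩
      act := ObjectProperty.homMk
        (gr.partι (H : Set G) M.X ▷ A.obj ≫ M.act ≫ gr.partπ (H : Set G) M.X)
      act_one := by
        ext
        change _ ◁ (MonObj.one : 𝟙_ C ⟶ A.obj) ≫ gr.partι (H : Set G) M.X ▷ A.obj ≫ M.act ≫ _ =
          (ρ_ _).hom
        rw [whisker_exchange_assoc, reassoc_of% M.act_one, rightUnitor_naturality_assoc,
          partι_partπ, Category.comp_id]
      act_act := by
        ext
        change (gr.partι (H : Set G) M.X ▷ A.obj ≫ M.act ≫ gr.partπ (H : Set G) M.X) ▷ A.obj ≫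
            gr.partι (H : Set G) M.X ▷ A.obj ≫ M.act ≫ gr.partπ (H : Set G) M.X =
          (α_ _ _ _).hom ≫ _ ◁ (MonObj.mul : A.obj ⊗ A.obj ⟶ A.obj) ≫
            gr.partι (H : Set G) M.X ▷ A.obj ≫ M.act ≫ gr.partπ (H : Set G) M.X
        rw [← comp_whiskerRight_assoc, Category.assoc, Category.assoc, gr.part_act_partι,
          comp_whiskerRight_assoc, whisker_exchange_assoc, reassoc_of% M.act_act,
          associator_naturality_left_assoc] }
  map {M N} f := ⟨ObjectProperty.homMk (gr.partMap (H : Set G) f.hom), by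
    ext
    change (gr.partι (H : Set G) M.X ▷ A.obj ≫ M.act ≫ gr.partπ (H : Set G) M.X) ≫
        gr.partMap (H : Set G) f.hom = gr.partMap (H : Set G) f.hom ▷ A.obj ≫
      gr.partι (H : Set G) N.X ▷ A.obj ≫ N.act ≫ gr.partπ (H : Set G) N.X
    rw [← comp_whiskerRight_assoc, partMap_partι]
    simp [reassoc_of% f.comm]⟩
  map_id M := by
    ext
    exact gr.partMap_id _ _
  map_comp f g := by
    ext
    exact gr.partMap_comp _ _ _

instance : (gr.partMod H A).Additive where
  map_add := by
    intros
    ext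
    change gr.partMap _ (_ + _) = gr.partMap _ _ + gr.partMap _ _
    simp only [partMap, Preadditive.add_comp, Preadditive.comp_add]
    rfl

instance : (gr.partMod H A).Linear k where
  map_smul := by
    intros
    ext
    change gr.partMap _ (_ • _) = _ • gr.partMap _ _
    simp only [partMap, Linear.smul_comp, Linear.comp_smul]
    rfl

end TensorGrading

/-- The diagram chase behind `symTensorIso_hom_assoc`: there `h₁` is the coherence relation for `α`,
`h₂` the naturality of `α`, and `h₃` the associativity of the isomorphisms `partModTensor`. -/
theorem comp_eq_of_squares {D : Type*} [Category* D] {X₀ X₁ X₂ X₃ Y₁ Y₂ Z₁ Z₂ Z₃ : D}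
    {b₁ : X₀ ⟶ X₁} {b₂ : X₁ ⟶ X₂} {m : X₂ ⟶ X₃} {a : X₀ ⟶ Y₁} {b : Y₁ ⟶ Y₂} {c : Y₂ ⟶ X₂}
    {t : Y₁ ⟶ Z₁} {b' : Z₁ ⟶ Z₂} {m' : Z₂ ⟶ Z₃} {n : Z₃ ⟶ X₃} {s : Y₂ ⟶ Z₂}
    (h₁ : a ≫ b ≫ c = b₁ ≫ b₂) (h₂ : t ≫ b' = b ≫ s) (h₃ : c ≫ m = s ≫ m' ≫ n) :
    b₁ ≫ b₂ ≫ m = a ≫ t ≫ (b' ≫ m') ≫ n := by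
  rw [← Category.assoc, ← h₁]
  simp only [Category.assoc]
  rw [h₃, reassoc_of% h₂]

/-! ### The functor from modules to symbols, and its comparison maps -/

namespace TensorGrading

variable {k : Type*} [Field k] {G : Type*} [Group G] {C : Type*} [Category* C] [Abelian C]
  [Linear k C] [MonoidalCategory C] [MonoidalPreadditive C] [MonoidalLinear k C]
  [TensorCategory k C] (gr : TensorGrading k G C) (H : Subgroup G)
  (A : (gr.sub H).FullSubcategory) [MonObj A]

/-- The component of `X` in `C_H`, as an object of `C_H`. -/
abbrev partSub (X : C) : (gr.sub H).FullSubcategory := ⟨gr.part (H : Set G) X, gr.part_mem _ _⟩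

/-- The isomorphism `(W ⊗ X)_H ⊗ Y ≅ (W ⊗ (X ⊗ Y))_H` of modules. -/
def partModTensor (W X : C) (Y : RightMod A) :
    gr.partSub H (W ⊗ X) ⊙ₗ Y ≅ (gr.partMod H A).obj (W ⊙ₗ X ⊙ₗ (gr.incl H A).obj Y) :=
  RightMod.isoMk ((gr.sub H).isoMk
    { hom := gr.partTensor H W X Y.X.obj
      inv := gr.partTensorInv H W X Y.X.obj
      hom_inv_id := gr.partTensor_hom_inv H W X Y.X.property
      inv_hom_id := gr.partTensor_inv_hom H W X Y.X.property }) (by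
    ext
    change ((α_ (gr.part (H : Set G) (W ⊗ X)) Y.X.obj A.obj).hom ≫ _ ◁ Y.act.hom) ≫
        gr.partTensor H W X Y.X.obj = gr.partTensor H W X Y.X.obj ▷ A.obj ≫
      gr.partι (H : Set G) (W ⊗ X ⊗ Y.X.obj) ▷ A.obj ≫ ((α_ W (X ⊗ Y.X.obj) A.obj).hom ≫
        W ◁ ((α_ X Y.X.obj A.obj).hom ≫ X ◁ Y.act.hom)) ≫ gr.partπ (H : Set G) _
    rw [← comp_whiskerRight_assoc, gr.partTensor_partι H W X Y.X.property, partTensor,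
      Category.assoc, whisker_exchange_assoc]
    simp)

/-- The functor `M ↦ [V, (W ⊗ M)_H]`. -/
@[simps, reducible]
def symFunctor (V W : C) :
    RightMod A.obj ⥤ Sym k (gr.sub H).FullSubcategory C (RightMod A) where
  obj M := ⟨V, (gr.partMod H A).obj (W ⊙ₗ M)⟩
  map f := Sym.gen (𝟙 V) ((gr.partMod H A).map (W ⊴ₗ f))
  map_id M := by simp
  map_comp f g := by rw [Sym.gen_comp]; simp

instance (V W : C) : (gr.symFunctor H A V W).Additive where
  map_add {_ _ f g} := by
    simp [BilinearAction.add_right (k := k), Functor.map_add, Sym.gen_add_right]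

instance (V W : C) : (gr.symFunctor H A V W).Linear k where
  map_smul f t := by
    simp [BilinearAction.smul_right (k := k), Functor.map_smul, Sym.gen_smul_right]

variable {V W : C} (e : V ⊗ W ≅ 𝟙_ C)

/-- The isomorphism `[V ⊗ (W ⊗ X)_H, Y] ≅ [V, (W ⊗ (X ⊗ Y))_H]`. -/
@[simps]
def symTensorIso (V W X : C) (Y : RightMod A) :
    (⟨V ⊗ gr.part (H : Set G) (W ⊗ X), Y⟩ : Sym k (gr.sub H).FullSubcategory C (RightMod A)) ≅
      (gr.symFunctor H A V W).obj (X ⊙ₗ (gr.incl H A).obj Y) where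
  hom := (Sym.bal V (gr.partSub H (W ⊗ X)) Y).hom ≫
    Sym.gen (𝟙 V) (gr.partModTensor H A W X Y).hom
  inv := Sym.gen (𝟙 V) (gr.partModTensor H A W X Y).inv ≫
    (Sym.bal V (gr.partSub H (W ⊗ X)) Y).inv
  hom_inv_id := by
    rw [Category.assoc, ← Category.assoc (Sym.gen _ _), Sym.gen_comp]
    rw [Iso.hom_inv_id, Category.comp_id, Sym.gen_id, Category.id_comp, Iso.hom_inv_id]
  inv_hom_id := by
    rw [Category.assoc, Iso.inv_hom_id_assoc, Sym.gen_comp]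
    simp

/-- The natural morphism `[X, Y] ⟶ [V, (W ⊗ (X ⊗ Y))_H]` for objects with `V ⊗ W ≅ 1`. -/
def toSym (p : Sym k (gr.sub H).FullSubcategory C (RightMod A)) :
    p ⟶ (gr.symFunctor H A V W).obj ((gr.tensFunctor H A).obj p) :=
  Sym.gen (gr.toPart H e p.left) (𝟙 p.right) ≫ (gr.symTensorIso H A V W p.left p.right).hom

/-- The morphism `[V, (W ⊗ (X ⊗ Y))_H] ⟶ [X, Y]` for objects with `V ⊗ W ≅ 1`. -/
def ofSym (p : Sym k (gr.sub H).FullSubcategory C (RightMod A)) :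
    (gr.symFunctor H A V W).obj ((gr.tensFunctor H A).obj p) ⟶ p :=
  (gr.symTensorIso H A V W p.left p.right).inv ≫ Sym.gen (gr.ofPart H e p.left) (𝟙 p.right)

/-- The isomorphism `symTensorIso` cancels, so the composite takes place in the first entry, where
`toPart_ofPart` applies. -/
theorem toSym_ofSym {σ : G} (hW : gr.comp σ⁻¹ W)
    (p : Sym k (gr.sub H).FullSubcategory C (RightMod A)) :
    gr.toSym H A e p ≫ gr.ofSym H A e p =
      Sym.gen (gr.proj (cosetSet (σ : G ⧸ H)) p.left) (𝟙 p.right) := by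
  rw [toSym, ofSym, Category.assoc, Iso.hom_inv_id_assoc, Sym.gen_comp,
    gr.toPart_ofPart H e hW, Category.comp_id]

/-- Naturality of `α` moves `(W ⊗ f)_H` from the left entry of the symbol to the right one, where
`partTensor_naturality` takes over. -/
theorem symTensorIso_hom_naturality (V W : C) {X X' : C} {Y Y' : RightMod A} (f : X ⟶ X')
    (g : Y ⟶ Y') :
    Sym.gen (V ◁ gr.partMap (H : Set G) (W ◁ f)) g ≫ (gr.symTensorIso H A V W X' Y').hom =
      (gr.symTensorIso H A V W X Y).hom ≫
        (gr.symFunctor H A V W).map (f ⊙ₗₘ (gr.incl H A).map g) := by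
  have h1 := Sym.bal_naturality (k := k) (𝟙 V)
    (ObjectProperty.homMk (gr.partMap (H : Set G) (W ◁ f)) :
      gr.partSub H (W ⊗ X) ⟶ gr.partSub H (W ⊗ X')) g
  have h2 : ((ObjectProperty.homMk (gr.partMap (H : Set G) (W ◁ f)) :
      gr.partSub H (W ⊗ X) ⟶ gr.partSub H (W ⊗ X')) ⊙ₗₘ g) ≫
        (gr.partModTensor H A W X' Y').hom = (gr.partModTensor H A W X Y).hom ≫
      (gr.partMod H A).map (W ⊴ₗ (f ⊙ₗₘ (gr.incl H A).map g)) := by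
    ext
    have h := gr.partTensor_naturality H W f g.hom.hom
    rw [MonoidalCategory.tensorHom_def, MonoidalCategory.tensorHom_def] at h
    exact h
  simp only [MonoidalRightAction.id_actionHom] at h1
  rw [symTensorIso_hom, symTensorIso_hom, symFunctor_map, Category.assoc, Sym.gen_comp, ← h2,
    ← Sym.gen_comp]
  erw [reassoc_of% h1]

/-- Moving `T` and then `(W ⊗ X)_H` across the symbol agrees with moving their product at once, by
the coherence relation; on the right entry the difference is absorbed by `partTensor_assoc`. -/
theorem symTensorIso_hom_assoc (V W X : C) (T : (gr.sub H).FullSubcategory) (Y : RightMod A) :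
    (Sym.bal (V ⊗ gr.part (H : Set G) (W ⊗ X)) T Y).hom ≫
        (gr.symTensorIso H A V W X (T ⊙ₗ Y)).hom =
      Sym.gen ((α_ _ _ _).hom ≫ V ◁ gr.partTensor H W X T.obj) (𝟙 Y) ≫
        (gr.symTensorIso H A V W (X ⊗ T.obj) Y).hom ≫
          (gr.symFunctor H A V W).map (αₗ X T.obj ((gr.incl H A).obj Y)).hom := by
  have h1 := Sym.bal_naturality (k := k) (𝟙 V) (ObjectProperty.homMk (gr.partTensor H W X T.obj) :
    gr.partSub H (W ⊗ X) ⊗ T ⟶ gr.partSub H (W ⊗ X ⊗ T.obj)) (𝟙 Y)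
  have h2 := Sym.bal_coherence (k := k) V (gr.partSub H (W ⊗ X)) T Y
  have h3 : (αₗ (gr.partSub H (W ⊗ X)) T Y).hom ≫ (gr.partModTensor H A W X (T ⊙ₗ Y)).hom =
      ((ObjectProperty.homMk (gr.partTensor H W X T.obj) :
        gr.partSub H (W ⊗ X) ⊗ T ⟶ gr.partSub H (W ⊗ X ⊗ T.obj)) ⊵ₗ Y) ≫
        (gr.partModTensor H A W (X ⊗ T.obj) Y).hom ≫
          (gr.partMod H A).map (W ⊴ₗ (αₗ X T.obj ((gr.incl H A).obj Y)).hom) := by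
    ext
    exact (gr.partTensor_assoc H W X T.obj Y.X.property).symm
  simp only [MonoidalRightAction.id_actionHom, MonoidalLeftAction.actionHom_id] at h1
  have h4 : Sym.gen (k := k) (D := (gr.sub H).FullSubcategory) (𝟙 V)
        (αₗ (gr.partSub H (W ⊗ X)) T Y).hom ≫
      Sym.gen (𝟙 V) (gr.partModTensor H A W X (T ⊙ₗ Y)).hom =
      Sym.gen (𝟙 V) ((ObjectProperty.homMk (gr.partTensor H W X T.obj) :
        gr.partSub H (W ⊗ X) ⊗ T ⟶ gr.partSub H (W ⊗ X ⊗ T.obj)) ⊵ₗ Y) ≫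
      Sym.gen (𝟙 V) (gr.partModTensor H A W (X ⊗ T.obj) Y).hom ≫
        (gr.symFunctor H A V W).map (αₗ X T.obj ((gr.incl H A).obj Y)).hom := by
    rw [Sym.gen_comp, h3, symFunctor_map, Sym.gen_comp, Sym.gen_comp, Category.comp_id,
      Category.comp_id]
    rfl
  have h5 : Sym.gen (k := k) (D := (gr.sub H).FullSubcategory)
      ((α_ V (gr.part (H : Set G) (W ⊗ X)) T.obj).hom ≫ V ◁ gr.partTensor H W X T.obj) (𝟙 Y) =
      Sym.gen (α_ V (gr.part (H : Set G) (W ⊗ X)) T.obj).hom (𝟙 Y) ≫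
        Sym.gen (V ◁ gr.partTensor H W X T.obj) (𝟙 Y) := by
    rw [Sym.gen_comp, Category.comp_id]
  rw [h5, Category.assoc]
  exact comp_eq_of_squares h2 h1 h4

/-- Morphisms of symbols have no normal form, but naturality need only be tested on the generators
`[f, g]` and `α`. The result shows that `g ≫ toSym` depends only on the image of `g` among the
modules. -/
theorem toSym_naturality {p q : Sym k (gr.sub H).FullSubcategory C (RightMod A)} (g : p ⟶ q) :
    g ≫ gr.toSym H A e q =
      gr.toSym H A e p ≫ (gr.symFunctor H A V W).map ((gr.tensFunctor H A).map g) := by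
  refine Sym.natural_of_gen (𝟭 _) (gr.tensFunctor H A ⋙ gr.symFunctor H A V W)
    (gr.toSym H A e) ?_ ?_ g
  · intro X X' Y Y' f g
    change Sym.gen f g ≫ Sym.gen (gr.toPart H e X') (𝟙 Y') ≫ _ =
      (Sym.gen (gr.toPart H e X) (𝟙 Y) ≫ _) ≫
        (gr.symFunctor H A V W).map (f ⊙ₗₘ (gr.incl H A).map g)
    rw [Category.assoc, ← symTensorIso_hom_naturality, ← Category.assoc, ← Category.assoc,
      Sym.gen_comp, Sym.gen_comp, toPart_naturality, Category.comp_id, Category.id_comp]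
  -- For `α`: naturality moves `toPart` in front, `symTensorIso_hom_assoc` replaces `α` by the
  -- associator of modules, and `toPart_tensor` reassembles `toSym` at `[X ⊗ T, Y]`.
  · intro X T Y
    have h := Sym.bal_naturality (k := k) (gr.toPart H e X) (𝟙 T) (𝟙 Y)
    simp only [MonoidalRightAction.actionHom_id, MonoidalLeftAction.id_actionHom,
      MonoidalLeftAction.actionHomRight_id] at h
    have h' : Sym.gen (gr.toPart H e X ▷ T.obj) (𝟙 Y) ≫
        Sym.gen ((α_ _ _ _).hom ≫ V ◁ gr.partTensor H W X T.obj) (𝟙 Y) ≫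
          (gr.symTensorIso H A V W (X ⊗ T.obj) Y).hom ≫
            (gr.symFunctor H A V W).map (αₗ X T.obj ((gr.incl H A).obj Y)).hom =
        gr.toSym H A e ⟨X ⊗ T.obj, Y⟩ ≫
          (gr.symFunctor H A V W).map (αₗ X T.obj ((gr.incl H A).obj Y)).hom := by
      rw [← Category.assoc, Sym.gen_comp, ← gr.toPart_tensor H e X T.property, Category.comp_id,
        toSym, Category.assoc]
    exact (Category.assoc _ _ _).symm.trans ((congrArg (· ≫ _) h.symm).trans
      ((Category.assoc _ _ _).trans ((congrArg (_ ≫ ·)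
        (gr.symTensorIso_hom_assoc H A V W X T Y)).trans h')))

/-- The natural morphism `M ⟶ V ⊗ (W ⊗ M)_H` for objects with `V ⊗ W ≅ 1`. -/
def toMod (M : RightMod A.obj) :
    M ⟶ (gr.tensFunctor H A).obj ((gr.symFunctor H A V W).obj M) where
  hom := gr.toPart H e M.X
  comm := by
    change M.act ≫ gr.toPart H e M.X = gr.toPart H e M.X ▷ A.obj ≫ (α_ _ _ _).hom ≫
      V ◁ (gr.partι (H : Set G) (W ⊗ M.X) ▷ A.obj ≫ ((α_ W M.X A.obj).hom ≫ W ◁ M.act) ≫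
        gr.partπ (H : Set G) (W ⊗ M.X))
    rw [toPart_naturality, gr.toPart_tensor H e M.X A.property, Category.assoc, Category.assoc,
      ← MonoidalCategory.whiskerLeft_comp, partTensor, Category.assoc, Category.assoc,
      partπ_partMap, Category.assoc]

/-- The natural morphism `V ⊗ (W ⊗ M)_H ⟶ M` for objects with `V ⊗ W ≅ 1`. -/
def ofMod (M : RightMod A.obj) :
    (gr.tensFunctor H A).obj ((gr.symFunctor H A V W).obj M) ⟶ M where
  hom := gr.ofPart H e M.X
  comm := by
    -- The action on `(W ⊗ M)_H` ends with a projection, and `ofPart` starts with the inclusion;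
    -- their composite can be dropped because the component is stable under `A`.
    have h := gr.part_act_partι H A (W ⊙ₗ M)
    change gr.partι (H : Set G) (W ⊗ M.X) ▷ A.obj ≫ ((α_ W M.X A.obj).hom ≫ W ◁ M.act) ≫
      gr.partπ (H : Set G) (W ⊗ M.X) ≫ gr.partι (H : Set G) (W ⊗ M.X) =
        gr.partι (H : Set G) (W ⊗ M.X) ▷ A.obj ≫ (α_ W M.X A.obj).hom ≫ W ◁ M.act at h
    change ((α_ _ _ _).hom ≫ V ◁ (gr.partι (H : Set G) (W ⊗ M.X) ▷ A.obj ≫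
      ((α_ W M.X A.obj).hom ≫ W ◁ M.act) ≫ gr.partπ (H : Set G) (W ⊗ M.X))) ≫
        gr.ofPart H e M.X = gr.ofPart H e M.X ▷ A.obj ≫ M.act
    rw [ofPart, Category.assoc, ← whiskerLeft_comp_assoc, Category.assoc, Category.assoc, h]
    simp only [MonoidalCategory.whiskerLeft_comp, Category.assoc]
    rw [associator_inv_naturality_right_assoc, whisker_exchange_assoc]
    simp

theorem toMod_naturality {M N : RightMod A.obj} (f : M ⟶ N) :
    f ≫ gr.toMod H A e N =
      gr.toMod H A e M ≫ (gr.tensFunctor H A).map ((gr.symFunctor H A V W).map f) := by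
  ext
  change f.hom ≫ gr.toPart H e N.X = gr.toPart H e M.X ≫ (𝟙 V) ▷ _ ≫ V ◁ gr.partMap _ (W ◁ f.hom)
  simp [toPart_naturality]

/-- As `α` becomes the associator, this is `toPart_tensor` for the underlying object of `p.right`.
Fullness needs it to trade `toSym` for `toMod`, which is natural for all morphisms of modules. -/
theorem tensFunctor_map_toSym (p : Sym k (gr.sub H).FullSubcategory C (RightMod A)) :
    (gr.tensFunctor H A).map (gr.toSym H A e p) =
      gr.toMod H A e ((gr.tensFunctor H A).obj p) := by
  rw [toSym, Functor.map_comp]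
  ext
  change (gr.toPart H e p.left ▷ p.right.X.obj ≫ _ ◁ 𝟙 _) ≫ (α_ _ _ _).hom ≫
    (𝟙 V) ▷ _ ≫ V ◁ gr.partTensor H W p.left p.right.X.obj =
      gr.toPart H e (p.left ⊗ p.right.X.obj)
  rw [gr.toPart_tensor H e p.left p.right.X.property]
  simp

end TensorGrading

/-! ### Linear functors from invertible lax structures -/

section LeftLinear

open Functor Functor.LaxLeftLinear

variable {C D D' : Type*} [Category* C] [MonoidalCategory C] [Category* D] [Category* D']
  [MonoidalLeftAction C D] [MonoidalLeftAction C D']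

/-- A lax linear functor whose structure morphisms are invertible is linear. -/
abbrev leftLinearOfInverse (F : D ⥤ D') [F.LaxLeftLinear C]
    (δ : ∀ (c : C) (d : D), F.obj (c ⊙ₗ d) ⟶ c ⊙ₗ F.obj d)
    (h : ∀ c d, μₗ F c d ≫ δ c d = 𝟙 _) (h' : ∀ c d, δ c d ≫ μₗ F c d = 𝟙 _) :
    F.LeftLinear C :=
  have hi : ∀ c d, IsIso (μₗ F c d) := fun c d => ⟨δ c d, h c d, h' c d⟩
  { δₗ := δ
    -- Each oplax axiom follows from the corresponding lax axiom by cancelling the isomorphisms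
    -- `μₗ`.
    δₗ_naturality_left := fun {c c'} f d => by
      rw [← cancel_mono (μₗ F c' d), ← cancel_epi (μₗ F c d)]
      simp [h', reassoc_of% h]
    δₗ_naturality_right := fun c {d d'} f => by
      rw [← cancel_mono (μₗ F c d'), ← cancel_epi (μₗ F c d)]
      simp [h', reassoc_of% h]
    δₗ_associativity := fun c c' d => by
      have h2 : c ⊴ₗ δ c' d ≫ c ⊴ₗ μₗ F c' d = 𝟙 _ := by
        rw [← MonoidalLeftAction.actionHomRight_comp, h', MonoidalLeftAction.actionHomRight_id]
      rw [← cancel_epi (μₗ F (c ⊗ c') d), reassoc_of% h, μₗ_associativity_assoc, reassoc_of% h,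
        ← MonoidalLeftAction.actionHomRight_comp, h, MonoidalLeftAction.actionHomRight_id,
        Category.comp_id]
    δₗ_unitality_inv := fun d => by
      rw [← cancel_mono (μₗ F (𝟙_ C) d), Category.assoc, h', Category.comp_id, μₗ_unitality_inv]
    μₗ_comp_δₗ := h
    δₗ_comp_μₗ := h' }

end LeftLinear

/-! ### Extension of an additive functor to finite direct sums -/

section MatLift

variable {E D : Type*} [Category* E] [Preadditive E] [Category* D] [Preadditive D]
  [HasFiniteBiproducts D]

/-- The extension of an additive functor to finite direct sums. -/
def matLift (F : E ⥤ D) [F.Additive] : Mat_ E ⥤ D where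
  obj X := ⨁ fun i => F.obj (X.X i)
  map f := biproduct.matrix fun i j => F.map (f i j)
  map_id X := by
    ext i j
    by_cases h : j = i
    · subst h; simp
    · simp [h]
  map_comp f g := by
    ext i j
    simp [biproduct.lift_desc]

variable (F : E ⥤ D) [F.Additive]

/-- The projections of the direct sum `matLift F`. -/
def matLiftπ (X : Mat_ E) (j : X.ι) : (matLift F).obj X ⟶ F.obj (X.X j) :=
  biproduct.π (fun i => F.obj (X.X i)) j

/-- The inclusions of the direct sum `matLift F`. -/
def matLiftι (X : Mat_ E) (j : X.ι) : F.obj (X.X j) ⟶ (matLift F).obj X :=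
  biproduct.ι (fun i => F.obj (X.X i)) j

@[simp]
theorem matLiftι_π_self (X : Mat_ E) (j : X.ι) : matLiftι F X j ≫ matLiftπ F X j = 𝟙 _ :=
  biproduct.ι_π_self _ j

theorem matLiftι_π_ne (X : Mat_ E) {i j : X.ι} (h : i ≠ j) :
    matLiftι F X i ≫ matLiftπ F X j = 0 :=
  biproduct.ι_π_ne _ h

theorem matLift_total (X : Mat_ E) : ∑ j, matLiftπ F X j ≫ matLiftι F X j = 𝟙 _ :=
  biproduct.total

theorem matLift_hom_ext {X : Mat_ E} {Z : D} {f g : Z ⟶ (matLift F).obj X}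
    (h : ∀ j, f ≫ matLiftπ F X j = g ≫ matLiftπ F X j) : f = g :=
  biproduct.hom_ext _ _ h

theorem matLift_map_π {X Y : Mat_ E} (f : X ⟶ Y) (j : Y.ι) :
    (matLift F).map f ≫ matLiftπ F Y j = ∑ i, matLiftπ F X i ≫ F.map (f i j) :=
  (biproduct.matrix_π (fun i j => F.map (f i j)) j).trans biproduct.desc_eq

/-- The entries of a matrix can be read off from its image, which reduces faithfulness of the
extension to that of `F`. -/
theorem matLiftι_map_π {X Y : Mat_ E} (f : X ⟶ Y) (i : X.ι) (j : Y.ι) :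
    matLiftι F X i ≫ (matLift F).map f ≫ matLiftπ F Y j = F.map (f i j) := by
  refine (congrArg (_ ≫ ·) (matLift_map_π F f j)).trans ?_
  rw [Preadditive.comp_sum]
  refine (Finset.sum_eq_single i ?_ ?_).trans ?_
  · intro i' _ h
    rw [← Category.assoc, matLiftι_π_ne F X h.symm, zero_comp]
  · intro h
    exact absurd (Finset.mem_univ i) h
  · rw [← Category.assoc, matLiftι_π_self, Category.id_comp]

theorem matLift_map_dg_π {J : Type} [Fintype J] {X Y : J → E} (f : ∀ j, X j ⟶ Y j) (j : J) :
    (matLift F).map (MatAction.dg f) ≫ matLiftπ F ⟨J, Y⟩ j =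
      matLiftπ F ⟨J, X⟩ j ≫ F.map (f j) := by
  refine (matLift_map_π F (MatAction.dg f) j).trans ((Finset.sum_eq_single j ?_ ?_).trans ?_)
  · intro i _ hi
    rw [MatAction.dg_ne f hi, Functor.map_zero, comp_zero]
  · intro h
    exact absurd (Finset.mem_univ j) h
  · rw [MatAction.dg_self]

instance : (matLift F).Additive where
  map_add {X Y f g} := matLift_hom_ext F fun j => by
    rw [Preadditive.add_comp, matLift_map_π, matLift_map_π, matLift_map_π,
      ← Finset.sum_add_distrib]
    refine Finset.sum_congr rfl fun i _ => ?_
    rw [Mat_.add_apply, F.map_add, Preadditive.comp_add]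

instance (k : Type*) [Field k] [Linear k E] [Linear k D] [F.Linear k] :
    (matLift F).Linear k where
  map_smul f t := matLift_hom_ext F fun j => by
    rw [Linear.smul_comp, matLift_map_π, matLift_map_π, Finset.smul_sum]
    refine Finset.sum_congr rfl fun i _ => ?_
    rw [MatAction.smul_apply, F.map_smul, Linear.comp_smul]

instance [F.Faithful] : (matLift F).Faithful where
  map_injective {X Y f g} h := by
    ext i j
    apply F.map_injective
    rw [← matLiftι_map_π, h, matLiftι_map_π]

instance [F.Full] : (matLift F).Full where
  map_surjective {X Y} f := by
    let g : X ⟶ Y := fun i j => F.preimage (matLiftι F X i ≫ f ≫ matLiftπ F Y j)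
    have hg : ∀ i j, F.map (g i j) = matLiftι F X i ≫ f ≫ matLiftπ F Y j :=
      fun i j => F.map_preimage _
    refine ⟨g, matLift_hom_ext F fun j => ?_⟩
    rw [matLift_map_π]
    simp only [hg]
    conv_rhs => rw [← Category.id_comp f, ← matLift_total]
    simp only [Preadditive.sum_comp, Category.assoc]

theorem IsDirectSum.nonempty_iso {J : Type} [Fintype J] {V : J → D} {X : D}
    (h : IsDirectSum V X) : Nonempty (⨁ V ≅ X) := by
  obtain ⟨i, p, h1, h2, h3⟩ := h
  refine ⟨⟨biproduct.desc i, biproduct.lift p, ?_, ?_⟩⟩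
  · ext a b
    by_cases hab : b = a
    · subst hab
      simp [h1]
    · simp [h2 _ _ hab, biproduct.ι_π_ne _ hab]
  · rw [biproduct.lift_desc, h3]

theorem matLift_essSurj
    (h : ∀ X : D, ∃ (J : Type) (_ : Fintype J) (p : J → E), IsDirectSum (fun j => F.obj (p j)) X) :
    (matLift F).EssSurj where
  mem_essImage X := by
    obtain ⟨J, _, p, hp⟩ := h X
    exact ⟨⟨J, p⟩, hp.nonempty_iso⟩

end MatLift

/-! ### Extension of a module functor structure to finite direct sums -/

section MatLiftAction

variable {E D : Type*} [Category* E] [Preadditive E] [Category* D] [Preadditive D]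
  [HasFiniteBiproducts D] (F : E ⥤ D) [F.Additive]
  (C : Type*) [Category* C] [MonoidalCategory C] [MonoidalLeftAction C E] [MonoidalLeftAction C D]

/-- The structure morphism of the extension of a linear functor to finite direct sums. -/
def matLiftμ [F.LaxLeftLinear C] (c : C) (X : Mat_ E) :
    c ⊙ₗ (matLift F).obj X ⟶ (matLift F).obj (MatAction.obj c X) :=
  biproduct.lift fun j => c ⊴ₗ matLiftπ F X j ≫ Functor.LaxLeftLinear.μₗ F c (X.X j)

theorem matLiftμ_π [F.LaxLeftLinear C] (c : C) (X : Mat_ E) (j : X.ι) :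
    matLiftμ F C c X ≫ matLiftπ F (MatAction.obj c X) j =
      c ⊴ₗ matLiftπ F X j ≫ Functor.LaxLeftLinear.μₗ F c (X.X j) :=
  biproduct.lift_π _ j

open Functor.LaxLeftLinear Functor.OplaxLeftLinear MonoidalLeftAction

theorem matLiftμ_map_dg_π [F.LaxLeftLinear C] (c : C) (X : Mat_ E) {Y : X.ι → E}
    (f : ∀ j, c ⊙ₗ X.X j ⟶ Y j) (j : X.ι) :
    (matLiftμ F C c X ≫ (matLift F).map (MatAction.dg f)) ≫ matLiftπ F ⟨X.ι, Y⟩ j =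
      c ⊴ₗ matLiftπ F X j ≫ μₗ F c (X.X j) ≫ F.map (f j) := by
  refine (Category.assoc _ _ _).trans ((congrArg (_ ≫ ·) (matLift_map_dg_π F f j)).trans ?_)
  refine (Category.assoc _ _ _).symm.trans ((congrArg (· ≫ _) (matLiftμ_π F C c X j)).trans ?_)
  exact Category.assoc _ _ _

theorem matLiftμ_naturality_left [F.LaxLeftLinear C] {c c' : C} (f : c ⟶ c') (X : Mat_ E) :
    f ⊵ₗ (matLift F).obj X ≫ matLiftμ F C c' X =
      matLiftμ F C c X ≫ (matLift F).map (MatAction.left f X) :=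
  matLift_hom_ext F fun j => by
    refine Eq.trans ?_ (matLiftμ_map_dg_π F C c X (fun j => f ⊵ₗ X.X j) j).symm
    rw [← μₗ_naturality_left, Category.assoc, matLiftμ_π, ← Category.assoc, ← action_exchange,
      Category.assoc]

theorem matLiftμ_naturality_right (k : Type*) [Field k] [Preadditive C] [Linear k C] [Linear k D]
    [BilinearAction k C D] [F.LaxLeftLinear C] (c : C) {X Y : Mat_ E} (f : X ⟶ Y) :
    c ⊴ₗ (matLift F).map f ≫ matLiftμ F C c Y =
      matLiftμ F C c X ≫ (matLift F).map (MatAction.right c f) :=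
  matLift_hom_ext F fun j => by
    rw [Category.assoc, matLiftμ_π, Category.assoc]
    refine Eq.trans ?_ (congrArg (_ ≫ ·) (matLift_map_π F (MatAction.right c f) j)).symm
    rw [← Category.assoc, ← actionHomRight_comp, matLift_map_π,
      MatAction.actionHomRight_sum (k := k), Preadditive.sum_comp]
    refine Eq.trans ?_ (Preadditive.comp_sum _ _ _).symm
    refine Finset.sum_congr rfl fun i _ => ?_
    refine Eq.trans ?_ ((Category.assoc _ _ _).symm.trans
      ((congrArg (· ≫ _) (matLiftμ_π F C c X i)))).symm
    rw [MatAction.right_apply, Category.assoc, ← μₗ_naturality_right, actionHomRight_comp,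
      Category.assoc]

variable (k : Type*) [Field k] [Preadditive C] [Linear k C] [Linear k E] [Linear k D]
  [BilinearAction k C E] [BilinearAction k C D]

/-- The extension of a linear functor to finite direct sums is lax linear. -/
abbrev matLiftLaxLeftLinear [F.LaxLeftLinear C] :
    letI := matAction k C E
    (matLift F).LaxLeftLinear C :=
  letI := matAction k C E
  { μₗ := matLiftμ F C
    μₗ_naturality_left := matLiftμ_naturality_left F C
    μₗ_naturality_right := matLiftμ_naturality_right F C k
    μₗ_associativity := fun c c' X => matLift_hom_ext F fun j => by
      refine (matLiftμ_map_dg_π F C (c ⊗ c') X (fun j => (αₗ c c' (X.X j)).hom) j).trans ?_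
      refine Eq.trans ?_ ((congrArg (fun t => (αₗ c c' ((matLift F).obj X)).hom ≫
        c ⊴ₗ matLiftμ F C c' X ≫ t) (matLiftμ_π F C c (MatAction.obj c' X) j)).symm.trans
        (by simp only [Category.assoc]; rfl))
      rw [μₗ_associativity, ← actionHomRight_comp_assoc, matLiftμ_π, actionHomRight_comp,
        tensor_actionHomRight]
      simp only [Category.assoc, Iso.inv_hom_id_assoc]
    μₗ_unitality := fun X => matLift_hom_ext F fun j => by
      refine Eq.trans ?_ (matLiftμ_map_dg_π F C (𝟙_ C) X (fun j => (λₗ (X.X j)).hom) j).symm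
      rw [← μₗ_unitality, unit_actionHomRight]
      simp }

/-- The extension of a linear functor to finite direct sums is linear. -/
abbrev matLiftLeftLinear [F.LeftLinear C] :
    letI := matAction k C E
    (matLift F).LeftLinear C :=
  letI := matAction k C E
  letI := matLiftLaxLeftLinear F C k
  leftLinearOfInverse (matLift F)
    -- `matLiftμ` is given by its components after the projections, so its inverse is assembled from
    -- the inclusions. That they are inverse uses additivity of `c ⊗ -`, which preserves the direct
    -- sum.
    (fun c X => ∑ j : X.ι, matLiftπ F (MatAction.obj c X) j ≫ δₗ F c (X.X j) ≫ c ⊴ₗ matLiftι F X j)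
    (fun c X => by
      change matLiftμ F C c X ≫ _ = _
      refine (Preadditive.comp_sum _ _ _).trans ?_
      refine (Finset.sum_congr rfl fun j _ => ?_).trans
        (?_ : ∑ j, c ⊴ₗ (matLiftπ F X j ≫ matLiftι F X j) = _)
      · refine (Category.assoc _ _ _).symm.trans
          ((congrArg (· ≫ _) (matLiftμ_π F C c X j)).trans ?_)
        simp
      · rw [← MatAction.actionHomRight_sum (k := k), matLift_total, actionHomRight_id])
    (fun c X => matLift_hom_ext F fun j => by
      refine (Category.assoc _ _ _).trans ((congrArg (_ ≫ ·) (matLiftμ_π F C c X j)).trans ?_)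
      refine (Preadditive.sum_comp _ _ _).trans ((Finset.sum_eq_single j ?_ ?_).trans ?_)
      · intro i _ hi
        have h : c ⊴ₗ matLiftι F X i ≫ c ⊴ₗ matLiftπ F X j = 0 := by
          rw [← actionHomRight_comp, matLiftι_π_ne F X hi, MatAction.actionHomRight_zero (k := k)]
        simp only [Category.assoc, reassoc_of% h, zero_comp, comp_zero]
      · intro h
        exact absurd (Finset.mem_univ j) h
      · have h : c ⊴ₗ matLiftι F X j ≫ c ⊴ₗ matLiftπ F X j = 𝟙 _ := by
          rw [← actionHomRight_comp, matLiftι_π_self, actionHomRight_id]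
        simp only [Category.assoc, reassoc_of% h, Functor.LeftLinear.δₗ_comp_μₗ]
        exact (Category.comp_id _).trans (Category.id_comp _).symm)

end MatLiftAction

theorem Sym.gen_sum_left {k D M N : Type*} [Field k] [Category* D] [MonoidalCategory D]
    [Category* M] [Preadditive M] [Linear k M] [MonoidalRightAction D M]
    [Category* N] [Preadditive N] [Linear k N] [MonoidalLeftAction D N] {X X' : M} {Y Y' : N}
    {J : Type*} (s : Finset J) (f : J → (X ⟶ X')) (g : Y ⟶ Y') :
    Sym.gen (k := k) (D := D) (∑ j ∈ s, f j) g = ∑ j ∈ s, Sym.gen (f j) g :=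
  map_sum (AddMonoidHom.mk' (fun f : X ⟶ X' => Sym.gen (k := k) (D := D) f g)
    fun f f' => Sym.gen_add_left f f' g) f s

/-! ### Full faithfulness and linearity of the functor on symbols -/

namespace TensorGrading

variable {k : Type*} [Field k] {G : Type*} [Group G] {C : Type*} [Category* C] [Abelian C]
  [Linear k C] [MonoidalCategory C] [MonoidalPreadditive C] [MonoidalLinear k C]
  [TensorCategory k C]

namespace IsStrong

variable {gr : TensorGrading k G C} (hgr : gr.IsStrong) (σ : G)

/-- A homogeneous object of degree `σ` with a right inverse. -/
def obj : C := (hgr.exists_tensor_iso_unit σ).choose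

/-- A right inverse of `hgr.obj σ`. -/
def inv : C := (hgr.exists_tensor_iso_unit σ).choose_spec.choose

theorem comp_obj : gr.comp σ (hgr.obj σ) :=
  (hgr.exists_tensor_iso_unit σ).choose_spec.choose_spec.1

theorem comp_inv : gr.comp σ⁻¹ (hgr.inv σ) :=
  (hgr.exists_tensor_iso_unit σ).choose_spec.choose_spec.2.1

/-- The isomorphism of `hgr.obj σ ⊗ hgr.inv σ` with the unit object. -/
def unitIso : hgr.obj σ ⊗ hgr.inv σ ≅ 𝟙_ C :=
  (hgr.exists_tensor_iso_unit σ).choose_spec.choose_spec.2.2.some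

end IsStrong

variable (gr : TensorGrading k G C) (H : Subgroup G)
  (A : (gr.sub H).FullSubcategory) [MonObj A]

section FullyFaithful

variable {gr}

/-- The projections of `p.left` to its coset components add up to the identity, and by `toSym_ofSym`
each of them, as a map of symbols, factors through an object that depends only on the image of `p`.
The degree used for a coset `x` is its representative `x.out`. -/
theorem exists_finset_sum_toSym (hgr : gr.IsStrong)
    (p : Sym k (gr.sub H).FullSubcategory C (RightMod A)) :
    ∃ s : Finset (G ⧸ H), ∑ x ∈ s, gr.toSym H A (hgr.unitIso x.out) p ≫
      gr.ofSym H A (hgr.unitIso x.out) p = 𝟙 p := by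
  obtain ⟨s, hs⟩ := gr.exists_finset_sum_proj H p.left
  refine ⟨s, ?_⟩
  simp only [gr.toSym_ofSym H A _ (hgr.comp_inv _), QuotientGroup.out_eq']
  rw [← Sym.gen_id, ← hs]
  exact (Sym.gen_sum_left _ _ _).symm

/-- Inserting the resolution of the identity of `q` after `f` and using naturality of `toSym`
expresses `f` through its image. -/
theorem tensFunctor_faithful (hgr : gr.IsStrong) : (gr.tensFunctor H A).Faithful where
  map_injective {p q f g} h := by
    obtain ⟨s, hs⟩ := exists_finset_sum_toSym H A hgr q
    rw [← Category.comp_id f, ← Category.comp_id g, ← hs, Preadditive.comp_sum,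
      Preadditive.comp_sum]
    refine Finset.sum_congr rfl fun x _ => ?_
    rw [← Category.assoc, ← Category.assoc, toSym_naturality, toSym_naturality, h]

theorem tensFunctor_full (hgr : gr.IsStrong) : (gr.tensFunctor H A).Full where
  map_surjective {p q} f := by
    obtain ⟨s, hs⟩ := exists_finset_sum_toSym H A hgr q
    -- The formula that recovers a morphism from its image, applied to an arbitrary `f`. Its image
    -- is `f` because `toSym` maps to `toMod`, past which `f` can be moved.
    refine ⟨∑ x ∈ s, gr.toSym H A (hgr.unitIso x.out) p ≫
      (gr.symFunctor H A _ _).map f ≫ gr.ofSym H A (hgr.unitIso x.out) q, ?_⟩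
    have h : f = ∑ x ∈ s, f ≫ (gr.tensFunctor H A).map (gr.toSym H A (hgr.unitIso x.out) q ≫
        gr.ofSym H A (hgr.unitIso x.out) q) := by
      rw [← Preadditive.comp_sum, ← Functor.map_sum, hs, CategoryTheory.Functor.map_id,
        Category.comp_id]
    rw [Functor.map_sum]
    refine (Finset.sum_congr rfl fun x _ => ?_).trans h.symm
    rw [Functor.map_comp, Functor.map_comp, Functor.map_comp, tensFunctor_map_toSym,
      tensFunctor_map_toSym, ← Category.assoc, ← toMod_naturality, Category.assoc]

end FullyFaithful

open Functor.LaxLeftLinear in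
/-- The coherent natural isomorphisms `X ⊗ (V ⊗ Y) ≅ (X ⊗ V) ⊗ Y`. -/
instance tensLaxLeftLinear : (gr.tensFunctor H A).LaxLeftLinear C where
  μₗ X p := (αₗ X p.left ((gr.incl H A).obj p.right)).inv
  μₗ_naturality_left {X X'} f p := RightMod.hom_ext <| by
    change f ▷ (p.left ⊗ p.right.X.obj) ≫ (α_ X' p.left p.right.X.obj).inv =
      (α_ X p.left p.right.X.obj).inv ≫ (f ▷ p.left) ▷ p.right.X.obj ≫ _ ◁ 𝟙 _
    simp
  μₗ_naturality_right X {p q} g := by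
    have : (MonoidalLeftAction.actionLeft (RightMod A.obj) X).Additive :=
      ⟨BilinearAction.add_right (k := k) X _ _⟩
    have : (MonoidalLeftAction.actionLeft (RightMod A.obj) X).Linear k :=
      ⟨fun f t => BilinearAction.smul_right X t f⟩
    -- Only generators have to be tested; for `α` the identity is the pentagon.
    refine Sym.natural_of_gen (gr.tensFunctor H A ⋙ MonoidalLeftAction.actionLeft _ X)
      ((BoxAction.actData X).lift ⋙ gr.tensFunctor H A)
      (fun p => (αₗ X p.left ((gr.incl H A).obj p.right)).inv) ?_ ?_ g
    · intro V V' Y Y' f g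
      refine RightMod.hom_ext ?_
      change X ◁ (f ▷ _ ≫ _ ◁ g.hom.hom) ≫ (α_ _ _ _).inv =
        (α_ _ _ _).inv ≫ (X ◁ f) ▷ _ ≫ _ ◁ g.hom.hom
      simp
    · intro V T Y
      refine RightMod.hom_ext ?_
      change X ◁ (α_ V T.obj Y.X.obj).hom ≫ (α_ X V (T.obj ⊗ Y.X.obj)).inv =
        (α_ X (V ⊗ T.obj) Y.X.obj).inv ≫ ((α_ X V T.obj).inv ▷ _ ≫ _ ◁ 𝟙 _) ≫ (α_ _ _ _).hom
      simp
  μₗ_associativity X X' p := RightMod.hom_ext <| by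
    change (α_ (X ⊗ X') p.left p.right.X.obj).inv ≫ (α_ X X' p.left).hom ▷ _ ≫ _ ◁ 𝟙 _ =
      (α_ X X' (p.left ⊗ p.right.X.obj)).hom ≫ X ◁ (α_ X' p.left p.right.X.obj).inv ≫
        (α_ X (X' ⊗ p.left) p.right.X.obj).inv
    simp
  μₗ_unitality p := RightMod.hom_ext <| by
    change (λ_ (p.left ⊗ p.right.X.obj)).hom = (α_ _ p.left p.right.X.obj).inv ≫
      (λ_ p.left).hom ▷ _ ≫ _ ◁ 𝟙 _
    simp

instance tensLeftLinear : (gr.tensFunctor H A).LeftLinear C :=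
  leftLinearOfInverse (gr.tensFunctor H A)
    (fun X p => (αₗ X p.left ((gr.incl H A).obj p.right)).hom)
    (fun _ _ => Iso.inv_hom_id _) (fun _ _ => Iso.hom_inv_id _)

end TensorGrading

/-! ### Transport of abelian, module and graded structures along equivalences -/

section Transport

variable {M N : Type*} [Category* M] [Preadditive M] [Category* N] [Preadditive N]

theorem IsDirectSum.of_iso_left {J : Type} [Fintype J] {V W : J → M} {X : M}
    (e : ∀ j, V j ≅ W j) (h : IsDirectSum V X) : IsDirectSum W X := by
  obtain ⟨i, p, h1, h2, h3⟩ := h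
  refine ⟨fun j => (e j).inv ≫ i j, fun j => p j ≫ (e j).hom, fun j => by simp [reassoc_of% h1],
    fun j j' hj => ?_, ?_⟩
  · rw [Category.assoc, ← Category.assoc (i j), h2 j j' hj, zero_comp, comp_zero]
  · simpa using h3

/-- A preadditive category that is abelian in the sense of `IsAbelian`. -/
abbrev IsAbelian.abelian (h : IsAbelian M) : Abelian M :=
  have := h.hasFiniteProducts
  have := h.hasKernels
  have := h.hasCokernels
  have := h.normalMono
  have := h.normalEpi
  { }

theorem IsAbelian.of_isEquivalence (F : M ⥤ N) [HasFiniteProducts M] [F.IsEquivalence]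
    (h : IsAbelian N) :
    IsAbelian M :=
  let _ : Abelian N := h.abelian
  let _ : Abelian M := abelianOfEquivalence F
  isAbelian_of_abelian M

theorem IsModuleCategory.of_isEquivalence (F : M ⥤ N) {k C : Type*} [Field k] [Category* C]
    [Preadditive C] [Linear k C] [MonoidalCategory C] [Linear k M] [Linear k N]
    [MonoidalLeftAction C M] [MonoidalLeftAction C N] [HasFiniteProducts M] [BilinearAction k C M]
    [F.LeftLinear C]
    [F.IsEquivalence] (h : IsModuleCategory k C N) : IsModuleCategory k C M := by
  have hM := IsAbelian.of_isEquivalence F h.abelian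
  let _ : Abelian M := hM.abelian
  -- The linear structure of `F` intertwines the partial actions on `M` and `N`. An equivalence
  -- preserves and reflects limits and colimits, so exactness on `N` passes to `M`.
  have eL (V : C) : F ⋙ MonoidalLeftAction.actionLeft N V ≅
      MonoidalLeftAction.actionLeft M V ⋙ F :=
    NatIso.ofComponents (fun X => Functor.LeftLinear.μₗIso F V X)
      fun f => Functor.LaxLeftLinear.μₗ_naturality_right F V f
  have eR (X : M) : MonoidalLeftAction.actionRight C (F.obj X) ≅
      MonoidalLeftAction.actionRight C X ⋙ F :=
    NatIso.ofComponents (fun V => Functor.LeftLinear.μₗIso F V X)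
      fun f => Functor.LaxLeftLinear.μₗ_naturality_left F f X
  exact
  { abelian := hM
    bilinear := inferInstance
    actionLeft_limits := fun V => by
      have := h.actionLeft_limits V
      exact preservesFiniteLimits_of_comp _ F
        ⟨fun J _ _ => preservesLimitsOfShape_of_natIso (eL V)⟩
    actionLeft_colimits := fun V => by
      have := h.actionLeft_colimits V
      exact preservesFiniteColimits_of_comp _ F
        ⟨fun J _ _ => preservesColimitsOfShape_of_natIso (eL V)⟩
    actionRight_limits := fun X => by
      have := h.actionRight_limits (F.obj X)
      exact preservesFiniteLimits_of_comp _ F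
        ⟨fun J _ _ => preservesLimitsOfShape_of_natIso (eR X)⟩
    actionRight_colimits := fun X => by
      have := h.actionRight_colimits (F.obj X)
      exact preservesFiniteColimits_of_comp _ F
        ⟨fun J _ _ => preservesColimitsOfShape_of_natIso (eR X)⟩ }

variable (F : M ⥤ N) [F.Additive]

theorem IsDirectSum.map {J : Type} [Fintype J] {V : J → M} {X : M} (h : IsDirectSum V X) :
    IsDirectSum (fun j => F.obj (V j)) (F.obj X) := by
  obtain ⟨i, p, h1, h2, h3⟩ := h
  refine ⟨fun j => F.map (i j), fun j => F.map (p j), fun j => ?_, fun j j' hj => ?_, ?_⟩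
  · rw [← F.map_comp, h1, F.map_id]
  · rw [← F.map_comp, h2 j j' hj, F.map_zero]
  · simp only [← F.map_comp, ← F.map_sum, h3, F.map_id]

theorem IsDirectSum.of_map [F.Full] [F.Faithful] {J : Type} [Fintype J] {V : J → M} {X : M}
    (h : IsDirectSum (fun j => F.obj (V j)) (F.obj X)) : IsDirectSum V X := by
  obtain ⟨i, p, h1, h2, h3⟩ := h
  refine ⟨fun j => F.preimage (i j), fun j => F.preimage (p j), fun j => ?_, fun j j' hj => ?_, ?_⟩
  · exact F.map_injective (by simp [h1])
  · exact F.map_injective (by simp [h2 j j' hj])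
  · exact F.map_injective (by simp [F.map_sum, h3])

theorem IsGrading.of_isEquivalence [F.IsEquivalence] {X : Type*} {comp : X → ObjectProperty M}
    {comp' : X → ObjectProperty N} (h : IsGrading comp')
    (hF : ∀ x Z, comp x Z ↔ comp' x (F.obj Z)) : IsGrading comp where
  iso x := ⟨fun e hV => (hF x _).2 ((h.iso x).of_iso (F.mapIso e) ((hF x _).1 hV))⟩
  sums x Z := by
    rintro ⟨J, _, V, hV, hZ⟩
    exact (hF x Z).2 (h.sums x _ ⟨J, _, fun j => F.obj (V j), fun j => (hF x _).1 (hV j), hZ.map F⟩)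
  hom_eq_zero hxy V W hV hW f := F.map_injective (by
    rw [h.hom_eq_zero hxy ((hF _ _).1 hV) ((hF _ _).1 hW) (F.map f), F.map_zero])
  total Z := by
    obtain ⟨J, _, V, hV, hZ⟩ := h.total (F.obj Z)
    refine ⟨J, _, fun j => F.objPreimage (V j), fun j => ?_,
      (hZ.of_iso_left fun j => (F.objObjPreimageIso (V j)).symm).of_map F⟩
    obtain ⟨x, hx⟩ := hV j
    exact ⟨x, (hF x _).2 ((h.iso x).of_iso (F.objObjPreimageIso (V j)).symm hx)⟩

theorem matAction_bilinear (k C : Type*) [Field k] [Category* C] [Preadditive C] [Linear k C]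
    [MonoidalCategory C] [Linear k M] [MonoidalLeftAction C M] [BilinearAction k C M] :
    letI := matAction k C M
    BilinearAction k C (Mat_ M) :=
  letI := matAction k C M
  { add_left := fun {V W} f g X => by
      change MatAction.dg _ = MatAction.dg _ + MatAction.dg _
      ext i j
      rw [Mat_.add_apply]
      by_cases h : i = j
      · subst h
        simp [BilinearAction.add_left (k := k)]
      · simp [MatAction.dg_ne _ h]
    smul_left := fun {V W} t f X => by
      change MatAction.dg _ = t • MatAction.dg _
      ext i j
      rw [MatAction.smul_apply]
      by_cases h : i = j
      · subst h
        simp [BilinearAction.smul_left]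
      · simp [MatAction.dg_ne _ h]
    add_right := fun V X Y f g => by
      ext i j
      exact BilinearAction.add_right (k := k) V (f i j) (g i j)
    smul_right := fun V X Y t f => by
      ext i j
      exact BilinearAction.smul_right V t (f i j) }

end Transport

section Embedding

variable {E D : Type*} [Category* E] [Preadditive E] [Category* D] [Preadditive D]
  [HasFiniteBiproducts D] (F : E ⥤ D) [F.Additive]

/-- The extension of `F` to finite direct sums agrees with `F` on `E`. -/
def matLiftEmbeddingIso (p : E) : (matLift F).obj ((Mat_.embedding E).obj p) ≅ F.obj p where
  hom := matLiftπ F ((Mat_.embedding E).obj p) PUnit.unit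
  inv := matLiftι F ((Mat_.embedding E).obj p) PUnit.unit
  hom_inv_id := by
    refine Eq.trans ?_ (matLift_total F ((Mat_.embedding E).obj p))
    exact (Fintype.sum_unique fun j : PUnit => matLiftπ F ((Mat_.embedding E).obj p) j ≫
      matLiftι F ((Mat_.embedding E).obj p) j).symm
  inv_hom_id := matLiftι_π_self F _ _

end Embedding

/-! ### The gradings and the equivalence -/

namespace TensorGrading

variable {k : Type*} [Field k] {G : Type*} [Group G] {C : Type*} [Category* C] [Abelian C]
  [Linear k C] [MonoidalCategory C] [MonoidalPreadditive C] [MonoidalLinear k C]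
  [TensorCategory k C] {gr : TensorGrading k G C} (H : Subgroup G)
  (A : (gr.sub H).FullSubcategory) [MonObj A]

theorem disjoint_cosetSet {x y : G ⧸ H} (h : x ≠ y) : Disjoint (cosetSet x) (cosetSet y) :=
  Set.disjoint_left.2 fun _ hx hy => h (Eq.trans (Eq.symm hx) hy)

/-- A left coset `x` satisfies `xH = x`, and the second entry of a symbol lies in `C_H`. -/
theorem tensFunctor_mem {x : G ⧸ H} (p : Sym k (gr.sub H).FullSubcategory C (RightMod A))
    (hp : gr.coset x p.left) : gr.modGrading H A.obj x ((gr.tensFunctor H A).obj p) :=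
  gr.restrict_tensor (fun _ hs _ ht => (QuotientGroup.mk_mul_of_mem _ ht).trans hs) hp
    p.right.X.property

theorem IsStrong.coset_obj (hgr : gr.IsStrong) (x : G ⧸ H) : gr.coset x (hgr.obj x.out) :=
  gr.restrict_of_comp (S := cosetSet x) x.out_eq (hgr.comp_obj x.out)

theorem modGrading_closed (A : C) [MonObj A] (x : G ⧸ H) :
    sumsOf (gr.modGrading H A x) ≤ gr.modGrading H A x := by
  rintro M ⟨J, _, V, hV, hM⟩
  exact sumsOf_sumsOf (fun W => ∃ σ ∈ cosetSet x, gr.comp σ W) _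
    ⟨J, _, fun j => (V j).X, hV, hM.map (RightMod.forget A)⟩

/-- The component of `M` in degree `x` is `V ⊗ (W ⊗ M)_H`, with inclusion `ofMod` and projection
`toMod`. This serves both essential surjectivity and the decomposition of modules into homogeneous
ones. -/
theorem isDirectSum_tensFunctor (hgr : gr.IsStrong) (M : RightMod A.obj) :
    ∃ (n : ℕ) (x : Fin n → G ⧸ H), IsDirectSum (fun j => (gr.tensFunctor H A).obj
      ((gr.symFunctor H A (hgr.obj (x j).out) (hgr.inv (x j).out)).obj M)) M := by
  obtain ⟨s, hs⟩ := gr.exists_finset_sum_proj H M.X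
  -- Direct sums are indexed by types in `Type`, whereas `s` lives in the universe of `G`; hence the
  -- reindexing by `Fin s.card`.
  refine ⟨s.card, fun j => (s.equivFin.symm j).1,
    fun j => gr.ofMod H A (hgr.unitIso _) M, fun j => gr.toMod H A (hgr.unitIso _) M,
    fun j => RightMod.hom_ext (gr.ofPart_toPart H _ _), fun j j' hj => RightMod.hom_ext ?_,
    RightMod.hom_ext ?_⟩
  -- Orthogonality needs no computation: the summands lie in components for different cosets.
  · refine gr.restrict_hom_eq_zero (disjoint_cosetSet H (x := (s.equivFin.symm j).1)
      (y := (s.equivFin.symm j').1) fun h => hj ?_)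
      (tensFunctor_mem H A _ (hgr.coset_obj H _)) (tensFunctor_mem H A _ (hgr.coset_obj H _)) _
    exact s.equivFin.symm.injective (Subtype.ext h)
  · refine ((RightMod.forget A.obj).map_sum _ _).trans ?_
    refine (Finset.sum_congr rfl fun j _ => gr.toPart_ofPart H _ (hgr.comp_inv _) M.X).trans ?_
    simp only [QuotientGroup.out_eq']
    rw [Equiv.sum_comp s.equivFin.symm fun y => gr.proj (cosetSet y.1) M.X,
      Finset.sum_coe_sort s fun y => gr.proj (cosetSet y) M.X, hs]
    rfl

theorem isGrading_modGrading (hgr : gr.IsStrong) : IsGrading (gr.modGrading H A.obj) where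
  iso x := ⟨fun e hV => gr.restrict_of_iso ((RightMod.forget A.obj).mapIso e) hV⟩
  sums x := modGrading_closed H A.obj x
  hom_eq_zero hxy V W hV hW f :=
    RightMod.hom_ext (gr.restrict_hom_eq_zero (disjoint_cosetSet H hxy) hV hW f.hom)
  total M := by
    obtain ⟨n, x, h⟩ := isDirectSum_tensFunctor H A hgr M
    exact ⟨Fin n, _, _, fun j => ⟨x j, tensFunctor_mem H A _ (hgr.coset_obj H _)⟩, h⟩

theorem isGradedModuleCategory_modGrading (hgr : gr.IsStrong) :
    gr.IsGradedModuleCategory (gr.modGrading H A.obj) where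
  isModuleCategory := RightMod.isModuleCategory k A.obj
  isGrading := isGrading_modGrading H A hgr
  action_mem {σ x V Y} hV hY := gr.restrict_tensor (S := {σ}) (by
    rintro s rfl t ht
    exact congrArg (fun y : G ⧸ H => s • y) ht) (gr.restrict_of_comp (Set.mem_singleton _) hV) hY

instance : HasFiniteBiproducts (RightMod A.obj) :=
  have := Abelian.hasFiniteBiproducts (C := C)
  RightMod.hasFiniteBiproducts

variable (gr) in
/-- The functor `C ⊠_{C_H} (C_H)_A ⥤ C_A` that sends `[V, Y]` to `V ⊗ Y`. -/
abbrev boxFunctor : BoxTensor k (gr.sub H).FullSubcategory C (RightMod A) ⥤ RightMod A.obj :=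
  matLift (gr.tensFunctor H A)

variable (gr) in
/-- The coherent natural isomorphisms `X ⊗ F Z ≅ F (X ⊗ Z)`. -/
instance boxLeftLinear : (gr.boxFunctor H A).LeftLinear C :=
  matLiftLeftLinear (gr.tensFunctor H A) C k

theorem boxFunctor_isEquivalence (hgr : gr.IsStrong) : (gr.boxFunctor H A).IsEquivalence :=
  have := tensFunctor_faithful H A hgr
  have := tensFunctor_full H A hgr
  have : (gr.boxFunctor H A).EssSurj := matLift_essSurj _ fun M => by
    obtain ⟨n, x, h⟩ := isDirectSum_tensFunctor H A hgr M
    exact ⟨Fin n, _, _, h⟩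
  { }

/-- For the converse, if the image `M` of `Z` has degree `x`, the projection to that degree is the
identity. So `M` is isomorphic to the image of the single symbol `[V, (W ⊗ M)_H]` with `V` in `C_x`,
and full faithfulness lifts this to an isomorphism with `Z`. -/
theorem boxGrading_iff (hgr : gr.IsStrong) (x : G ⧸ H)
    (Z : BoxTensor k (gr.sub H).FullSubcategory C (RightMod A)) :
    gr.boxGrading H (RightMod A) x Z ↔ gr.modGrading H A.obj x ((gr.boxFunctor H A).obj Z) := by
  have hF := boxFunctor_isEquivalence H A hgr
  constructor
  · rintro ⟨J, _, V, hV, hZ⟩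
    refine modGrading_closed H A.obj x _ ⟨J, _, _, fun j => ?_, hZ.map (gr.boxFunctor H A)⟩
    obtain ⟨W, Y, hW, h⟩ := hV j
    rw [h]
    exact ((isGrading_modGrading H A hgr).iso x).of_iso
      (matLiftEmbeddingIso (gr.tensFunctor H A) ⟨W, Y⟩).symm (tensFunctor_mem H A ⟨W, Y⟩ hW)
  · intro h
    let M := (gr.boxFunctor H A).obj Z
    let p := (gr.symFunctor H A (hgr.obj x.out) (hgr.inv x.out)).obj M
    let e : (gr.tensFunctor H A).obj p ≅ M :=
      { hom := gr.ofMod H A (hgr.unitIso x.out) M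
        inv := gr.toMod H A (hgr.unitIso x.out) M
        hom_inv_id := RightMod.hom_ext (gr.ofPart_toPart H _ _)
        inv_hom_id := RightMod.hom_ext ((gr.toPart_ofPart H _ (hgr.comp_inv _) M.X).trans (by
          rw [QuotientGroup.out_eq']
          exact gr.proj_of_mem h)) }
    let e' : box k (gr.sub H).FullSubcategory p.left p.right ≅ Z :=
      (gr.boxFunctor H A).preimageIso (matLiftEmbeddingIso (gr.tensFunctor H A) p ≪≫ e)
    exact sumsOf_of_iso e' (sumsOf_of ⟨_, _, hgr.coset_obj H x, rfl⟩)

/-- Kernels, exactness and the vanishing of morphisms between components are hard to see from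
generators and relations; all of them are pulled back from the modules along the equivalence. -/
theorem isGradedModuleCategory_boxGrading (hgr : gr.IsStrong) :
    gr.IsGradedModuleCategory (gr.boxGrading H (RightMod A)) := by
  have hF := boxFunctor_isEquivalence H A hgr
  have hb : BilinearAction k C (BoxTensor k (gr.sub H).FullSubcategory C (RightMod A)) :=
    matAction_bilinear k C
  have hM := isGradedModuleCategory_modGrading H A hgr
  exact
  { isModuleCategory := IsModuleCategory.of_isEquivalence (gr.boxFunctor H A) hM.isModuleCategory
    isGrading := hM.isGrading.of_isEquivalence (gr.boxFunctor H A) (boxGrading_iff H A hgr)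
    action_mem := fun {σ x V Y} hV hY => (boxGrading_iff H A hgr _ _).2
      ((hM.isGrading.iso _).of_iso (Functor.LeftLinear.μₗIso (gr.boxFunctor H A) V Y)
        (hM.action_mem hV ((boxGrading_iff H A hgr _ _).1 hY))) }

end TensorGrading

end TensorClifford

end

theorem mainTheorem11 {k : Type*} [Field k] {G : Type*} [Group G] {C : Type*} [Category* C]
    [Abelian C] [Linear k C] [MonoidalCategory C] [MonoidalPreadditive C] [MonoidalLinear k C]
    [TensorClifford.TensorCategory k C] (gr : TensorClifford.TensorGrading k G C)
    (hgr : gr.IsStrong) (H : Subgroup G) (A : (gr.sub H).FullSubcategory) [MonObj A] :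
    gr.IsGradedModuleCategory (gr.boxGrading H (TensorClifford.RightMod A)) ∧
    gr.IsGradedModuleCategory (gr.modGrading H A.obj) ∧
    ∃ (F : TensorClifford.BoxTensor k (gr.sub H).FullSubcategory C (TensorClifford.RightMod A) ⥤
        TensorClifford.RightMod A.obj) (_ : F.LeftLinear C),
      F.Additive ∧ F.Linear k ∧ F.IsEquivalence ∧
      ∀ (x : G ⧸ H) (Z : TensorClifford.BoxTensor k (gr.sub H).FullSubcategory C
          (TensorClifford.RightMod A)),
        gr.boxGrading H (TensorClifford.RightMod A) x Z ↔ gr.modGrading H A.obj x (F.obj Z) := by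
  exact ⟨TensorClifford.TensorGrading.isGradedModuleCategory_boxGrading H A hgr,
    TensorClifford.TensorGrading.isGradedModuleCategory_modGrading H A hgr,
    gr.boxFunctor H A, inferInstance, inferInstance, inferInstance,
    TensorClifford.TensorGrading.boxFunctor_isEquivalence H A hgr,
    TensorClifford.TensorGrading.boxGrading_iff H A hgr⟩
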